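/- Let $d\ge 2$. Write $z=(x,v)\in\mathbf R^{d}\times\mathbf R^d=\mathbf R^{2d}$ and $Z_s=(z_1,\dots,z_s)$, $E_0(Z_s)=\sum_{i\le s}|v_i|^2/2$, $$\Omega_s=\{Z_s\in\mathbf R^{2ds}: x_i\ne x_j \ \forall i\neq j\},\qquad \mathcal D_s^{\varepsilon}=\{Z_s\in\mathbf R^{2ds}: |x_i-x_j|>\varepsilon\ \forall i\ne j\}.$$ For $\beta>0$, $\mu\in\mathbf R$, $\varepsilon>0$ put $$\|G\|_{\varepsilon,\beta,\mu}=\sup_{s\ge1}\,e^{\mu s}\sup_{Z_s\in\mathcal D^\varepsilon_s}|g_s(Z_s)|e^{\beta E_0(Z_s)},\qquad \|G\|_{0,\beta,\mu}=\sup_{s\ge1}\,e^{\mu s}\sup_{Z_s\in\Omega_s}|g_s(Z_s)|e^{\beta E_0(Z_s)},$$ and, for $g:\mathbf R^{2d}\to\mathbf R$, $|g|_{0,1,\beta}=\sup_{z}|g(z)|e^{\beta|v|^2/2}$. A *consistent family of marginals* is a sequence $F_0=(f_0^{(s)})_{s\ge1}$ of functions on $\Omega_s$, each nonnegative, integrable,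 continuous on $\Omega_s$ and invariant under permutations of the particles, with $\int f_0^{(1)}=1$ and, for all $s\ge1$ and $Z_s\in\Omega_s$, $\int_{\mathbf R^{2d}} f_0^{(s+1)}(Z_s,z)\,dz=f_0^{(s)}(Z_s)$ (the integral being convergent). For $N\ge1$ let $\varepsilon_N=N^{-1/(d-1)}$, i.e. $N\varepsilon_N^{d-1}=1$. A *BBGKY datum* for $N$ particles is a permutation-invariant probability density $f_{0,N}^{(N)}$ on $\mathcal D_N^{\varepsilon_N}$ whose marginals $$f_{0,N}^{(s)}(Z_s)=\int_{\mathbf R^{2d(N-s)}}\mathbf 1_{Z_N\in\mathcal D_N^{\varepsilon_N}}\,f_{0,N}^{(N)}(Z_N)\,dz_{s+1}\cdots dz_N,\qquad 1\le s\le N,$$ are given by convergent integrals at every point of $\mathcal D_s^{\varepsilon_N}$ and are continuous on $\mathcal D_s^{\varepsilon_N}$; $F_{0,N}=(f_{0,N}^{(s)})_{s\ge1}$, with $f_{0,N}^{(s)}=0$ for $s>N$. A consistent family of marginals $F_0$ is an *admissible Boltzmann datum* if there are BBGKY data $F_{0,N}$, $N\ge1$, with $\sup_{N\ge1}\|F_{0,N}\|_{\varepsilon_N,\beta,\mu}<\infty$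 for some $\beta>0$, $\mu\in\mathbf R$, such that for every $s\ge1$, $f_{0,N}^{(s)}\to f_0^{(s)}$ locally uniformly in $\Omega_s$ as $N\to\infty$. **Proposition.** (1) $F_0$ is an admissible Boltzmann datum if and only if $F_0$ is a consistent family of marginals and $\|F_0\|_{0,\beta_0,\mu_0}<\infty$ for some $\beta_0>0$ and $\mu_0\in\mathbf R$. (2) If $F_0$ is a consistent family of marginals with $\|F_0\|_{0,\beta_0,\mu_0}<\infty$, where $\beta_0>0$ and $\mu_0\in\mathbf R$, then there is a probability measure $\pi$ on a set of (measurable) probability densities $g$ on $\mathbf R^{2d}$ satisfying $|g|_{0,1,\beta_0}\le e^{-\mu_0}$, with respect to a $\sigma$-algebra for which $(g,z)\mapsto g(z)$ is jointly measurable, such that for all $s\ge1$ and all $Z_s\in\Omega_s$ $$f_0^{(s)}(Z_s)=\int g^{\otimes s}(Z_s)\,d\pi(g),\qquad g^{\otimes s}(Z_s)=\prod_{i=1}^s g(z_i).$$ -/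

import Mathlib

open MeasureTheory Filter Topology
open scoped ENNReal

noncomputable section

/-- The one-particle phase space: a pair `z = (x, v)`, a position and a velocity in `ℝ^d` with
the Euclidean norm. -/
abbrev Phase (d : ℕ) : Type := EuclideanSpace ℝ (Fin d) × EuclideanSpace ℝ (Fin d)

/-- Configurations `Z_s = (z_1, …, z_s)` of `s` particles. -/
abbrev Config (d s : ℕ) : Type := Fin s → Phase d

/-- `Ω_s`: configurations in which no two particles have the same position. -/
def offDiag (d s : ℕ) : Set (Config d s) :=
  {Z | ∀ i j, i ≠ j → (Z i).1 ≠ (Z j).1}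

/-- `𝒟_s`: configurations of `s` non-overlapping hard spheres of diameter `ε`. -/
def hardSphere (d : ℕ) (ε : ℝ) (s : ℕ) : Set (Config d s) :=
  {Z | ∀ i j, i ≠ j → ε < ‖(Z i).1 - (Z j).1‖}

/-- The diameter `ε = N^{-1/(d-1)}`, i.e. the solution of `N ε^{d-1} = 1` (for `N ≥ 1`, `d ≥ 2`). -/
def bgDiameter (d N : ℕ) : ℝ := (N : ℝ) ^ (-(1 / ((d : ℝ) - 1)))

/-- The free Hamiltonian `E₀(Z_s) = ∑ |v_i|² / 2`. -/
def freeEnergy {d s : ℕ} (Z : Config d s) : ℝ := ∑ i, ‖(Z i).2‖ ^ 2 / 2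

/-- `sup_{Z ∈ D} |g(Z)| exp (β E₀(Z))`, as an element of `[0, ∞]`. This is `|g|_{ε,s,β}` for
`D = 𝒟_s` and `|g|_{0,s,β}` for `D = Ω_s` or `D` the whole space. -/
def levelNorm {d s : ℕ} (D : Set (Config d s)) (β : ℝ) (g : Config d s → ℝ) : ℝ≥0∞ :=
  ⨆ Z ∈ D, ENNReal.ofReal (|g Z| * Real.exp (β * freeEnergy Z))

/-- `sup_{s ≥ 1} |g_s|_{s,β} exp (μ s)`, as an element of `[0, ∞]`. This is `‖G‖_{ε,β,μ}` for
`D s = 𝒟_s` and `‖G‖_{0,β,μ}` for `D s = Ω_s`. -/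
def familyNorm {d : ℕ} (D : ∀ s, Set (Config d s)) (β μ : ℝ) (G : ∀ s, Config d s → ℝ) : ℝ≥0∞ :=
  ⨆ (s : ℕ) (_ : 1 ≤ s), levelNorm (D s) β (G s) * ENNReal.ofReal (Real.exp (μ * s))

/-- A consistent family of marginals `F = (f^{(s)})_{s ≥ 1}`: each `f^{(s)}` is a symmetric
probability density, continuous on `Ω_s`, and `∫ f^{(s+1)}(Z_s, z) dz = f^{(s)}(Z_s)` at every
point of `Ω_s`. Only the values on `Ω_s`, for `s ≥ 1`, matter. -/
structure IsMarginalFamily {d : ℕ} (F : ∀ s, Config d s → ℝ) : Prop where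
  nonneg : ∀ s, 1 ≤ s → ∀ Z ∈ offDiag d s, 0 ≤ F s Z
  integrable : ∀ s, 1 ≤ s → IntegrableOn (F s) (offDiag d s)
  continuous : ∀ s, 1 ≤ s → ContinuousOn (F s) (offDiag d s)
  symm : ∀ s, 1 ≤ s → ∀ (σ : Equiv.Perm (Fin s)), ∀ Z ∈ offDiag d s, F s (Z ∘ σ) = F s Z
  consistent : ∀ s, 1 ≤ s → ∀ Z ∈ offDiag d s,
    Integrable (fun z : Phase d => F (s + 1) (Fin.snoc (α := fun _ => Phase d) Z z)) ∧
      ∫ z : Phase d, F (s + 1) (Fin.snoc (α := fun _ => Phase d) Z z) = F s Z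
  normalized : ∫ Z in offDiag d 1, F 1 Z = 1

/-- The configuration `(Z_s, z_{s+1}, …, z_N)` (for `s ≤ N`). -/
def glue {d N s : ℕ} (Z : Config d s) (W : Config d (N - s)) : Config d N :=
  fun i => if h : i.1 < s then Z ⟨i.1, h⟩ else W ⟨i.1 - s, by omega⟩

/-- `Z_N ↦ 1_{Z_N ∈ 𝒟_N} f(Z_N)`. -/
def cutoff {d N : ℕ} (ε : ℝ) (f : Config d N → ℝ) : Config d N → ℝ :=
  (hardSphere d ε N).indicator f

/-- The sequence of marginals of an `N`-particle function `f`: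
`f^{(s)}(Z_s) = ∫ 1_{Z_N ∈ 𝒟_N} f(Z_N) dz_{s+1} … dz_N` for `s ≤ N` (for `s = N` nothing is
integrated), and `0` for `s > N`. -/
def marginal {d N : ℕ} (ε : ℝ) (f : Config d N → ℝ) (s : ℕ) : Config d s → ℝ :=
  if s ≤ N then fun Z => ∫ W : Config d (N - s), cutoff ε f (glue Z W) else 0

/-- `N`-particle BBGKY initial data: a symmetric probability density `f` on `𝒟_N` whose marginals
`f^{(s)}`, `1 ≤ s ≤ N`, are given by convergent integrals at every point of `𝒟_s` and are
continuous on `𝒟_s`. -/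
structure IsBBGKYDatum {d N : ℕ} (ε : ℝ) (f : Config d N → ℝ) : Prop where
  nonneg : ∀ Z ∈ hardSphere d ε N, 0 ≤ f Z
  symm : ∀ (σ : Equiv.Perm (Fin N)), ∀ Z ∈ hardSphere d ε N, f (Z ∘ σ) = f Z
  integrable : IntegrableOn f (hardSphere d ε N)
  normalized : ∫ Z in hardSphere d ε N, f Z = 1
  slice_integrable : ∀ s, 1 ≤ s → s ≤ N → ∀ Z ∈ hardSphere d ε s,
    Integrable (fun W : Config d (N - s) => cutoff ε f (glue Z W))
  continuous : ∀ s, 1 ≤ s → s ≤ N → ContinuousOn (marginal ε f s) (hardSphere d ε s)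

/-- Admissible Boltzmann data: consistent families of marginals that are limits, locally uniformly
in `Ω_s` for each `s`, of the marginals of BBGKY initial data with `N ε^{d-1} = 1`, these being
bounded in `‖·‖_{ε,β,μ}` uniformly in `N ≥ 1` for some `β > 0` and `μ ∈ ℝ`. -/
def IsAdmissible {d : ℕ} (F : ∀ s, Config d s → ℝ) : Prop :=
  IsMarginalFamily F ∧
  ∃ f : ∀ N, Config d N → ℝ,
    (∀ N, 1 ≤ N → IsBBGKYDatum (bgDiameter d N) (f N)) ∧
    (∃ β : ℝ, 0 < β ∧ ∃ μ : ℝ,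
      (⨆ (N : ℕ) (_ : 1 ≤ N),
        familyNorm (hardSphere d (bgDiameter d N)) β μ (marginal (bgDiameter d N) (f N))) < ⊤) ∧
    ∀ s, 1 ≤ s → TendstoLocallyUniformlyOn
      (fun N : ℕ => marginal (bgDiameter d N) (f N) s) (F s) atTop (offDiag d s)

/-- Probability densities on the one-particle phase space (functions, not classes modulo null
sets). -/
structure ProbDensity (d : ℕ) where
  toFun : Phase d → ℝ
  measurable : Measurable toFun
  nonneg : ∀ z, 0 ≤ toFun z
  integrable : Integrable toFun
  normalized : ∫ z, toFun z = 1

/-- The tensor power `g^{⊗ s}(Z_s) = ∏ g(z_i)`. -/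
def ProbDensity.tensorPower {d : ℕ} (g : ProbDensity d) (s : ℕ) (Z : Config d s) : ℝ :=
  ∏ i, g.toFun (Z i)

/-- `F` is a mixture `f^{(s)} = ∫ g^{⊗ s} dπ(g)` on `Ω_s`, `s ≥ 1`, where `π` is a probability
measure on a set `S` of probability densities `g` with `|g|_{0,1,β} ≤ e^{-μ}`. The `σ`-algebra on
`S` is one for which `(g, z) ↦ g(z)` is jointly measurable. -/
def IsTensorMixture {d : ℕ} (β μ : ℝ) (F : ∀ s, Config d s → ℝ) : Prop :=
  ∃ (S : Set (ProbDensity d)) (_ : MeasurableSpace S) (π : Measure S),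
    IsProbabilityMeasure π ∧
    Measurable (fun p : S × Phase d => p.1.1.toFun p.2) ∧
    (∀ g ∈ S, levelNorm Set.univ β (g.tensorPower 1) ≤ ENNReal.ofReal (Real.exp (-μ))) ∧
    ∀ s, 1 ≤ s → ∀ Z ∈ offDiag d s,
      Integrable (fun g : S => g.1.tensorPower s Z) π ∧
        F s Z = ∫ g : S, g.1.tensorPower s Z ∂π

end

/-! Part (2) is de Finetti's theorem, made to hold at every point of Ω_s and not only almost
everywhere. A density g is encoded by the numbers θ_b = ∫_b g, where b runs over a countable basis
of the phase space and the whole space. For Z in Ω_s the functions F_{s+k}(Z, ·), k ≥ 0, are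
densities of an exchangeable consistent family of mass F_s(Z), so `exists_momentMeasure` yields a
measure m_Z on the cube of all θ whose moments are the box masses of that family. By
Stone–Weierstrass and Scheffé, ∫ f dm_Z is continuous in Z for continuous f; and integrating
m_{(Z,z)} over z in b multiplies m_Z by θ_b (`setIntegral_momentMeasure_snoc`).

Let π = m_∅. The norm bound reads F_s ≤ C M^{⊗s} with M(z) = e^{-μ₀} e^{-β₀|v|²/2}. Letting the
order of the moments tend to infinity removes C: almost surely θ_b ≤ ∫_b M when M is integrable on
b, hence m_z ≤ M(z) π. A jointly measurable Radon–Nikodym derivative g_θ(z) of m_z is therefore at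
most M(z), and its integral over b is θ_b almost surely. By induction on s, m_Z = ∏ g_θ(z_i) π at
every Z in Ω_s (`integral_momentMeasure_eq`): as functions of the last particle, both sides are
continuous when integrated against f, and have equal integrals over every b. Comparing total masses
gives the representation.

In part (1), every point of Ω_s lies in 𝒟_s for all large N, so the uniform bound passes to the
limit. Conversely, each g_θ is conditioned on non-overlap separately, and the conditioned laws are
averaged over π. Under g_θ a ball of radius ε in position has probability at most κ = K ε^d,
uniformly in θ, and N ε_N^d = ε_N → 0. The probability of non-overlap of N particles is never
compared with 1; only its ratios under removal of boundedly many particles are, and union bounds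
place these within powers of 1 - Nκ. So the marginals are at most 2^s M^{⊗s} for large N and
converge uniformly where particles are at least a fixed distance apart. The finitely many remaining
N are filled with conditioned Gaussian particles. -/

noncomputable section

/-! ### Exchangeable families of measures and their moment measures -/

section MomentMeasure

variable {X ι : Type*}

/-- The monomial `θ ↦ ∏ j, θ (I j)` on the cube `[0, 1]^ι`. -/
def momentMonomial {k : ℕ} (I : Fin k → ι) : C(ι → unitInterval, ℝ) where
  toFun θ := ∏ j, (θ (I j) : ℝ)
  continuous_toFun := by fun_prop

@[simp] lemma momentMonomial_apply {k : ℕ} (I : Fin k → ι) (θ : ι → unitInterval) :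
    momentMonomial I θ = ∏ j, (θ (I j) : ℝ) := rfl

/-- The fraction of the points `W_1, …, W_N` lying in each of the sets `B i`. -/
def empiricalFractions (B : ι → Set X) (N : ℕ) (W : Fin N → X) (i : ι) : unitInterval :=
  ⟨(∑ l, (B i).indicator (fun _ => (1 : ℝ)) (W l)) / N, by
    have h0 : ∀ l : Fin N, 0 ≤ (B i).indicator (fun _ => (1 : ℝ)) (W l) :=
      fun l => Set.indicator_nonneg (fun _ _ => zero_le_one) _
    have h1 : ∀ l : Fin N, (B i).indicator (fun _ => (1 : ℝ)) (W l) ≤ 1 :=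
      fun l => Set.indicator_le_self' (fun _ _ => zero_le_one) _
    refine ⟨div_nonneg (Finset.sum_nonneg fun l _ => h0 l) (Nat.cast_nonneg _), ?_⟩
    refine div_le_one_of_le₀ ?_ (Nat.cast_nonneg _)
    calc _ ≤ ∑ l : Fin N, (1 : ℝ) := Finset.sum_le_sum fun l _ => h1 l
      _ = N := by simp⟩

lemma measurable_empiricalFractions [MeasurableSpace X] {B : ι → Set X} (hB : ∀ i, MeasurableSet (B i)) (N : ℕ) :
    Measurable (empiricalFractions B N) := by
  refine measurable_pi_lambda _ fun i => Measurable.subtype_mk ?_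
  refine (Finset.measurable_sum _ fun l _ => ?_).div_const _
  exact (measurable_const.indicator (hB i)).comp (measurable_pi_apply l)

/-- Expanding the product of k sums produces all maps τ, repetitions included: a moment of the
empirical fractions is sampling with replacement. -/
lemma momentMonomial_empiricalFractions (B : ι → Set X) {N k : ℕ} (I : Fin k → ι)
    (W : Fin N → X) :
    momentMonomial I (empiricalFractions B N W) =
      (∑ τ : Fin k → Fin N,
        {W : Fin N → X | ∀ j, W (τ j) ∈ B (I j)}.indicator (fun _ => (1 : ℝ)) W) / N ^ k := by
  classical
  simp only [momentMonomial_apply, empiricalFractions]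
  rw [Finset.prod_div_distrib, Finset.prod_univ_sum]
  simp only [Finset.prod_const, Finset.card_univ, Fintype.card_fin, Fintype.piFinset_univ]
  congr 1
  refine Finset.sum_congr rfl fun τ _ => ?_
  simp only [Set.indicator_apply, Set.mem_ofPred_eq, Finset.prod_ite_zero, Finset.prod_const_one,
    Finset.mem_univ, true_imp_iff]

variable [MeasurableSpace X]

/-- A family of measures on the finite powers of `X` is exchangeable and consistent. -/
structure IsExchangeableFamily (ν : ∀ k, Measure (Fin k → X)) : Prop where
  finite : ∀ k, IsFiniteMeasure (ν k)
  symm : ∀ k (σ : Equiv.Perm (Fin k)), (ν k).map (fun W => W ∘ σ) = ν k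
  consistent : ∀ k, (ν (k + 1)).map (fun W => W ∘ Fin.castSucc) = ν k

namespace IsExchangeableFamily

variable {ν : ∀ k, Measure (Fin k → X)}

lemma map_castLE (hν : IsExchangeableFamily ν) {k n : ℕ} (h : k ≤ n) :
    (ν n).map (fun W => W ∘ Fin.castLE h) = ν k := by
  induction n, h using Nat.le_induction with
  | base => simp
  | succ n h ih =>
    rw [← ih, ← hν.consistent n, Measure.map_map (by fun_prop) (by fun_prop)]
    rfl

/-- Permutations act transitively on injections, so τ is the initial inclusion followed by a
permutation; exchangeability absorbs the latter and consistency handles the former. -/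
lemma map_embedding (hν : IsExchangeableFamily ν) {k n : ℕ} {τ : Fin k → Fin n}
    (hτ : Function.Injective τ) :
    (ν n).map (fun W => W ∘ τ) = ν k := by
  have hkn : k ≤ n := by simpa using Fintype.card_le_of_injective τ hτ
  have : MulAction.IsMultiplyPretransitive (Equiv.Perm (Fin n)) (Fin n) k :=
    Equiv.Perm.isMultiplyPretransitive (Fin n) k
  obtain ⟨σ, hσ⟩ := MulAction.exists_smul_eq (Equiv.Perm (Fin n)) (Fin.castLEEmb hkn) ⟨τ, hτ⟩
  have h : τ = σ ∘ Fin.castLE hkn := by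
    funext j
    have := DFunLike.congr_fun hσ j
    simpa using this.symm
  rw [← hν.map_castLE hkn]
  conv_rhs => rw [← hν.symm n σ]
  rw [Measure.map_map (by fun_prop) (by fun_prop), h]
  rfl

lemma measure_univ (hν : IsExchangeableFamily ν) (k : ℕ) :
    ν k Set.univ = ν 0 Set.univ := by
  rw [← hν.map_castLE (Nat.zero_le k), Measure.map_apply (by fun_prop) MeasurableSet.univ,
    Set.preimage_univ]

lemma measurableSet_box {B : ι → Set X} (hB : ∀ i, MeasurableSet (B i)) {k n : ℕ}
    (I : Fin k → ι) (τ : Fin k → Fin n) :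
    MeasurableSet {W : Fin n → X | ∀ j, W (τ j) ∈ B (I j)} := by
  rw [Set.ofPred_forall]
  exact MeasurableSet.iInter fun j => (measurable_pi_apply (τ j)) (hB _)

/-- Sampling with and without replacement agree asymptotically. Each injective τ contributes exactly
the limit value, any other τ errs by at most the total mass c, and the proportion of the latter, 1 -
N(N-1)⋯(N-k+1)/N^k, tends to 0. -/
lemma tendsto_integral_empirical (hν : IsExchangeableFamily ν) {B : ι → Set X}
    (hB : ∀ i, MeasurableSet (B i)) {k : ℕ} (I : Fin k → ι) :
    Tendsto (fun N => ∫ W, momentMonomial I (empiricalFractions B N W) ∂(ν N)) atTop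
      (𝓝 ((ν k).real {W | ∀ j, W j ∈ B (I j)})) := by
  classical
  have := hν.finite
  set v := (ν k).real {W | ∀ j, W j ∈ B (I j)} with hv
  set c := (ν 0).real Set.univ
  have hc : ∀ n, (ν n).real Set.univ = c := fun n => by
    simp only [c, measureReal_def, hν.measure_univ n]
  let a : ∀ N, (Fin k → Fin N) → ℝ := fun N τ => (ν N).real {W | ∀ j, W (τ j) ∈ B (I j)}
  have ha : ∀ N τ, Function.Injective τ → a N τ = v := by
    intro N τ hτ
    simp only [a, hv, measureReal_def]
    rw [← hν.map_embedding hτ, Measure.map_apply (by fun_prop) (by exact measurableSet_box hB I id)]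
    rfl
  have hbd : ∀ N τ, |a N τ - v| ≤ c := by
    intro N τ
    rw [abs_le]
    have h1 : a N τ ≤ c := (measureReal_mono (Set.subset_univ _)).trans (hc N).le
    have h2 : v ≤ c := (measureReal_mono (Set.subset_univ _)).trans (hc k).le
    have h3 : 0 ≤ a N τ := measureReal_nonneg
    have h4 : 0 ≤ v := measureReal_nonneg
    constructor <;> linarith
  have hint : ∀ N, ∫ W, momentMonomial I (empiricalFractions B N W) ∂(ν N) =
      (∑ τ, a N τ) / N ^ k := by
    intro N
    simp_rw [momentMonomial_empiricalFractions]
    rw [integral_div, integral_finsetSum]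
    · congr 1
      refine Finset.sum_congr rfl fun τ _ => ?_
      rw [integral_indicator (measurableSet_box hB I τ)]
      simp [a]
    · intro τ _
      exact (integrable_const _).indicator (measurableSet_box hB I τ)
  have hcard : ∀ N, ((Finset.univ.filter fun τ : Fin k → Fin N => Function.Injective τ).card : ℝ)
      = N.descFactorial k := by
    intro N
    rw [← Fintype.card_subtype,
      Fintype.card_congr (Equiv.subtypeInjectiveEquivEmbedding (Fin k) (Fin N)),
      Fintype.card_embedding_eq]
    simp
  have hest : ∀ N, |(∑ τ, a N τ) - N ^ k * v| ≤ c * (N ^ k - N.descFactorial k) := by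
    intro N
    have e1 : (∑ τ, a N τ) - N ^ k * v = ∑ τ : Fin k → Fin N, (a N τ - v) := by
      simp
    rw [e1]
    refine (Finset.abs_sum_le_sum_abs _ _).trans ?_
    calc ∑ τ : Fin k → Fin N, |a N τ - v|
        ≤ ∑ τ : Fin k → Fin N, (if Function.Injective τ then 0 else c) := by
          refine Finset.sum_le_sum fun τ _ => ?_
          split_ifs with h
          · simp [ha N τ h]
          · exact hbd N τ
      _ = ∑ τ : Fin k → Fin N, (c - if Function.Injective τ then c else 0) := by
          refine Finset.sum_congr rfl fun τ _ => ?_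
          split_ifs <;> simp
      _ = c * (N ^ k - N.descFactorial k) := by
          rw [Finset.sum_sub_distrib, ← Finset.sum_filter, Finset.sum_const, Finset.sum_const,
            nsmul_eq_mul, nsmul_eq_mul, hcard]
          simp
          ring
  have hlim : Tendsto (fun N : ℕ => c * (1 - (N.descFactorial k : ℝ) / N ^ k)) atTop (𝓝 0) := by
    have h1 : Tendsto (fun N : ℕ => (N.descFactorial k : ℝ) / N ^ k) atTop (𝓝 1) := by
      refine (Asymptotics.isEquivalent_iff_tendsto_one ?_).1 (isEquivalent_descFactorial k)
      filter_upwards [eventually_ge_atTop 1] with N hN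
      have : (N : ℝ) ≠ 0 := by positivity
      positivity
    have := (h1.const_sub 1).const_mul c
    simpa using this
  rw [tendsto_iff_norm_sub_tendsto_zero]
  refine squeeze_zero' (Eventually.of_forall fun _ => norm_nonneg _) ?_ hlim
  filter_upwards [eventually_ge_atTop 1] with N hN
  have hN0 : (0 : ℝ) < (N : ℝ) ^ k := by positivity
  rw [hint, Real.norm_eq_abs]
  have : (∑ τ, a N τ) / N ^ k - v = ((∑ τ, a N τ) - N ^ k * v) / N ^ k := by
    field_simp
  rw [this, abs_div, abs_of_pos hN0, div_le_iff₀ hN0]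
  refine (hest N).trans (le_of_eq ?_)
  field_simp

/-- **De Finetti's theorem, moment form**: an exchangeable consistent family of finite measures has
the moments of a measure on a cube. -/
theorem exists_momentMeasure [Countable ι] (hν : IsExchangeableFamily ν) {B : ι → Set X}
    (hB : ∀ i, MeasurableSet (B i)) :
    ∃ π : Measure (ι → unitInterval), IsFiniteMeasure π ∧
      ∀ (k : ℕ) (I : Fin k → ι),
        ∫ θ, momentMonomial I θ ∂π = (ν k).real {W | ∀ j, W j ∈ B (I j)} := by
  have := hν.finite
  let ρ : ℕ → FiniteMeasure (ι → unitInterval) := fun N =>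
    ⟨(ν N).map (empiricalFractions B N), inferInstance⟩
  have hmass : ∀ N, (ρ N).mass ≤ (ν 0 Set.univ).toNNReal := by
    intro N
    rw [← ENNReal.coe_le_coe, FiniteMeasure.ennreal_mass,
      ENNReal.coe_toNNReal (measure_ne_top _ _)]
    change (ν N).map (empiricalFractions B N) Set.univ ≤ _
    rw [Measure.map_apply (measurable_empiricalFractions hB N) MeasurableSet.univ,
      Set.preimage_univ, hν.measure_univ]
  -- On the compact cube, measures of bounded mass form a compact set. A limit along a nonprincipal
  -- ultrafilter takes the place of a subsequence.
  obtain ⟨π, -, hπ⟩ := (isCompact_setOfPred_finiteMeasure_le_of_compactSpace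
    (ι → unitInterval) (ν 0 Set.univ).toNNReal).ultrafilter_le_nhds'
      ((hyperfilter ℕ).map ρ) (by
        rw [Ultrafilter.mem_map]
        exact Filter.univ_mem' hmass)
  have hπ' : Tendsto ρ (hyperfilter ℕ : Filter ℕ) (𝓝 π) := hπ
  rw [FiniteMeasure.tendsto_iff_forall_integral_tendsto] at hπ'
  refine ⟨π, inferInstance, fun k I => ?_⟩
  refine tendsto_nhds_unique (hπ' (BoundedContinuousFunction.mkOfCompact (momentMonomial I))) ?_
  have h2 := (hν.tendsto_integral_empirical hB I).mono_left Nat.hyperfilter_le_atTop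
  refine h2.congr fun N => ?_
  change _ = ∫ x, momentMonomial I x ∂((ν N).map (empiricalFractions B N))
  rw [integral_map (measurable_empiricalFractions hB N).aemeasurable]
  exact (momentMonomial I).continuous.aestronglyMeasurable

end IsExchangeableFamily

/-- **Stone–Weierstrass on the cube**: a closed property of continuous functions that is stable
under linear combinations and holds for monomials holds for all of them. -/
theorem momentMonomial_induction {p : C(ι → unitInterval, ℝ) → Prop}
    (mono : ∀ (k : ℕ) (I : Fin k → ι), p (momentMonomial I))
    (zero : p 0) (add : ∀ f g, p f → p g → p (f + g)) (smul : ∀ (c : ℝ) f, p f → p (c • f))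
    (closed : ∀ f, (∀ ε > 0, ∃ g, p g ∧ ∀ θ, |f θ - g θ| ≤ ε) → p f)
    (f : C(ι → unitInterval, ℝ)) : p f := by
  let A : Subalgebra ℝ C(ι → unitInterval, ℝ) :=
    Algebra.adjoin ℝ (Set.range fun i : ι => momentMonomial (fun _ : Fin 1 => i))
  have hsep : A.SeparatesPoints := by
    intro x y hxy
    obtain ⟨i, hi⟩ := Function.ne_iff.1 hxy
    refine ⟨_, ⟨momentMonomial (fun _ : Fin 1 => i),
      Algebra.subset_adjoin (Set.mem_range_self i), rfl⟩, ?_⟩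
    simpa [Subtype.ext_iff] using fun h => hi (Subtype.ext h)
  -- The algebra generated by the coordinates is the linear span of their products, which are the
  -- monomials.
  have hA : ∀ g ∈ A, p g := by
    intro g hg
    have hmem : g ∈ Submodule.span ℝ (Submonoid.closure
        (Set.range fun i : ι => momentMonomial (fun _ : Fin 1 => i)) :
          Set C(ι → unitInterval, ℝ)) := by
      rw [← Algebra.adjoin_eq_span]; exact hg
    refine Submodule.span_induction (p := fun g _ => p g) ?_ zero (fun f g _ _ => add f g)
      (fun c f _ => smul c f) hmem
    intro m hm
    suffices ∃ (k : ℕ) (I : Fin k → ι), m = momentMonomial I by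
      obtain ⟨k, I, rfl⟩ := this
      exact mono k I
    refine Submonoid.closure_induction (motive := fun m _ =>
      ∃ (k : ℕ) (I : Fin k → ι), m = momentMonomial I) ?_ ?_ ?_ hm
    · rintro _ ⟨i, rfl⟩
      exact ⟨1, _, rfl⟩
    · exact ⟨0, Fin.elim0, by ext θ; simp⟩
    · rintro _ _ - - ⟨k, I, rfl⟩ ⟨l, J, rfl⟩
      refine ⟨k + l, Fin.append I J, ?_⟩
      ext θ
      simp [Fin.prod_univ_add]
  refine closed f fun ε hε => ?_
  obtain ⟨g, hg⟩ := ContinuousMap.exists_mem_subalgebra_near_continuousMap_of_separatesPoints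
    A hsep f ε hε
  refine ⟨g, hA g g.2, fun θ => ?_⟩
  have := (ContinuousMap.norm_coe_le_norm ((g : C(ι → unitInterval, ℝ)) - f) θ).trans hg.le
  rw [abs_sub_comm]
  simpa using this

end MomentMeasure

end

noncomputable section

/-! ### Integration over configurations -/

section PiMeasure

variable {X : Type*} [MeasurableSpace X] (μ : Measure X) [SigmaFinite μ]

lemma measurePreserving_insertNth {k : ℕ} (i : Fin (k + 1)) :
    MeasurePreserving (fun p : X × (Fin k → X) => i.insertNth (α := fun _ => X) p.1 p.2)
      (μ.prod (Measure.pi fun _ => μ)) (Measure.pi fun _ => μ) :=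
  (measurePreserving_piFinSuccAbove (fun _ : Fin (k + 1) => μ) i).symm

lemma lintegral_pi_insertNth {k : ℕ} (i : Fin (k + 1)) {G : (Fin (k + 1) → X) → ℝ≥0∞}
    (hG : AEMeasurable G (Measure.pi fun _ => μ)) :
    ∫⁻ W, G W ∂(Measure.pi fun _ => μ) =
      ∫⁻ z, ∫⁻ W, G (i.insertNth (α := fun _ => X) z W) ∂(Measure.pi fun _ => μ) ∂μ := by
  have h := measurePreserving_insertNth μ i
  rw [← h.map_eq, lintegral_map' (by rwa [h.map_eq]) h.measurable.aemeasurable, lintegral_prod]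
  exact hG.comp_quasiMeasurePreserving h.quasiMeasurePreserving

lemma lintegral_pi_snoc {k : ℕ} {G : (Fin (k + 1) → X) → ℝ≥0∞}
    (hG : AEMeasurable G (Measure.pi fun _ => μ)) :
    ∫⁻ W, G W ∂(Measure.pi fun _ => μ) =
      ∫⁻ W, ∫⁻ z, G (Fin.snoc (α := fun _ => X) W z) ∂μ ∂(Measure.pi fun _ => μ) := by
  have h := (measurePreserving_insertNth μ (Fin.last k)).comp
    (Measure.measurePreserving_swap (μ := Measure.pi fun _ : Fin k => μ) (ν := μ))
  rw [← h.map_eq, lintegral_map' (by rwa [h.map_eq]) h.measurable.aemeasurable, lintegral_prod]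
  · simp
  · exact hG.comp_quasiMeasurePreserving h.quasiMeasurePreserving

lemma ae_pi_insertNth {k : ℕ} (i : Fin (k + 1)) {p : (Fin (k + 1) → X) → Prop}
    (hp : MeasurableSet {W | p W})
    (h : ∀ᵐ W ∂(Measure.pi fun _ : Fin k => μ), ∀ᵐ z ∂μ, p (i.insertNth (α := fun _ => X) z W)) :
    ∀ᵐ W ∂(Measure.pi fun _ => μ), p W := by
  have hm := (measurePreserving_insertNth μ i).comp
    (Measure.measurePreserving_swap (μ := Measure.pi fun _ : Fin k => μ) (ν := μ))
  rw [← hm.map_eq, ae_map_iff hm.measurable.aemeasurable hp]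
  rw [Measure.ae_prod_iff_ae_ae]
  · exact h
  · exact hm.measurable hp

lemma measurePreserving_comp_perm {k : ℕ} (σ : Equiv.Perm (Fin k)) :
    MeasurePreserving (fun W : Fin k → X => W ∘ σ) (Measure.pi fun _ => μ)
      (Measure.pi fun _ => μ) :=
  (measurePreserving_piCongrLeft (fun _ : Fin k => μ) σ).symm

end PiMeasure

/-- **Scheffé's lemma**, integrated over a set. -/
lemma tendsto_setIntegral_of_tendsto_integral {α ι : Type*} [MeasurableSpace α] {μ : Measure α}
    {l : Filter ι} [l.IsCountablyGenerated] {f : ι → α → ℝ} {g : α → ℝ}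
    (hf : ∀ᶠ n in l, Integrable (f n) μ) (hf0 : ∀ᶠ n in l, 0 ≤ᵐ[μ] f n)
    (hg : Integrable g μ) (hlim : ∀ᵐ x ∂μ, Tendsto (fun n => f n x) l (𝓝 (g x)))
    (hint : Tendsto (fun n => ∫ x, f n x ∂μ) l (𝓝 (∫ x, g x ∂μ))) (A : Set α) :
    Tendsto (fun n => ∫ x in A, f n x ∂μ) l (𝓝 (∫ x in A, g x ∂μ)) := by
  -- Since f_n ≥ 0, the positive part of g - f_n is dominated by |g|. The identity |f_n - g| = (f_n
  -- - g) + 2 (g - f_n)⁺ then turns convergence of the integrals into L¹ convergence.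
  have hpos : Tendsto (fun n => ∫ x, max (g x - f n x) 0 ∂μ) l (𝓝 (∫ _, (0 : ℝ) ∂μ)) := by
    refine tendsto_integral_filter_of_dominated_convergence (fun x => |g x|) ?_ ?_ hg.abs ?_
    · filter_upwards [hf] with n hn
      exact ((hg.sub hn).aestronglyMeasurable.sup aestronglyMeasurable_const)
    · filter_upwards [hf0] with n hn
      filter_upwards [hn] with x hx
      have hx' : 0 ≤ f n x := hx
      rw [Real.norm_eq_abs, abs_of_nonneg (le_max_right _ _)]
      exact max_le ((sub_le_self _ hx').trans (le_abs_self _)) (abs_nonneg _)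
    · filter_upwards [hlim] with x hx
      simpa using (hx.const_sub (g x)).max (tendsto_const_nhds (x := (0 : ℝ)))
  have hL1 : Tendsto (fun n => ∫ x, |f n x - g x| ∂μ) l (𝓝 0) := by
    have h := (hint.sub_const (∫ x, g x ∂μ)).add (hpos.const_mul 2)
    simp only [integral_zero, mul_zero, add_zero, sub_self] at h
    refine h.congr' ?_
    filter_upwards [hf] with n hn
    rw [← integral_sub hn hg, ← integral_const_mul]
    have hi2 : Integrable (fun x => 2 * max (g x - f n x) 0) μ :=
      ((hg.sub hn).pos_part).const_mul 2
    have hi1 : Integrable (fun x => f n x - g x) μ := hn.sub hg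
    rw [← integral_add hi1 hi2]
    refine integral_congr_ae (Eventually.of_forall fun x => ?_)
    rcases le_total (f n x) (g x) with h | h
    · simp only [max_eq_left (sub_nonneg.2 h), abs_of_nonpos (sub_nonpos.2 h)]; ring
    · simp only [max_eq_right (sub_nonpos.2 h), abs_of_nonneg (sub_nonneg.2 h)]; ring
  rw [tendsto_iff_norm_sub_tendsto_zero]
  refine squeeze_zero' (Eventually.of_forall fun _ => norm_nonneg _) ?_ hL1
  filter_upwards [hf] with n hn
  rw [← integral_sub hn.integrableOn hg.integrableOn]
  refine (norm_integral_le_integral_norm _).trans ?_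
  exact setIntegral_le_integral (hn.sub hg).norm (Eventually.of_forall fun x => norm_nonneg _)

lemma ContinuousOn.aestronglyMeasurable_of_ae_mem {α : Type*} [TopologicalSpace α]
    [MeasurableSpace α] [OpensMeasurableSpace α] [SecondCountableTopology α] {μ : Measure α}
    {f : α → ℝ} {U : Set α} (hf : ContinuousOn f U) (hU : MeasurableSet U)
    (h : ∀ᵐ x ∂μ, x ∈ U) : AEStronglyMeasurable f μ := by
  rw [← Measure.restrict_eq_self_of_ae_mem h]
  exact hf.aestronglyMeasurable hU

/-! ### Configurations without coinciding positions -/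

section OffDiag

variable {d : ℕ}

lemma isOpen_offDiag (s : ℕ) : IsOpen (offDiag d s) := by
  have : offDiag d s = ⋂ i, ⋂ j, ⋂ (_ : i ≠ j), {Z | (Z i).1 ≠ (Z j).1} := by
    ext Z; simp [offDiag]
  rw [this]
  refine isOpen_iInter_of_finite fun i => isOpen_iInter_of_finite fun j =>
    isOpen_iInter_of_finite fun _ => ?_
  exact isOpen_ne_fun (by fun_prop) (by fun_prop)

lemma snoc_mem_offDiag {s : ℕ} {Z : Config d s} {z : Phase d} :
    Fin.snoc (α := fun _ => Phase d) Z z ∈ offDiag d (s + 1) ↔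
      Z ∈ offDiag d s ∧ ∀ i, (Z i).1 ≠ z.1 := by
  constructor
  · intro h
    refine ⟨fun i j hij => ?_, fun i => ?_⟩
    · simpa using h i.castSucc j.castSucc (by simpa using hij)
    · simpa using h i.castSucc (Fin.last s) (Fin.castSucc_ne_last i)
  · rintro ⟨h1, h2⟩ i j
    refine Fin.lastCases ?_ (fun _ => ?_) i <;> refine Fin.lastCases ?_ (fun _ => ?_) j
    · simp
    · intro _; simpa using (h2 _).symm
    · intro _; simpa using h2 _
    · intro hij; simpa using h1 _ _ (by simpa using hij)

variable [Nonempty (Fin d)]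

lemma ae_fst_ne (x : EuclideanSpace ℝ (Fin d)) : ∀ᵐ z : Phase d, x ≠ z.1 := by
  have h : ∀ᵐ y : EuclideanSpace ℝ (Fin d), x ≠ y := by
    filter_upwards [compl_mem_ae_iff.2 (measure_singleton (μ := volume) x)] with y hy h
    exact hy h.symm
  exact Measure.quasiMeasurePreserving_fst.ae h

lemma ae_snoc_mem_offDiag {s : ℕ} {Z : Config d s} (hZ : Z ∈ offDiag d s) :
    ∀ᵐ z : Phase d, Fin.snoc (α := fun _ => Phase d) Z z ∈ offDiag d (s + 1) := by
  simp_rw [snoc_mem_offDiag]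
  filter_upwards [ae_all_iff.2 fun i => ae_fst_ne (Z i).1] with z hz using ⟨hZ, hz⟩

omit [Nonempty (Fin d)] in
lemma continuous_append {s k : ℕ} :
    Continuous fun p : Config d s × Config d k => Fin.append p.1 p.2 := by
  refine continuous_pi fun i => ?_
  refine Fin.addCases (fun i => ?_) (fun i => ?_) i
  · simp only [Fin.append_left]; fun_prop
  · simp only [Fin.append_right]; fun_prop

omit [Nonempty (Fin d)] in
lemma continuous_snoc {s : ℕ} :
    Continuous fun p : Config d s × Phase d => Fin.snoc (α := fun _ => Phase d) p.1 p.2 := by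
  refine continuous_pi fun i => ?_
  refine Fin.lastCases ?_ (fun i => ?_) i
  · simp only [Fin.snoc_last]; fun_prop
  · simp only [Fin.snoc_castSucc]; fun_prop

omit [Nonempty (Fin d)] in
lemma isOpen_setOf_append_mem {s : ℕ} (Z : Config d s) (k : ℕ) :
    IsOpen {W : Config d k | Fin.append Z W ∈ offDiag d (s + k)} :=
  (isOpen_offDiag _).preimage (continuous_append.comp (Continuous.prodMk_right Z))

lemma ae_append_mem_offDiag {s : ℕ} {Z : Config d s} (hZ : Z ∈ offDiag d s) (k : ℕ) :
    ∀ᵐ W : Config d k, Fin.append Z W ∈ offDiag d (s + k) := by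
  induction k with
  | zero =>
    refine Eventually.of_forall fun W => ?_
    rwa [show W = Fin.elim0 from Subsingleton.elim _ _, Fin.append_elim0]
  | succ k ih =>
    refine ae_pi_insertNth volume (Fin.last k) (isOpen_setOf_append_mem Z (k + 1)).measurableSet ?_
    filter_upwards [ih] with W hW
    filter_upwards [ae_snoc_mem_offDiag hW] with z hz
    rwa [Fin.insertNth_last', Fin.append_snoc]

end OffDiag

/-! ### Conditional measures of a family of marginals -/

/-- A consistent family of marginals, extended to `s = 0` by the constant `1`. -/
structure IsExtendedFamily {d : ℕ} (F : ∀ s, Config d s → ℝ) : Prop where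
  nonneg : ∀ s, ∀ Z ∈ offDiag d s, 0 ≤ F s Z
  continuous : ∀ s, ContinuousOn (F s) (offDiag d s)
  symm : ∀ s (σ : Equiv.Perm (Fin s)), ∀ Z ∈ offDiag d s, F s (Z ∘ σ) = F s Z
  consistent : ∀ s, ∀ Z ∈ offDiag d s,
    Integrable (fun z : Phase d => F (s + 1) (Fin.snoc (α := fun _ => Phase d) Z z)) ∧
      ∫ z : Phase d, F (s + 1) (Fin.snoc (α := fun _ => Phase d) Z z) = F s Z
  zero : ∀ Z, F 0 Z = 1

/-- For fixed `Z_s`, the measure on `k` further particles with density `F_{s+k}(Z_s, ·)`. -/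
def condMeasure {d : ℕ} (F : ∀ s, Config d s → ℝ) {s : ℕ} (Z : Config d s) (k : ℕ) :
    Measure (Config d k) :=
  volume.withDensity fun W => ENNReal.ofReal (F (s + k) (Fin.append Z W))

/-- Transports values between equal but not definitionally equal particle numbers, such as (s + 1) +
k and s + (k + 1). -/
lemma family_comp_cast {d : ℕ} (F : ∀ s, Config d s → ℝ) {m n : ℕ} (h : m = n)
    (Z : Config d n) : F m (Z ∘ Fin.cast h) = F n Z := by
  subst h; rfl

namespace IsExtendedFamily

variable {d : ℕ} [Nonempty (Fin d)] {F : ∀ s, Config d s → ℝ} (hF : IsExtendedFamily F)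
  {s : ℕ} {Z : Config d s}

include hF

omit [Nonempty (Fin d)] in
lemma continuousOn_append (Z : Config d s) (k : ℕ) :
    ContinuousOn (fun W : Config d k => F (s + k) (Fin.append Z W))
      {W | Fin.append Z W ∈ offDiag d (s + k)} :=
  (hF.continuous _).comp (continuous_append.comp (Continuous.prodMk_right Z)).continuousOn
    fun _ hW => hW

lemma aestronglyMeasurable_append (hZ : Z ∈ offDiag d s) (k : ℕ) :
    AEStronglyMeasurable (fun W : Config d k => F (s + k) (Fin.append Z W)) :=
  (hF.continuousOn_append Z k).aestronglyMeasurable_of_ae_mem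
    (isOpen_setOf_append_mem Z k).measurableSet (ae_append_mem_offDiag hZ k)

lemma ae_append_nonneg (hZ : Z ∈ offDiag d s) (k : ℕ) :
    0 ≤ᵐ[volume] fun W : Config d k => F (s + k) (Fin.append Z W) := by
  filter_upwards [ae_append_mem_offDiag hZ k] with W hW using hF.nonneg _ _ hW

lemma lintegral_snoc (hZ : Z ∈ offDiag d s) :
    ∫⁻ z : Phase d, ENNReal.ofReal (F (s + 1) (Fin.snoc (α := fun _ => Phase d) Z z)) =
      ENNReal.ofReal (F s Z) := by
  rw [← (hF.consistent s Z hZ).2, ofReal_integral_eq_lintegral_ofReal (hF.consistent s Z hZ).1]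
  filter_upwards [ae_snoc_mem_offDiag hZ] with z hz using hF.nonneg _ _ hz

lemma map_condMeasure_castSucc (hZ : Z ∈ offDiag d s) (k : ℕ) :
    (condMeasure F Z (k + 1)).map (fun W => W ∘ Fin.castSucc) = condMeasure F Z k := by
  ext A hA
  have hm : Measurable fun W : Config d (k + 1) => W ∘ Fin.castSucc := by fun_prop
  have hmeas := (hF.aestronglyMeasurable_append hZ (k + 1)).aemeasurable.ennreal_ofReal
  rw [Measure.map_apply hm hA, condMeasure, condMeasure, withDensity_apply _ (hm hA),
    withDensity_apply _ hA, ← lintegral_indicator (hm hA), ← lintegral_indicator hA]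
  rw [volume_pi, lintegral_pi_snoc volume (hmeas.indicator (hm hA))]
  refine lintegral_congr_ae ?_
  filter_upwards [ae_append_mem_offDiag hZ k] with W hW
  by_cases h : W ∈ A
  · rw [Set.indicator_of_mem h]
    rw [← hF.lintegral_snoc hW]
    refine lintegral_congr fun z => ?_
    rw [Set.indicator_of_mem, Fin.append_snoc]
    · rfl
    · have : Fin.snoc (α := fun _ => Phase d) W z ∘ Fin.castSucc = W := by
        funext i; simp
      simpa [this] using h
  · rw [Set.indicator_of_notMem h]
    rw [lintegral_congr (g := fun _ => 0), lintegral_zero]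
    intro z
    rw [Set.indicator_of_notMem]
    have : Fin.snoc (α := fun _ => Phase d) W z ∘ Fin.castSucc = W := by
      funext i; simp
    simpa [this] using h

lemma condMeasure_univ (hZ : Z ∈ offDiag d s) (k : ℕ) :
    condMeasure F Z k Set.univ = ENNReal.ofReal (F s Z) := by
  induction k with
  | zero =>
    rw [condMeasure, withDensity_apply _ MeasurableSet.univ, Measure.restrict_univ]
    rw [lintegral_unique, volume_pi, Measure.pi_univ]
    simp only [Finset.univ_eq_empty, Finset.prod_empty, mul_one]
    congr 2
    exact Fin.append_elim0 Z
  | succ k ih =>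
    rw [← ih, ← hF.map_condMeasure_castSucc hZ k, Measure.map_apply (by fun_prop)
      MeasurableSet.univ, Set.preimage_univ]

lemma map_condMeasure_perm (hZ : Z ∈ offDiag d s) (k : ℕ) (σ : Equiv.Perm (Fin k)) :
    (condMeasure F Z k).map (fun W => W ∘ σ) = condMeasure F Z k := by
  have hσ : MeasurePreserving (fun W : Config d k => W ∘ σ) volume volume :=
    measurePreserving_comp_perm volume σ
  have he : MeasurableEmbedding (fun W : Config d k => W ∘ σ) :=
    (MeasurableEquiv.piCongrLeft (fun _ : Fin k => Phase d) σ).symm.measurableEmbedding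
  ext A hA
  rw [Measure.map_apply hσ.measurable hA, condMeasure, withDensity_apply _ (hσ.measurable hA),
    withDensity_apply _ hA]
  refine Eq.trans (lintegral_congr_ae (ae_restrict_of_ae ?_)) (hσ.setLIntegral_comp_preimage_emb he
    (fun W => ENNReal.ofReal (F (s + k) (Fin.append Z W))) A)
  filter_upwards [ae_append_mem_offDiag hZ k] with W hW
  let e : Equiv.Perm (Fin (s + k)) :=
    (finSumFinEquiv.symm.trans ((Equiv.refl _).sumCongr σ)).trans finSumFinEquiv
  have : Fin.append Z (W ∘ σ) = Fin.append Z W ∘ e := by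
    funext i
    refine Fin.addCases (fun i => ?_) (fun i => ?_) i <;> simp [e]
  rw [this, hF.symm _ _ _ hW]

lemma isExchangeableFamily (hZ : Z ∈ offDiag d s) :
    IsExchangeableFamily (condMeasure F Z) where
  finite k := ⟨by rw [hF.condMeasure_univ hZ]; exact ENNReal.ofReal_lt_top⟩
  symm k σ := hF.map_condMeasure_perm hZ k σ
  consistent k := hF.map_condMeasure_castSucc hZ k

lemma integrable_append (hZ : Z ∈ offDiag d s) (k : ℕ) :
    Integrable (fun W : Config d k => F (s + k) (Fin.append Z W)) := by
  refine ⟨hF.aestronglyMeasurable_append hZ k, ?_⟩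
  rw [hasFiniteIntegral_iff_ofReal (hF.ae_append_nonneg hZ k)]
  have := hF.condMeasure_univ hZ k
  rw [condMeasure, withDensity_apply _ MeasurableSet.univ, Measure.restrict_univ] at this
  rw [this]
  exact ENNReal.ofReal_lt_top

lemma condMeasure_real (hZ : Z ∈ offDiag d s) {k : ℕ} {A : Set (Config d k)}
    (hA : MeasurableSet A) :
    (condMeasure F Z k).real A = ∫ W in A, F (s + k) (Fin.append Z W) := by
  rw [measureReal_def, condMeasure, withDensity_apply _ hA,
    integral_eq_lintegral_of_nonneg_ae (ae_restrict_of_ae (hF.ae_append_nonneg hZ k))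
      (hF.aestronglyMeasurable_append hZ k).restrict]

/-- The densities F_{s+k}(Z', ·) converge almost everywhere as Z' → Z, and their total masses
F_s(Z') converge by continuity of F_s. Scheffé's lemma then applies without a dominating function.
-/
lemma continuousOn_condMeasure_real {k : ℕ} {A : Set (Config d k)} (hA : MeasurableSet A) :
    ContinuousOn (fun Z : Config d s => (condMeasure F Z k).real A) (offDiag d s) := by
  have hint : ∀ Z ∈ offDiag d s, ∫ W : Config d k, F (s + k) (Fin.append Z W) = F s Z := by
    intro Z hZ
    rw [← setIntegral_univ, ← hF.condMeasure_real hZ MeasurableSet.univ, measureReal_def,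
      hF.condMeasure_univ hZ, ENNReal.toReal_ofReal (hF.nonneg _ _ hZ)]
  suffices ContinuousOn (fun Z : Config d s => ∫ W in A, F (s + k) (Fin.append Z W))
      (offDiag d s) from this.congr fun Z hZ => hF.condMeasure_real hZ hA
  intro Z hZ
  refine tendsto_setIntegral_of_tendsto_integral ?_ ?_ (hF.integrable_append hZ k) ?_ ?_ A
  · filter_upwards [self_mem_nhdsWithin] with Z' hZ' using hF.integrable_append hZ' k
  · filter_upwards [self_mem_nhdsWithin] with Z' hZ' using hF.ae_append_nonneg hZ' k
  · filter_upwards [ae_append_mem_offDiag hZ k] with W hW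
    have h1 := (hF.continuous _).continuousAt ((isOpen_offDiag _).mem_nhds hW)
    exact (Tendsto.comp h1
      ((continuous_append.comp (Continuous.prodMk_left W)).tendsto Z)).mono_left inf_le_left
  · rw [hint Z hZ]
    refine (hF.continuous s Z hZ).congr' ?_
    filter_upwards [self_mem_nhdsWithin] with Z' hZ' using (hint Z' hZ').symm

end IsExtendedFamily

end

noncomputable section

/-! ### General facts about approximation -/

lemma ContinuousMap.integrable_of_compactSpace {Y : Type*} [TopologicalSpace Y] [CompactSpace Y]
    [MeasurableSpace Y] [OpensMeasurableSpace Y] (f : C(Y, ℝ)) (μ : Measure Y)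
    [IsFiniteMeasure μ] : Integrable f μ :=
  (BoundedContinuousFunction.mkOfCompact f).integrable μ

/-- K is locally bounded, so the relative error ε K(y) is locally uniformly small. In the
application K(Z) is the mass F_s(Z) or a constant. -/
lemma ContinuousOn.of_forall_approx {Y : Type*} [TopologicalSpace Y] {U : Set Y} {h K : Y → ℝ}
    (hK : ContinuousOn K U) (hK0 : ∀ y ∈ U, 0 ≤ K y)
    (happ : ∀ ε > 0, ∃ k : Y → ℝ, ContinuousOn k U ∧ ∀ y ∈ U, |h y - k y| ≤ ε * K y) :
    ContinuousOn h U := by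
  refine continuousOn_of_locally_uniform_approx_of_continuousWithinAt fun x hx u hu => ?_
  obtain ⟨ε, hε, hεu⟩ := Metric.mem_uniformity_dist.1 hu
  have hpos : 0 < K x + 1 := by linarith [hK0 x hx]
  obtain ⟨k, hk, hkU⟩ := happ (ε / (2 * (K x + 1))) (by positivity)
  have hev : ∀ᶠ y in 𝓝[U] x, K y < K x + 1 := (hK x hx).eventually_lt_const (by linarith)
  refine ⟨_, inter_mem self_mem_nhdsWithin hev, k, hk x hx, fun y hy => hεu ?_⟩
  rw [Real.dist_eq]
  refine (hkU y hy.1).trans_lt ?_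
  have h2 : K y < K x + 1 := hy.2
  calc ε / (2 * (K x + 1)) * K y ≤ ε / (2 * (K x + 1)) * (K x + 1) := by gcongr
    _ = ε / 2 := by field_simp
    _ < ε := by linarith

/-- Continuous functions on an open set can be compared through their integrals over the sets of a
topological basis. -/
lemma le_of_forall_basis_setIntegral_le {Y : Type*} [TopologicalSpace Y] [MeasurableSpace Y]
    [BorelSpace Y] [SecondCountableTopology Y] {μ : Measure Y} [μ.IsOpenPosMeasure]
    [IsLocallyFiniteMeasure μ] {U : Set Y} (hU : IsOpen U) {h k : Y → ℝ}
    (hh : ContinuousOn h U) (hk : ContinuousOn k U)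
    (hle : ∀ b ∈ TopologicalSpace.countableBasis Y, b ⊆ U → IntegrableOn h b μ →
      IntegrableOn k b μ → ∫ y in b, h y ∂μ ≤ ∫ y in b, k y ∂μ) :
    ∀ y ∈ U, h y ≤ k y := by
  intro y hy
  by_contra! hlt
  -- With k(y) < c < c' < h(y), a small basis set b around y has h > c' and k < c, which contradicts
  -- the integral inequality. The extra bounds h < h(y) + 1 and k > k(y) - 1 make both functions
  -- bounded on b, hence integrable.
  obtain ⟨c, hc1, hc2⟩ := exists_between hlt
  obtain ⟨c', hc1', hc2'⟩ := exists_between hc2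
  have hUy := hU.mem_nhds hy
  have e1 := (hh.continuousAt hUy).tendsto.eventually_const_lt hc2'
  have e2 := (hh.continuousAt hUy).tendsto.eventually_lt_const (lt_add_one (h y))
  have e3 := (hk.continuousAt hUy).tendsto.eventually_lt_const hc1
  have e4 := (hk.continuousAt hUy).tendsto.eventually_const_lt (sub_one_lt (k y))
  obtain ⟨V, hV, hVfin⟩ := μ.exists_isOpen_measure_lt_top y
  have hnhds := inter_mem (inter_mem hUy (e1.and (e2.and (e3.and e4))))
    (hVfin.1.mem_nhds hV)
  obtain ⟨b, hb, hyb, hbs⟩ :=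
    (TopologicalSpace.isBasis_countableBasis Y).mem_nhds_iff.1 hnhds
  have hbo : IsOpen b := (TopologicalSpace.isBasis_countableBasis Y).isOpen hb
  have hbU : b ⊆ U := fun w hw => (hbs hw).1.1
  have hbfin : μ b < ⊤ := (measure_mono fun w hw => (hbs hw).2).trans_lt hVfin.2
  have hbpos : 0 < μ b := hbo.measure_pos μ ⟨y, hyb⟩
  have hih : IntegrableOn h b μ := by
    refine IntegrableOn.of_bound hbfin
      ((hh.mono hbU).aestronglyMeasurable hbo.measurableSet) (|c'| + |h y + 1|) ?_
    filter_upwards [ae_restrict_mem hbo.measurableSet] with w hw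
    have h1 := (hbs hw).1.2.1
    have h2 := (hbs hw).1.2.2.1
    rw [Real.norm_eq_abs, abs_le]
    constructor <;> linarith [neg_abs_le c', le_abs_self (h y + 1), abs_nonneg c',
      abs_nonneg (h y + 1)]
  have hik : IntegrableOn k b μ := by
    refine IntegrableOn.of_bound hbfin
      ((hk.mono hbU).aestronglyMeasurable hbo.measurableSet) (|c| + |k y - 1|) ?_
    filter_upwards [ae_restrict_mem hbo.measurableSet] with w hw
    have h1 := (hbs hw).1.2.2.2.1
    have h2 := (hbs hw).1.2.2.2.2
    rw [Real.norm_eq_abs, abs_le]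
    constructor <;> linarith [neg_abs_le (k y - 1), le_abs_self c, abs_nonneg c,
      abs_nonneg (k y - 1)]
  have hreal : 0 < μ.real b := ENNReal.toReal_pos hbpos.ne' hbfin.ne
  have g1 : c' * μ.real b ≤ ∫ w in b, h w ∂μ := by
    have := setIntegral_mono_on (integrableOn_const (C := c') hbfin.ne) hih hbo.measurableSet
      fun w hw => (hbs hw).1.2.1.le
    simpa [mul_comm] using this
  have g2 : ∫ w in b, k w ∂μ ≤ c * μ.real b := by
    have := setIntegral_mono_on hik (integrableOn_const (C := c) hbfin.ne) hbo.measurableSet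
      fun w hw => (hbs hw).1.2.2.2.1.le
    simpa [mul_comm] using this
  have := hle b hb hbU hih hik
  nlinarith

lemma eq_of_forall_basis_setIntegral_eq {Y : Type*} [TopologicalSpace Y] [MeasurableSpace Y]
    [BorelSpace Y] [SecondCountableTopology Y] {μ : Measure Y} [μ.IsOpenPosMeasure]
    [IsLocallyFiniteMeasure μ] {U : Set Y} (hU : IsOpen U) {h k : Y → ℝ}
    (hh : ContinuousOn h U) (hk : ContinuousOn k U)
    (heq : ∀ b ∈ TopologicalSpace.countableBasis Y, ∫ y in b, h y ∂μ = ∫ y in b, k y ∂μ) :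
    ∀ y ∈ U, h y = k y := fun y hy =>
  le_antisymm
    (le_of_forall_basis_setIntegral_le hU hh hk (fun b hb _ _ _ => (heq b hb).le) y hy)
    (le_of_forall_basis_setIntegral_le hU hk hh (fun b hb _ _ _ => (heq b hb).ge) y hy)

/-- Measures on a cube are compared through nonnegative continuous functions. -/
lemma measure_le_of_forall_continuousMap {ι : Type*} [Countable ι]
    {μ ν : Measure (ι → unitInterval)} [IsFiniteMeasure μ] [IsFiniteMeasure ν]
    (h : ∀ f : C(ι → unitInterval, ℝ), (∀ θ, 0 ≤ f θ) → ∫ θ, f θ ∂μ ≤ ∫ θ, f θ ∂ν) :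
    μ ≤ ν := by
  -- Indicators of closed sets are limits of continuous functions; inner regularity by compact sets
  -- then reaches all measurable sets.
  have hclosed : ∀ K : Set (ι → unitInterval), IsClosed K → μ K ≤ ν K := by
    intro K hK
    refine le_of_tendsto_of_tendsto' (HasOuterApproxClosed.tendsto_lintegral_apprSeq hK μ)
      (HasOuterApproxClosed.tendsto_lintegral_apprSeq hK ν) fun n => ?_
    let f : C(ι → unitInterval, ℝ) :=
      ⟨fun θ => (hK.apprSeq n θ : ℝ), by fun_prop⟩
    have hf : ∀ ρ : Measure (ι → unitInterval), IsFiniteMeasure ρ →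
        ∫⁻ θ, (hK.apprSeq n θ : ℝ≥0∞) ∂ρ = ENNReal.ofReal (∫ θ, f θ ∂ρ) := by
      intro ρ _
      rw [ofReal_integral_eq_lintegral_ofReal (f.integrable_of_compactSpace ρ)
        (Eventually.of_forall fun θ => NNReal.coe_nonneg _)]
      exact lintegral_congr fun θ => by simp [f]
    rw [hf μ inferInstance, hf ν inferInstance]
    exact ENNReal.ofReal_le_ofReal (h f fun θ => NNReal.coe_nonneg _)
  refine Measure.le_intro fun A hA _ => ?_
  rw [hA.measure_eq_iSup_isCompact]
  refine iSup₂_le fun K hKA => iSup_le fun hK => ?_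
  exact (hclosed K hK.isClosed).trans (measure_mono hKA)

/-- A kernel into a cube is measurable if it integrates continuous functions to measurable ones. -/
lemma measurable_measure_of_forall_continuousMap {ι Y : Type*} [Countable ι] [MeasurableSpace Y]
    {κ : Y → Measure (ι → unitInterval)} [∀ y, IsFiniteMeasure (κ y)]
    (h : ∀ f : C(ι → unitInterval, ℝ), Measurable fun y => ∫ θ, f θ ∂(κ y)) :
    Measurable κ := by
  have hclosed : ∀ K : Set (ι → unitInterval), IsClosed K → Measurable fun y => κ y K := by
    intro K hK
    refine measurable_of_tendsto_metrizable (f := fun n y => ∫⁻ θ, hK.apprSeq n θ ∂(κ y)) ?_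
      (tendsto_pi_nhds.2 fun y => HasOuterApproxClosed.tendsto_lintegral_apprSeq hK (κ y))
    intro n
    let f : C(ι → unitInterval, ℝ) := ⟨fun θ => (hK.apprSeq n θ : ℝ), by fun_prop⟩
    have hf : ∀ y, ∫⁻ θ, (hK.apprSeq n θ : ℝ≥0∞) ∂(κ y) =
        ENNReal.ofReal (∫ θ, f θ ∂(κ y)) := by
      intro y
      rw [ofReal_integral_eq_lintegral_ofReal (f.integrable_of_compactSpace _)
        (Eventually.of_forall fun θ => NNReal.coe_nonneg _)]
      exact lintegral_congr fun θ => by simp [f]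
    simp_rw [hf]
    exact (h f).ennreal_ofReal
  refine Measurable.measure_of_isPiSystem (S := {K | IsClosed K}) ?_ isPiSystem_isClosed hclosed
    (hclosed _ isClosed_univ)
  rw [← borel_eq_generateFrom_isClosed]
  exact BorelSpace.measurable_eq

/-- Two integrable functions on a cube with the same integrals against continuous functions agree
almost everywhere. -/
lemma ae_eq_of_forall_continuousMap {ι : Type*} [Countable ι]
    {μ : Measure (ι → unitInterval)} [IsFiniteMeasure μ] {u v : (ι → unitInterval) → ℝ}
    (hu : Integrable u μ) (hv : Integrable v μ) (hu0 : ∀ θ, 0 ≤ u θ) (hv0 : ∀ θ, 0 ≤ v θ)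
    (h : ∀ f : C(ι → unitInterval, ℝ), ∫ θ, f θ * u θ ∂μ = ∫ θ, f θ * v θ ∂μ) :
    u =ᵐ[μ] v := by
  have hfin : ∀ w : (ι → unitInterval) → ℝ, Integrable w μ →
      IsFiniteMeasure (μ.withDensity fun θ => ENNReal.ofReal (w θ)) := fun w hw =>
    isFiniteMeasure_withDensity_ofReal hw.2
  have := hfin u hu
  have := hfin v hv
  have key : ∀ w : (ι → unitInterval) → ℝ, Integrable w μ → (∀ θ, 0 ≤ w θ) →
      ∀ f : (ι → unitInterval) → ℝ,
      ∫ θ, f θ ∂(μ.withDensity fun θ => ENNReal.ofReal (w θ)) = ∫ θ, f θ * w θ ∂μ := by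
    intro w hw hw0 f
    rw [integral_withDensity_eq_integral_toReal_smul₀ hw.aemeasurable.ennreal_ofReal
      (Eventually.of_forall fun _ => ENNReal.ofReal_lt_top)]
    refine integral_congr_ae (Eventually.of_forall fun θ => ?_)
    simp only [ENNReal.toReal_ofReal (hw0 θ), smul_eq_mul, mul_comm]
  have heq : (μ.withDensity fun θ => ENNReal.ofReal (u θ)) =
      μ.withDensity fun θ => ENNReal.ofReal (v θ) := by
    refine ext_of_forall_integral_eq_of_IsFiniteMeasure fun f => ?_
    rw [key u hu hu0, key v hv hv0]
    exact h f.toContinuousMap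
  rw [withDensity_eq_iff hu.aemeasurable.ennreal_ofReal hv.aemeasurable.ennreal_ofReal] at heq
  · filter_upwards [heq] with θ hθ
    rwa [ENNReal.ofReal_eq_ofReal_iff (hu0 θ) (hv0 θ)] at hθ
  · exact ((hasFiniteIntegral_iff_ofReal (Eventually.of_forall hu0)).1 hu.2).ne

/-! ### Moment measures of a family of marginals -/

/-- Indices of the test sets: a countable basis of the phase space, and the whole space. -/
abbrev TestIndex (d : ℕ) : Type := Option (TopologicalSpace.countableBasis (Phase d))

/-- The test set with a given index. -/
def testSet {d : ℕ} : TestIndex d → Set (Phase d)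
  | none => Set.univ
  | some b => b.1

lemma measurableSet_testSet {d : ℕ} (i : TestIndex d) : MeasurableSet (testSet i) := by
  cases i with
  | none => exact MeasurableSet.univ
  | some b => exact ((TopologicalSpace.isBasis_countableBasis _).isOpen b.2).measurableSet

open Classical in
/-- The measure on `[0, 1]^TestIndex` whose moments are those of the conditional measures given
`Z`. -/
def momentMeasure {d : ℕ} (F : ∀ s, Config d s → ℝ) {s : ℕ} (Z : Config d s) :
    Measure (TestIndex d → unitInterval) :=
  if h : IsExchangeableFamily (condMeasure F Z) then
    (h.exists_momentMeasure measurableSet_testSet).choose else 0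

instance {d : ℕ} (F : ∀ s, Config d s → ℝ) {s : ℕ} (Z : Config d s) :
    IsFiniteMeasure (momentMeasure F Z) := by
  unfold momentMeasure
  split_ifs with h
  · exact (h.exists_momentMeasure measurableSet_testSet).choose_spec.1
  · infer_instance

namespace IsExtendedFamily

variable {d : ℕ} [Nonempty (Fin d)] {F : ∀ s, Config d s → ℝ} (hF : IsExtendedFamily F)
  {s : ℕ} {Z : Config d s}

include hF

lemma integral_momentMonomial (hZ : Z ∈ offDiag d s) {k : ℕ} (I : Fin k → TestIndex d) :
    ∫ θ, momentMonomial I θ ∂(momentMeasure F Z) =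
      (condMeasure F Z k).real {W | ∀ j, W j ∈ testSet (I j)} := by
  have h := hF.isExchangeableFamily hZ
  rw [momentMeasure, dif_pos h]
  exact (h.exists_momentMeasure measurableSet_testSet).choose_spec.2 k I

/-- The moment of order zero. It is what recovers the pointwise value F_s(Z) at the end of the
argument. -/
lemma momentMeasure_real_univ (hZ : Z ∈ offDiag d s) :
    (momentMeasure F Z).real Set.univ = F s Z := by
  have := hF.integral_momentMonomial hZ (Fin.elim0 : Fin 0 → TestIndex d)
  simp only [momentMonomial_apply, Finset.univ_eq_empty, Finset.prod_empty, integral_const,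
    smul_eq_mul, mul_one] at this
  rw [this, measureReal_def]
  have h2 : {W : Config d 0 | ∀ j : Fin 0, W j ∈ testSet (Fin.elim0 j : TestIndex d)}
      = Set.univ := by
    ext W; simp
  rw [h2, hF.condMeasure_univ hZ, ENNReal.toReal_ofReal (hF.nonneg _ _ hZ)]

lemma abs_integral_sub_le (hZ : Z ∈ offDiag d s) {f g : C(TestIndex d → unitInterval, ℝ)} {ε : ℝ}
    (h : ∀ θ, |f θ - g θ| ≤ ε) :
    |∫ θ, f θ ∂(momentMeasure F Z) - ∫ θ, g θ ∂(momentMeasure F Z)| ≤ ε * F s Z := by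
  rw [← integral_sub (f.integrable_of_compactSpace _) (g.integrable_of_compactSpace _),
    ← hF.momentMeasure_real_univ hZ]
  exact norm_integral_le_of_norm_le_const (f := fun θ => f θ - g θ) (Eventually.of_forall h)

/-- For monomials the integral is a box mass of the conditional measure, which is continuous in Z.
Uniform approximation of f costs an error of at most ε F_s(Z), so the property is closed. -/
lemma continuousOn_integral_momentMeasure (s : ℕ) (f : C(TestIndex d → unitInterval, ℝ)) :
    ContinuousOn (fun Z : Config d s => ∫ θ, f θ ∂(momentMeasure F Z)) (offDiag d s) := by
  induction f using momentMonomial_induction with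
  | mono k I =>
    refine (hF.continuousOn_condMeasure_real (k := k)
      (A := {W | ∀ j, W j ∈ testSet (I j)}) ?_).congr fun Z hZ => hF.integral_momentMonomial hZ I
    exact IsExchangeableFamily.measurableSet_box measurableSet_testSet I id
  | zero => simpa using continuousOn_const
  | add f g hf hg =>
    refine (hf.add hg).congr fun Z _ => ?_
    exact integral_add (f.integrable_of_compactSpace _) (g.integrable_of_compactSpace _)
  | smul c f hf =>
    refine (hf.const_smul c).congr fun Z _ => ?_
    exact integral_smul c _
  | closed f hf =>
    refine ContinuousOn.of_forall_approx (hF.continuous s) (hF.nonneg s) fun ε hε => ?_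
    obtain ⟨g, hg, hfg⟩ := hf ε hε
    exact ⟨_, hg, fun Z hZ => hF.abs_integral_sub_le hZ hfg⟩

lemma abs_integral_momentMeasure_le (hZ : Z ∈ offDiag d s)
    (f : C(TestIndex d → unitInterval, ℝ)) :
    |∫ θ, f θ ∂(momentMeasure F Z)| ≤ ‖f‖ * F s Z := by
  have := hF.abs_integral_sub_le hZ (f := f) (g := 0) (ε := ‖f‖)
    fun θ => by simpa using f.norm_coe_le_norm θ
  simpa using this

lemma continuousOn_integral_momentMeasure_snoc (Z : Config d s)
    (f : C(TestIndex d → unitInterval, ℝ)) :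
    ContinuousOn (fun z => ∫ θ, f θ ∂(momentMeasure F (Fin.snoc (α := fun _ => Phase d) Z z)))
      {z | Fin.snoc (α := fun _ => Phase d) Z z ∈ offDiag d (s + 1)} :=
  (hF.continuousOn_integral_momentMeasure (s + 1) f).comp
    (continuous_snoc.comp (Continuous.prodMk_right Z)).continuousOn fun _ hz => hz

lemma integrable_integral_momentMeasure_snoc (hZ : Z ∈ offDiag d s)
    (f : C(TestIndex d → unitInterval, ℝ)) :
    Integrable fun z => ∫ θ, f θ ∂(momentMeasure F (Fin.snoc (α := fun _ => Phase d) Z z)) := by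
  refine ((hF.consistent s Z hZ).1.const_mul ‖f‖).mono' ?_ ?_
  · refine (hF.continuousOn_integral_momentMeasure_snoc Z f).aestronglyMeasurable_of_ae_mem ?_
      (ae_snoc_mem_offDiag hZ)
    exact ((isOpen_offDiag _).preimage
      (continuous_snoc.comp (Continuous.prodMk_right Z))).measurableSet
  · filter_upwards [ae_snoc_mem_offDiag hZ] with z hz
    exact hF.abs_integral_momentMeasure_le hz f

/-- Fubini in the first additional particle, which is thereby moved from the random particles to the
fixed ones. -/
lemma condMeasure_cons_box (hZ : Z ∈ offDiag d s) {k : ℕ} {B : Set (Phase d)}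
    {A : Set (Config d k)} (hB : MeasurableSet B) (hA : MeasurableSet A) :
    condMeasure F Z (k + 1) {W | W 0 ∈ B ∧ (fun j : Fin k => W j.succ) ∈ A} =
      ∫⁻ z in B, condMeasure F (Fin.snoc (α := fun _ => Phase d) Z z) k A := by
  have hm : MeasurableSet {W : Config d (k + 1) | W 0 ∈ B ∧ (fun j : Fin k => W j.succ) ∈ A} :=
    ((measurable_pi_apply 0) hB).inter
      ((by fun_prop : Measurable fun (W : Config d (k + 1)) (j : Fin k) => W j.succ) hA)
  have hmeas := (hF.aestronglyMeasurable_append hZ (k + 1)).aemeasurable.ennreal_ofReal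
  rw [condMeasure, withDensity_apply _ hm, ← lintegral_indicator hm,
    volume_pi, lintegral_pi_insertNth volume 0 (hmeas.indicator hm), ← lintegral_indicator hB]
  refine lintegral_congr fun z => ?_
  by_cases hz : z ∈ B
  · rw [Set.indicator_of_mem hz, condMeasure, withDensity_apply _ hA, ← lintegral_indicator hA]
    refine lintegral_congr fun W => ?_
    rw [Fin.insertNth_zero']
    by_cases hW : W ∈ A
    · rw [Set.indicator_of_mem hW, Set.indicator_of_mem (by simpa using ⟨hz, hW⟩),
        Fin.append_right_cons]
      exact congrArg ENNReal.ofReal (family_comp_cast F _ _)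
    · rw [Set.indicator_of_notMem hW, Set.indicator_of_notMem (by simpa using fun _ => hW)]
  · rw [Set.indicator_of_notMem hz, ← lintegral_zero]
    refine lintegral_congr fun W => ?_
    rw [Set.indicator_of_notMem]
    simp [hz]

/-- Given θ, a new particle falls in `testSet b` with probability θ_b. For monomials this is the
previous lemma, since multiplication by θ_b prepends b to the index list; linearity and
approximation do the rest. -/
lemma setIntegral_momentMeasure_snoc (hZ : Z ∈ offDiag d s) (b : TestIndex d)
    (f : C(TestIndex d → unitInterval, ℝ)) :
    ∫ z in testSet b, ∫ θ, f θ ∂(momentMeasure F (Fin.snoc (α := fun _ => Phase d) Z z)) =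
      ∫ θ, f θ * (θ b : ℝ) ∂(momentMeasure F Z) := by
  have hint := fun f => hF.integrable_integral_momentMeasure_snoc hZ f
  have hb : Continuous fun θ : TestIndex d → unitInterval => (θ b : ℝ) := by fun_prop
  have hint' : ∀ f : C(TestIndex d → unitInterval, ℝ),
      Integrable (fun θ => f θ * (θ b : ℝ)) (momentMeasure F Z) := fun f =>
    (f * ⟨_, hb⟩ : C(TestIndex d → unitInterval, ℝ)).integrable_of_compactSpace _
  induction f using momentMonomial_induction with
  | mono k I =>
    have h1 : ∀ θ : TestIndex d → unitInterval, momentMonomial I θ * (θ b : ℝ) =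
        momentMonomial (Fin.cons b I : Fin (k + 1) → TestIndex d) θ := by
      intro θ
      simp [Fin.prod_univ_succ, mul_comm]
    have hbox : {W : Config d (k + 1) |
        ∀ j, W j ∈ testSet ((Fin.cons b I : Fin (k + 1) → TestIndex d) j)} =
        {W | W 0 ∈ testSet b ∧ (fun j : Fin k => W j.succ) ∈
          {W : Config d k | ∀ j, W j ∈ testSet (I j)}} := by
      ext W; simp [Fin.forall_fin_succ]
    have hA : MeasurableSet {W : Config d k | ∀ j, W j ∈ testSet (I j)} :=
      IsExchangeableFamily.measurableSet_box measurableSet_testSet I id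
    simp_rw [h1]
    rw [hF.integral_momentMonomial hZ, hbox, measureReal_def,
      hF.condMeasure_cons_box hZ (measurableSet_testSet b) hA]
    have hae := ae_restrict_of_ae (s := testSet b) (ae_snoc_mem_offDiag hZ)
    have hcongr : ∀ᵐ z ∂(volume.restrict (testSet b)),
        condMeasure F (Fin.snoc (α := fun _ => Phase d) Z z) k {W | ∀ j, W j ∈ testSet (I j)} =
        ENNReal.ofReal (∫ θ, momentMonomial I θ
          ∂(momentMeasure F (Fin.snoc (α := fun _ => Phase d) Z z))) := by
      filter_upwards [hae] with z hz
      have := (hF.isExchangeableFamily hz).finite k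
      rw [hF.integral_momentMonomial hz, ofReal_measureReal]
    rw [lintegral_congr_ae hcongr, integral_eq_lintegral_of_nonneg_ae]
    · filter_upwards [hae] with z hz
      rw [hF.integral_momentMonomial hz]
      exact measureReal_nonneg
    · exact (hint _).aestronglyMeasurable.restrict
  | zero => simp
  | add f g hf hg =>
    simp only [ContinuousMap.add_apply, add_mul]
    rw [integral_add (hint' f) (hint' g), ← hf, ← hg,
      ← integral_add (hint f).integrableOn (hint g).integrableOn]
    refine integral_congr_ae (Eventually.of_forall fun z => ?_)
    exact integral_add (f.integrable_of_compactSpace _) (g.integrable_of_compactSpace _)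
  | smul c f hf =>
    simp only [ContinuousMap.smul_apply, smul_eq_mul, mul_assoc, integral_const_mul, hf]
  | closed f hf =>
    refine eq_of_forall_dist_le fun ε hε => ?_
    have hF0 := hF.nonneg s Z hZ
    -- Replacing f by g costs at most δ F_s(Z) on each side, for a total of at most 2 δ (F_s(Z) + 1)
    -- = ε.
    obtain ⟨g, hg, hfg⟩ := hf (ε / (2 * (F s Z + 1))) (by positivity)
    set δ := ε / (2 * (F s Z + 1))
    have hδ : 0 < δ := by positivity
    have h1 : |(∫ z in testSet b, ∫ θ, f θ
          ∂(momentMeasure F (Fin.snoc (α := fun _ => Phase d) Z z))) -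
        ∫ z in testSet b, ∫ θ, g θ
          ∂(momentMeasure F (Fin.snoc (α := fun _ => Phase d) Z z))| ≤ δ * F s Z := by
      rw [← integral_sub (hint f).integrableOn (hint g).integrableOn, ← Real.norm_eq_abs]
      have hc := (hF.consistent s Z hZ).1.const_mul δ
      calc _ ≤ ∫ z in testSet b, δ * F (s + 1) (Fin.snoc (α := fun _ => Phase d) Z z) := by
            refine norm_integral_le_of_norm_le (μ := volume.restrict (testSet b))
              hc.integrableOn ?_
            filter_upwards [ae_restrict_of_ae (ae_snoc_mem_offDiag hZ)] with z hz
            exact hF.abs_integral_sub_le hz hfg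
        _ ≤ ∫ z, δ * F (s + 1) (Fin.snoc (α := fun _ => Phase d) Z z) := by
            refine setIntegral_le_integral hc ?_
            filter_upwards [ae_snoc_mem_offDiag hZ] with z hz
            exact mul_nonneg hδ.le (hF.nonneg _ _ hz)
        _ = δ * F s Z := by rw [integral_const_mul, (hF.consistent s Z hZ).2]
    have h2 : |(∫ θ, g θ * (θ b : ℝ) ∂(momentMeasure F Z)) -
        ∫ θ, f θ * (θ b : ℝ) ∂(momentMeasure F Z)| ≤ δ * F s Z := by
      refine hF.abs_integral_sub_le hZ (f := g * ⟨_, hb⟩) (g := f * ⟨_, hb⟩) fun θ => ?_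
      have h3 := hfg θ
      have h4 : |(θ b : ℝ)| ≤ 1 := by
        rw [abs_of_nonneg (θ b).2.1]; exact (θ b).2.2
      change |g θ * (θ b : ℝ) - f θ * (θ b : ℝ)| ≤ δ
      rw [← sub_mul, abs_mul, abs_sub_comm]
      exact (mul_le_of_le_one_right (abs_nonneg _) h4).trans h3
    rw [hg] at h1
    rw [Real.dist_eq]
    refine (abs_sub_le _ (∫ θ, g θ * (θ b : ℝ) ∂(momentMeasure F Z)) _).trans ?_
    refine (add_le_add h1 h2).trans ?_
    have : δ * (F s Z + 1) = ε / 2 := by simp only [δ]; field_simp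
    nlinarith

end IsExtendedFamily

end

noncomputable section

/-! ### The random density of a family of marginals -/

/-- The law of the random density. -/
def mixingMeasure {d : ℕ} (F : ∀ s, Config d s → ℝ) : Measure (TestIndex d → unitInterval) :=
  momentMeasure F (Fin.elim0 : Config d 0)

instance {d : ℕ} (F : ∀ s, Config d s → ℝ) : IsFiniteMeasure (mixingMeasure F) := by
  unfold mixingMeasure; infer_instance

/-- The one-particle configuration. -/
def singleConfig {d : ℕ} (z : Phase d) : Config d 1 :=
  Fin.snoc (α := fun _ => Phase d) (Fin.elim0 : Config d 0) z

@[simp] lemma singleConfig_apply {d : ℕ} (z : Phase d) (i : Fin 1) : singleConfig z i = z := by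
  obtain rfl : i = Fin.last 0 := Subsingleton.elim _ _
  exact Fin.snoc_last (α := fun _ => Phase d) z (Fin.elim0 : Config d 0)

lemma mem_offDiag_of_le_one {d s : ℕ} (hs : s ≤ 1) (Z : Config d s) : Z ∈ offDiag d s := by
  intro i j hij
  exact absurd (Fin.ext (by omega)) hij

lemma continuous_singleConfig {d : ℕ} : Continuous (singleConfig : Phase d → Config d 1) :=
  continuous_snoc.comp (Continuous.prodMk_right _)

namespace IsExtendedFamily

variable {d : ℕ} [Nonempty (Fin d)] {F : ∀ s, Config d s → ℝ} (hF : IsExtendedFamily F)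
  {s : ℕ} {Z : Config d s} {M : Phase d → ℝ} {C : ℝ}

include hF

lemma isProbabilityMeasure_mixingMeasure : IsProbabilityMeasure (mixingMeasure F) := by
  have h := hF.momentMeasure_real_univ (mem_offDiag_of_le_one zero_le_one Fin.elim0)
  rw [hF.zero, measureReal_def, ENNReal.toReal_eq_one_iff] at h
  exact ⟨h⟩

lemma continuous_integral_single (f : C(TestIndex d → unitInterval, ℝ)) :
    Continuous fun z => ∫ θ, f θ ∂(momentMeasure F (singleConfig z)) := by
  rw [← continuousOn_univ]
  exact (hF.continuousOn_integral_momentMeasure 1 f).comp continuous_singleConfig.continuousOn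
    fun z _ => mem_offDiag_of_le_one le_rfl _

lemma setIntegral_single (b : TestIndex d) (f : C(TestIndex d → unitInterval, ℝ)) :
    ∫ z in testSet b, ∫ θ, f θ ∂(momentMeasure F (singleConfig z)) =
      ∫ θ, f θ * (θ b : ℝ) ∂(mixingMeasure F) :=
  hF.setIntegral_momentMeasure_snoc (mem_offDiag_of_le_one zero_le_one Fin.elim0) b f

lemma condMeasure_box_le
    (hbd : ∀ s, ∀ Z ∈ offDiag d s, F s Z ≤ C * ∏ i, M (Z i)) {B : Set (Phase d)}
    (hB : MeasurableSet B) (hMB : IntegrableOn M B) (k : ℕ) :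
    (condMeasure F (Fin.elim0 : Config d 0) k).real {W | ∀ j, W j ∈ B} ≤
      C * (∫ z in B, M z) ^ k := by
  have h0 := mem_offDiag_of_le_one zero_le_one (Fin.elim0 : Config d 0)
  have hbox : MeasurableSet {W : Config d k | ∀ j, W j ∈ B} := by
    rw [Set.ofPred_forall]
    exact MeasurableSet.iInter fun j => (measurable_pi_apply j) hB
  have hind : Integrable (B.indicator M) := (integrable_indicator_iff hB).2 hMB
  rw [hF.condMeasure_real h0 hbox, ← integral_indicator hbox, ← integral_indicator hB]
  have hpow : (∫ z, B.indicator M z) ^ k =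
      ∫ W : Config d k, ∏ i, B.indicator M (W i) := by
    rw [integral_fintype_prod_volume_eq_pow, Fintype.card_fin]
  rw [hpow, ← integral_const_mul]
  refine integral_mono_ae ((hF.integrable_append h0 k).indicator hbox)
    ((Integrable.fintype_prod fun _ => hind).const_mul C) ?_
  filter_upwards [ae_append_mem_offDiag h0 k] with W hW
  by_cases hWB : ∀ j, W j ∈ B
  · rw [Set.indicator_of_mem (by simpa using hWB)]
    refine (hbd _ _ hW).trans (le_of_eq ?_)
    congr 1
    rw [Fin.prod_univ_add]
    simp [hWB]
  · rw [Set.indicator_of_notMem (by simpa using hWB)]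
    obtain ⟨j, hj⟩ := not_forall.1 hWB
    have : ∏ i, B.indicator M (W i) = 0 :=
      Finset.prod_eq_zero (Finset.mem_univ j) (Set.indicator_of_notMem hj _)
    simp [this]

/-- The k-th moment of θ_b is at most C m^k, so Markov's inequality gives probability at most C
(m/c)^k to θ_b ≥ c. For c > m this vanishes as k → ∞, whatever C is; this is why the densities obey
the bound M with no additional constant. -/
lemma ae_coord_le (hM0 : ∀ z, 0 ≤ M z)
    (hbd : ∀ s, ∀ Z ∈ offDiag d s, F s Z ≤ C * ∏ i, M (Z i)) (b : TestIndex d)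
    (hMB : IntegrableOn M (testSet b)) :
    ∀ᵐ θ ∂(mixingMeasure F), (θ b : ℝ) ≤ ∫ z in testSet b, M z := by
  set m := ∫ z in testSet b, M z with hm
  have hm0 : 0 ≤ m := integral_nonneg hM0
  have hcont : Continuous fun θ : TestIndex d → unitInterval => (θ b : ℝ) := by fun_prop
  have hzero : ∀ c, m < c → (mixingMeasure F) {θ | c ≤ (θ b : ℝ)} = 0 := by
    intro c hc
    have hc0 : 0 < c := hm0.trans_lt hc
    have hk : ∀ k : ℕ, (mixingMeasure F).real {θ | c ≤ (θ b : ℝ)} ≤ C * (m / c) ^ k := by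
      intro k
      let f : C(TestIndex d → unitInterval, ℝ) := ⟨fun θ => (θ b : ℝ) ^ k, by fun_prop⟩
      have h1 := mul_meas_ge_le_integral_of_nonneg (μ := mixingMeasure F)
        (Eventually.of_forall fun θ => (pow_nonneg (θ b).2.1 k : 0 ≤ f θ))
        (f.integrable_of_compactSpace _) (c ^ k)
      have h2 : (mixingMeasure F).real {θ | c ≤ (θ b : ℝ)} ≤
          (mixingMeasure F).real {θ | c ^ k ≤ f θ} :=
        measureReal_mono fun θ (hθ : c ≤ (θ b : ℝ)) => pow_le_pow_left₀ hc0.le hθ k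
      have h3 : ∫ θ, f θ ∂(mixingMeasure F) ≤ C * m ^ k := by
        have h4 := hF.integral_momentMonomial
          (mem_offDiag_of_le_one zero_le_one (Fin.elim0 : Config d 0)) (fun _ : Fin k => b)
        have h5 : ∫ θ, f θ ∂(mixingMeasure F) = ∫ θ, momentMonomial (fun _ : Fin k => b) θ
            ∂(momentMeasure F (Fin.elim0 : Config d 0)) := by
          refine integral_congr_ae (Eventually.of_forall fun θ => ?_)
          simp [f]
        rw [h5, h4]
        exact hF.condMeasure_box_le hbd (measurableSet_testSet b) hMB k
      have h6 : c ^ k * (mixingMeasure F).real {θ | c ≤ (θ b : ℝ)} ≤ C * m ^ k :=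
        (mul_le_mul_of_nonneg_left h2 (by positivity)).trans (h1.trans h3)
      rw [div_pow, mul_div_assoc', le_div_iff₀ (by positivity)]
      linarith
    have hlim : Tendsto (fun k : ℕ => C * (m / c) ^ k) atTop (𝓝 0) := by
      have := (tendsto_pow_atTop_nhds_zero_of_lt_one (by positivity : 0 ≤ m / c)
        ((div_lt_one hc0).2 hc)).const_mul C
      simpa using this
    have := ge_of_tendsto' hlim hk
    rw [← measureReal_eq_zero_iff]
    exact le_antisymm this measureReal_nonneg
  have hae : ∀ n : ℕ, ∀ᵐ θ ∂(mixingMeasure F), (θ b : ℝ) < m + 1 / ((n : ℝ) + 1) := by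
    intro n
    have := hzero (m + 1 / ((n : ℝ) + 1)) (by linarith [Nat.one_div_pos_of_nat (α := ℝ) (n := n)])
    rw [ae_iff]
    simpa using this
  filter_upwards [ae_all_iff.2 hae] with θ hθ
  refine le_of_forall_pos_lt_add fun ε hε => ?_
  obtain ⟨n, hn⟩ := exists_nat_one_div_lt hε
  linarith [hθ n]

/-- Both sides are continuous in z, so it suffices to compare integrals over basis sets b. On the
left this is ∫ f θ_b, and θ_b ≤ ∫_b M almost surely. -/
lemma integral_single_le (hMc : Continuous M) (hM0 : ∀ z, 0 ≤ M z)
    (hbd : ∀ s, ∀ Z ∈ offDiag d s, F s Z ≤ C * ∏ i, M (Z i))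
    (f : C(TestIndex d → unitInterval, ℝ)) (hf : ∀ θ, 0 ≤ f θ) (z : Phase d) :
    ∫ θ, f θ ∂(momentMeasure F (singleConfig z)) ≤ M z * ∫ θ, f θ ∂(mixingMeasure F) := by
  have hf1 := f.integrable_of_compactSpace (mixingMeasure F)
  have hpos : 0 ≤ ∫ θ, f θ ∂(mixingMeasure F) := integral_nonneg hf
  -- Integrability of M on b is deduced from that of M ∫ f by division, which requires ∫ f > 0. If ∫
  -- f = 0, then f vanishes almost everywhere.
  rcases hpos.eq_or_lt with h0 | h0
  · have hf0 : (f : (TestIndex d → unitInterval) → ℝ) =ᵐ[mixingMeasure F] 0 :=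
      (integral_eq_zero_iff_of_nonneg hf hf1).1 h0.symm
    rw [← h0, mul_zero]
    refine le_of_forall_basis_setIntegral_le (μ := volume) (U := Set.univ)
      (h := fun z => ∫ θ, f θ ∂(momentMeasure F (singleConfig z))) (k := fun _ => 0) isOpen_univ
      (hF.continuous_integral_single f).continuousOn continuousOn_const ?_ z (Set.mem_univ z)
    intro b hb _ _ _
    rw [show b = testSet (some ⟨b, hb⟩) from rfl, hF.setIntegral_single]
    rw [integral_zero, integral_congr_ae (g := fun _ => 0), integral_zero]
    filter_upwards [hf0] with θ hθ
    simp [hθ]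
  · refine le_of_forall_basis_setIntegral_le (μ := volume) (U := Set.univ)
      (h := fun z => ∫ θ, f θ ∂(momentMeasure F (singleConfig z)))
      (k := fun z => M z * ∫ θ, f θ ∂(mixingMeasure F)) isOpen_univ
      (hF.continuous_integral_single f).continuousOn (hMc.mul continuous_const).continuousOn
      ?_ z (Set.mem_univ z)
    intro b hb _ _ hint
    have hMb : IntegrableOn M b := by
      have := hint.mul_const (∫ θ, f θ ∂(mixingMeasure F))⁻¹
      refine this.congr (Eventually.of_forall fun z => ?_)
      simp only
      rw [mul_assoc, mul_inv_cancel₀ h0.ne', mul_one]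
    rw [integral_mul_const]
    rw [show b = testSet (some ⟨b, hb⟩) from rfl] at hMb ⊢
    rw [hF.setIntegral_single, ← integral_const_mul]
    refine integral_mono_ae ?_ (hf1.const_mul _) ?_
    · exact (f * ⟨fun θ => (θ (some ⟨b, hb⟩) : ℝ), by fun_prop⟩ :
        C(TestIndex d → unitInterval, ℝ)).integrable_of_compactSpace (mixingMeasure F)
    · filter_upwards [hF.ae_coord_le hM0 hbd _ hMb] with θ hθ
      rw [mul_comm]
      exact mul_le_mul_of_nonneg_right hθ (hf θ)

lemma momentMeasure_single_le (hMc : Continuous M) (hM0 : ∀ z, 0 ≤ M z)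
    (hbd : ∀ s, ∀ Z ∈ offDiag d s, F s Z ≤ C * ∏ i, M (Z i)) (z : Phase d) :
    momentMeasure F (singleConfig z) ≤ ENNReal.ofReal (M z) • mixingMeasure F := by
  have : IsFiniteMeasure (ENNReal.ofReal (M z) • mixingMeasure F) :=
    Measure.smul_finite _ ENNReal.ofReal_ne_top
  refine measure_le_of_forall_continuousMap fun f hf => ?_
  rw [integral_smul_measure, ENNReal.toReal_ofReal (hM0 z), smul_eq_mul]
  exact hF.integral_single_le hMc hM0 hbd f hf z

end IsExtendedFamily

/-- The moment measures as a kernel. -/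
def momentKernel {d : ℕ} [Nonempty (Fin d)] {F : ∀ s, Config d s → ℝ} (hF : IsExtendedFamily F) :
    ProbabilityTheory.Kernel (Phase d) (TestIndex d → unitInterval) where
  toFun z := momentMeasure F (singleConfig z)
  measurable' := measurable_measure_of_forall_continuousMap fun f =>
    (hF.continuous_integral_single f).measurable

lemma momentKernel_apply {d : ℕ} [Nonempty (Fin d)] {F : ∀ s, Config d s → ℝ}
    (hF : IsExtendedFamily F) (z : Phase d) :
    momentKernel hF z = momentMeasure F (singleConfig z) := rfl

/-- The random density: a jointly measurable Radon–Nikodym derivative, cut off at its almost sure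
upper bound `M`. -/
def randomDensity {d : ℕ} [Nonempty (Fin d)] {F : ∀ s, Config d s → ℝ} (hF : IsExtendedFamily F)
    (M : Phase d → ℝ) (θ : TestIndex d → unitInterval) (z : Phase d) : ℝ :=
  min ((momentKernel hF).rnDeriv (ProbabilityTheory.Kernel.const _ (mixingMeasure F)) z θ).toReal
    (M z)

namespace IsExtendedFamily

variable {d : ℕ} [Nonempty (Fin d)] {F : ∀ s, Config d s → ℝ} (hF : IsExtendedFamily F)
  {s : ℕ} {Z : Config d s} {M : Phase d → ℝ} {A C : ℝ}

lemma measurable_randomDensity (hMc : Continuous M) :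
    Measurable (Function.uncurry (randomDensity hF M)) :=
  (((ProbabilityTheory.Kernel.measurable_rnDeriv _ _).comp measurable_swap).ennreal_toReal).min
    (hMc.measurable.comp measurable_snd)

lemma randomDensity_nonneg (hM0 : ∀ z, 0 ≤ M z) (θ : TestIndex d → unitInterval) (z : Phase d) :
    0 ≤ randomDensity hF M θ z :=
  le_min ENNReal.toReal_nonneg (hM0 z)

lemma randomDensity_le (θ : TestIndex d → unitInterval) (z : Phase d) :
    randomDensity hF M θ z ≤ M z :=
  min_le_right _ _

lemma isFiniteKernel_momentKernel (hMA : ∀ z, M z ≤ A) (hC : 0 ≤ C)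
    (hbd : ∀ s, ∀ Z ∈ offDiag d s, F s Z ≤ C * ∏ i, M (Z i)) :
    ProbabilityTheory.IsFiniteKernel (momentKernel hF) := by
  refine ⟨⟨ENNReal.ofReal (C * A), ENNReal.ofReal_lt_top, fun z => ?_⟩⟩
  have hz := mem_offDiag_of_le_one le_rfl (singleConfig z)
  rw [momentKernel_apply, ← ofReal_measureReal, hF.momentMeasure_real_univ hz]
  refine ENNReal.ofReal_le_ofReal ((hbd 1 _ hz).trans ?_)
  simpa using mul_le_mul_of_nonneg_left (hMA z) hC

/-- Domination by M(z) times the mixing measure gives absolute continuity and a derivative at most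
M(z) almost everywhere. Truncation at M(z) therefore changes it on a null set only, while making the
bound valid for every θ and z. -/
lemma momentMeasure_single_eq (hMc : Continuous M) (hM0 : ∀ z, 0 ≤ M z) (hMA : ∀ z, M z ≤ A)
    (hC : 0 ≤ C) (hbd : ∀ s, ∀ Z ∈ offDiag d s, F s Z ≤ C * ∏ i, M (Z i)) (z : Phase d) :
    momentMeasure F (singleConfig z) =
      (mixingMeasure F).withDensity fun θ => ENNReal.ofReal (randomDensity hF M θ z) := by
  have hle := hF.momentMeasure_single_le hMc hM0 hbd z
  have hac : momentMeasure F (singleConfig z) ≪ mixingMeasure F :=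
    (Measure.absolutelyContinuous_of_le hle).trans (Measure.smul_absolutelyContinuous)
  have := hF.isFiniteKernel_momentKernel hMA hC hbd
  have h1 := ProbabilityTheory.Kernel.rnDeriv_eq_rnDeriv_measure (κ := momentKernel hF)
    (η := ProbabilityTheory.Kernel.const _ (mixingMeasure F)) (a := z)
  rw [ProbabilityTheory.Kernel.const_apply, momentKernel_apply] at h1
  have h2 : (momentMeasure F (singleConfig z)).rnDeriv (mixingMeasure F)
      ≤ᵐ[mixingMeasure F] fun _ => ENNReal.ofReal (M z) := by
    refine ae_le_of_forall_setLIntegral_le_of_sigmaFinite (Measure.measurable_rnDeriv _ _)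
      fun B _ _ => ?_
    refine (Measure.setLIntegral_rnDeriv_le B).trans ((hle B).trans ?_)
    simp
  have := Measure.haveLebesgueDecomposition_of_sigmaFinite (momentMeasure F (singleConfig z))
    (mixingMeasure F)
  refine (Measure.withDensity_rnDeriv_eq (momentMeasure F (singleConfig z)) (mixingMeasure F)
    hac).symm.trans (withDensity_congr_ae ?_)
  filter_upwards [h1, h2] with θ h1 h2
  rw [randomDensity, h1, min_eq_left, ENNReal.ofReal_toReal]
  · exact ne_top_of_le_ne_top ENNReal.ofReal_ne_top h2
  · exact ENNReal.toReal_le_of_le_ofReal (hM0 z) h2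

lemma integral_single_eq (hMc : Continuous M) (hM0 : ∀ z, 0 ≤ M z) (hMA : ∀ z, M z ≤ A)
    (hC : 0 ≤ C) (hbd : ∀ s, ∀ Z ∈ offDiag d s, F s Z ≤ C * ∏ i, M (Z i)) (z : Phase d)
    (f : (TestIndex d → unitInterval) → ℝ) :
    ∫ θ, f θ ∂(momentMeasure F (singleConfig z)) =
      ∫ θ, f θ * randomDensity hF M θ z ∂(mixingMeasure F) := by
  have hm : Measurable fun θ => randomDensity hF M θ z :=
    (hF.measurable_randomDensity hMc).comp measurable_prodMk_right
  rw [hF.momentMeasure_single_eq hMc hM0 hMA hC hbd z,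
    integral_withDensity_eq_integral_toReal_smul hm.ennreal_ofReal
      (Eventually.of_forall fun _ => ENNReal.ofReal_lt_top)]
  refine integral_congr_ae (Eventually.of_forall fun θ => ?_)
  simp only [ENNReal.toReal_ofReal (hF.randomDensity_nonneg hM0 θ z), smul_eq_mul, mul_comm]

end IsExtendedFamily

end

/-! ### Product densities of the moment measures and the pointwise mixture -/

noncomputable section

/-- A jointly measurable random probability density on the phase space, bounded by `M`, whose mixed
moments are continuous off the diagonal. -/
structure IsRandomDensity {d : ℕ} {Θ : Type*} [MeasurableSpace Θ] (π : Measure Θ)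
    (M : Phase d → ℝ) (g : Θ → Phase d → ℝ) : Prop where
  measurable : Measurable (Function.uncurry g)
  nonneg : ∀ θ z, 0 ≤ g θ z
  le : ∀ θ z, g θ z ≤ M z
  integrable : ∀ θ, Integrable (g θ)
  normalized : ∀ θ, ∫ z, g θ z = 1
  continuousOn : ∀ (s : ℕ) (ψ : Θ → ℝ), Integrable ψ π →
    ContinuousOn (fun Z : Config d s => ∫ θ, ψ θ * ∏ i, g θ (Z i) ∂π) (offDiag d s)

/-- `F` is dominated by the tensor powers of a bounded continuous function `M`. -/
structure IsTensorDominated {d : ℕ} (F : ∀ s, Config d s → ℝ) (M : Phase d → ℝ) (A C : ℝ) :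
    Prop where
  continuous : Continuous M
  nonneg : ∀ z, 0 ≤ M z
  le : ∀ z, M z ≤ A
  const_nonneg : 0 ≤ C
  bound : ∀ s, ∀ Z ∈ offDiag d s, F s Z ≤ C * ∏ i, M (Z i)

namespace IsExtendedFamily

variable {d : ℕ} [Nonempty (Fin d)] {F : ∀ s, Config d s → ℝ} (hF : IsExtendedFamily F)
  {s : ℕ} {M : Phase d → ℝ} {A C : ℝ} (hM : IsTensorDominated F M A C)

lemma measurable_prod_randomDensity (hMc : Continuous M) (Z : Config d s) :
    Measurable fun θ => ∏ i, randomDensity hF M θ (Z i) :=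
  Finset.measurable_prod _ fun _ _ =>
    (hF.measurable_randomDensity hMc).comp measurable_prodMk_right

include hM in
lemma abs_prod_randomDensity_le (θ : TestIndex d → unitInterval) (Z : Config d s) :
    |∏ i, randomDensity hF M θ (Z i)| ≤ A ^ s := by
  rw [Finset.abs_prod]
  calc ∏ i, |randomDensity hF M θ (Z i)| ≤ ∏ _i : Fin s, A := by
        refine Finset.prod_le_prod (fun _ _ => abs_nonneg _) fun i _ => ?_
        rw [abs_of_nonneg (hF.randomDensity_nonneg hM.nonneg θ _)]
        exact (hF.randomDensity_le θ _).trans (hM.le _)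
    _ = A ^ s := by simp

include hM in
lemma integrable_mul_prod_randomDensity {ψ : (TestIndex d → unitInterval) → ℝ}
    (hψ : Integrable ψ (mixingMeasure F)) (Z : Config d s) :
    Integrable (fun θ => ψ θ * ∏ i, randomDensity hF M θ (Z i)) (mixingMeasure F) :=
  hψ.mul_bdd (hF.measurable_prod_randomDensity hM.continuous Z).aestronglyMeasurable
    (Eventually.of_forall fun θ => hF.abs_prod_randomDensity_le hM θ Z)

include hM in
lemma integrable_randomDensity :
    Integrable (Function.uncurry (randomDensity hF M)) ((mixingMeasure F).prod volume) := by
  have hmeas := hF.measurable_randomDensity hM.continuous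
  refine ⟨hmeas.aestronglyMeasurable, ?_⟩
  have h0' : 0 ≤ᵐ[(mixingMeasure F).prod volume] Function.uncurry (randomDensity hF M) :=
    Eventually.of_forall fun p => hF.randomDensity_nonneg hM.nonneg p.1 p.2
  rw [hasFiniteIntegral_iff_ofReal h0', lintegral_prod_symm' _ hmeas.ennreal_ofReal]
  have h0 := mem_offDiag_of_le_one zero_le_one (Fin.elim0 : Config d 0)
  have h1 : ∀ z, ∫⁻ θ, ENNReal.ofReal (Function.uncurry (randomDensity hF M) (θ, z))
      ∂(mixingMeasure F) = ENNReal.ofReal (F 1 (singleConfig z)) := by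
    intro z
    have hz := mem_offDiag_of_le_one le_rfl (singleConfig z)
    rw [← hF.momentMeasure_real_univ hz, ofReal_measureReal, hF.momentMeasure_single_eq
      hM.continuous hM.nonneg hM.le hM.const_nonneg hM.bound z,
      withDensity_apply _ MeasurableSet.univ, Measure.restrict_univ]
    rfl
  simp_rw [h1]
  exact (hF.lintegral_snoc h0).trans_lt ENNReal.ofReal_lt_top

include hM in
lemma integral_mul_setIntegral_randomDensity {ψ : (TestIndex d → unitInterval) → ℝ} {K : ℝ}
    (hψ : AEStronglyMeasurable ψ (mixingMeasure F)) (hK : ∀ θ, |ψ θ| ≤ K) (B : Set (Phase d)) :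
    ∫ θ, ψ θ * (∫ z in B, randomDensity hF M θ z) ∂(mixingMeasure F) =
      ∫ z in B, ∫ θ, ψ θ * randomDensity hF M θ z ∂(mixingMeasure F) := by
  simp_rw [← integral_const_mul]
  refine integral_integral_swap ?_
  have h1 : Integrable (Function.uncurry (randomDensity hF M))
      ((mixingMeasure F).prod (volume.restrict B)) :=
    (hF.integrable_randomDensity hM).mono_measure
      (Measure.prod_mono le_rfl Measure.restrict_le_self)
  exact h1.bdd_mul (c := K) (hψ.comp_fst) (Eventually.of_forall fun p => hK p.1)

include hF in
-- The coordinate of the whole space is at most 1 and has mean 1. It yields the normalization of the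
-- random density.
lemma ae_coord_none : ∀ᵐ θ ∂(mixingMeasure F), (θ none : ℝ) = 1 := by
  have hprob := hF.isProbabilityMeasure_mixingMeasure
  have h0 := mem_offDiag_of_le_one zero_le_one (Fin.elim0 : Config d 0)
  have hb : Continuous fun θ : TestIndex d → unitInterval => (θ none : ℝ) := by fun_prop
  have hi : Integrable (fun θ : TestIndex d → unitInterval => (θ none : ℝ)) (mixingMeasure F) :=
    (⟨_, hb⟩ : C(TestIndex d → unitInterval, ℝ)).integrable_of_compactSpace _
  have h1 : ∫ θ, (θ none : ℝ) ∂(mixingMeasure F) = 1 := by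
    have h := hF.setIntegral_single none 1
    simp only [ContinuousMap.one_apply, one_mul, integral_const, smul_eq_mul, mul_one] at h
    rw [← h, ← hF.zero Fin.elim0, ← (hF.consistent 0 _ h0).2]
    refine (setIntegral_univ (μ := volume)).trans (integral_congr_ae (Eventually.of_forall
      fun z => ?_))
    exact hF.momentMeasure_real_univ (mem_offDiag_of_le_one le_rfl _)
  have h2 : ∫ θ, (1 - (θ none : ℝ)) ∂(mixingMeasure F) = 0 := by
    rw [integral_sub (integrable_const _) hi]
    simp [h1]
  rw [integral_eq_zero_iff_of_nonneg (fun θ => sub_nonneg.2 (θ none).2.2)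
    ((integrable_const _).sub hi)] at h2
  filter_upwards [h2] with θ hθ
  simp only [Pi.zero_apply] at hθ
  linarith

include hM in
-- By Fubini and `setIntegral_single`, both sides have the same integral against every continuous f
-- of θ. Thus almost every θ consists of the masses of its own density; countability of the test
-- sets allows one null set for all b.
lemma ae_setIntegral_randomDensity :
    ∀ᵐ θ ∂(mixingMeasure F), Integrable (randomDensity hF M θ) ∧
      ∀ b : TestIndex d, ∫ z in testSet b, randomDensity hF M θ z = θ b := by
  have hint := hF.integrable_randomDensity hM
  refine (hint.prod_right_ae).and (ae_all_iff.2 fun b => ?_)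
  have hb : Continuous fun θ : TestIndex d → unitInterval => (θ b : ℝ) := by fun_prop
  refine ae_eq_of_forall_continuousMap
    (u := fun θ => ∫ z in testSet b, randomDensity hF M θ z) (v := fun θ => (θ b : ℝ)) ?_
    ((⟨_, hb⟩ : C(TestIndex d → unitInterval, ℝ)).integrable_of_compactSpace _)
    (fun θ => integral_nonneg fun z => hF.randomDensity_nonneg hM.nonneg θ z)
    (fun θ => (θ b).2.1) fun f => ?_
  · have h1 : Integrable (Function.uncurry (randomDensity hF M))
        ((mixingMeasure F).prod (volume.restrict (testSet b))) :=
      hint.mono_measure (Measure.prod_mono le_rfl Measure.restrict_le_self)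
    exact h1.integral_prod_left
  · rw [hF.integral_mul_setIntegral_randomDensity hM (K := ‖f‖)
      f.continuous.aestronglyMeasurable (fun θ => f.norm_coe_le_norm θ), ← hF.setIntegral_single b]
    refine integral_congr_ae (Eventually.of_forall fun z => ?_)
    exact (hF.integral_single_eq hM.continuous hM.nonneg hM.le hM.const_nonneg hM.bound z f).symm

include hM in
/-- Once the moment measures have the product density, mixed moments are continuous. -/
lemma continuousOn_integral_mul_prod
    (hs : ∀ Z ∈ offDiag d s, ∀ f : C(TestIndex d → unitInterval, ℝ),
      ∫ θ, f θ ∂(momentMeasure F Z) =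
        ∫ θ, f θ * ∏ i, randomDensity hF M θ (Z i) ∂(mixingMeasure F))
    {ψ : (TestIndex d → unitInterval) → ℝ} (hψ : Integrable ψ (mixingMeasure F)) :
    ContinuousOn (fun Z : Config d s =>
      ∫ θ, ψ θ * ∏ i, randomDensity hF M θ (Z i) ∂(mixingMeasure F)) (offDiag d s) := by
  have hA : 0 ≤ A := (hM.nonneg 0).trans (hM.le 0)
  refine ContinuousOn.of_forall_approx (K := fun _ => A ^ s) continuousOn_const
    (fun _ _ => by positivity) fun ε hε => ?_
  -- An integrable ψ is approximated in L¹ by a continuous f. Because the product of densities is at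
  -- most A^s, the error is uniform in Z.
  obtain ⟨f, hf, hfi⟩ := hψ.exists_boundedContinuous_integral_sub_le hε
  refine ⟨fun Z => ∫ θ, f θ * ∏ i, randomDensity hF M θ (Z i) ∂(mixingMeasure F), ?_, ?_⟩
  · exact (hF.continuousOn_integral_momentMeasure s f.toContinuousMap).congr
      fun Z hZ => (hs Z hZ f.toContinuousMap).symm
  · intro Z _
    rw [← integral_sub (hF.integrable_mul_prod_randomDensity hM hψ Z)
      (hF.integrable_mul_prod_randomDensity hM hfi Z), ← Real.norm_eq_abs]
    calc _ ≤ ∫ θ, ‖ψ θ - f θ‖ * A ^ s ∂(mixingMeasure F) := by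
          refine norm_integral_le_of_norm_le ((hψ.sub hfi).norm.mul_const _)
            (Eventually.of_forall fun θ => ?_)
          rw [← sub_mul, norm_mul]
          exact mul_le_mul_of_nonneg_left (hF.abs_prod_randomDensity_le hM θ Z) (norm_nonneg _)
      _ ≤ ε * A ^ s := by
          rw [integral_mul_const]
          exact mul_le_mul_of_nonneg_right hf (by positivity)

include hM in
/-- The moment measure given `Z` has the density `∏ g(z_i)` with respect to the mixing measure. -/
theorem integral_momentMeasure_eq (s : ℕ) : ∀ Z ∈ offDiag d s,
    ∀ f : C(TestIndex d → unitInterval, ℝ), ∫ θ, f θ ∂(momentMeasure F Z) =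
      ∫ θ, f θ * ∏ i, randomDensity hF M θ (Z i) ∂(mixingMeasure F) := by
  -- The one-particle case is isolated because every induction step needs it: it makes z ↦ ∫ ψ(θ)
  -- g_θ(z) continuous for the discontinuous weight ψ = f ∏ g_θ(z_i).
  have hone : ∀ Z ∈ offDiag d 1, ∀ f : C(TestIndex d → unitInterval, ℝ),
      ∫ θ, f θ ∂(momentMeasure F Z) =
        ∫ θ, f θ * ∏ i, randomDensity hF M θ (Z i) ∂(mixingMeasure F) := by
    intro Z _ f
    have : Z = singleConfig (Z 0) := by
      funext i; rw [singleConfig_apply, Subsingleton.elim i 0]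
    rw [this, hF.integral_single_eq hM.continuous hM.nonneg hM.le hM.const_nonneg hM.bound]
    simp
  induction s with
  | zero =>
    intro Z _ f
    rw [show Z = Fin.elim0 from Subsingleton.elim _ _]
    simp [mixingMeasure]
  | succ s ih =>
    intro Z' hZ' f
    obtain ⟨Z, z, rfl⟩ : ∃ Z z, Z' = Fin.snoc (α := fun _ => Phase d) Z z :=
      ⟨_, _, (Fin.snoc_init_self Z').symm⟩
    have hZ := (snoc_mem_offDiag.1 hZ').1
    let ψ : (TestIndex d → unitInterval) → ℝ := fun θ => f θ * ∏ i, randomDensity hF M θ (Z i)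
    have hψ : Integrable ψ (mixingMeasure F) :=
      hF.integrable_mul_prod_randomDensity hM (f.integrable_of_compactSpace _) Z
    have hψK : ∀ θ, |ψ θ| ≤ ‖f‖ * A ^ s := fun θ => by
      rw [abs_mul]
      exact mul_le_mul (f.norm_coe_le_norm θ) (hF.abs_prod_randomDensity_le hM θ Z)
        (abs_nonneg _) (norm_nonneg _)
    have key := eq_of_forall_basis_setIntegral_eq (μ := volume)
      (U := {z | Fin.snoc (α := fun _ => Phase d) Z z ∈ offDiag d (s + 1)})
      (h := fun z => ∫ θ, f θ ∂(momentMeasure F (Fin.snoc (α := fun _ => Phase d) Z z)))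
      (k := fun z => ∫ θ, ψ θ * randomDensity hF M θ z ∂(mixingMeasure F))
      ((isOpen_offDiag _).preimage (continuous_snoc.comp (Continuous.prodMk_right Z)))
      (hF.continuousOn_integral_momentMeasure_snoc Z f) ?_ ?_ z hZ'
    · refine key.trans ?_
      refine integral_congr_ae (Eventually.of_forall fun θ => ?_)
      simp [ψ, Fin.prod_univ_castSucc, mul_assoc]
    · have h1 := (hF.continuousOn_integral_mul_prod hM hone hψ).comp
        (continuous_singleConfig (d := d)).continuousOn (s := Set.univ)
        fun z _ => mem_offDiag_of_le_one le_rfl _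
      refine (h1.mono (Set.subset_univ _)).congr fun z _ => ?_
      simp
    -- On the left, integration over b inserts θ_b, and the induction hypothesis applies to f θ_b.
    -- On the right, Fubini produces ∫_b g_θ, which is θ_b almost surely.
    · intro b hb
      rw [show b = testSet (some ⟨b, hb⟩) from rfl, hF.setIntegral_momentMeasure_snoc hZ,
        ← hF.integral_mul_setIntegral_randomDensity hM hψ.aestronglyMeasurable hψK]
      refine (ih Z hZ (f * ⟨fun θ => (θ (some ⟨b, hb⟩) : ℝ), by fun_prop⟩)).trans ?_
      refine integral_congr_ae ?_
      filter_upwards [hF.ae_setIntegral_randomDensity hM] with θ hθ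
      rw [hθ.2]
      simp only [ContinuousMap.mul_apply, ContinuousMap.coe_mk, ψ]
      ring

include hF hM in
/-- **De Finetti's theorem for densities**: a consistent family of marginals is a mixture of tensor
powers at every configuration without coinciding positions. -/
theorem exists_isRandomDensity :
    ∃ (Θ : Type) (_ : MeasurableSpace Θ) (π : Measure Θ) (g : Θ → Phase d → ℝ),
      IsProbabilityMeasure π ∧ IsRandomDensity π M g ∧ Function.Injective g ∧
      ∀ s, ∀ Z ∈ offDiag d s, F s Z = ∫ θ, ∏ i, g θ (Z i) ∂π := by
  have hae := hF.ae_coord_none.and (hF.ae_setIntegral_randomDensity hM)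
  -- Discarding a measurable null set makes g_θ a probability density with masses θ_b for every
  -- remaining θ. In particular g_θ determines θ, which gives injectivity.
  obtain ⟨N, hN, hNm, hN0⟩ := exists_measurable_superset_of_null (ae_iff.1 hae)
  have hgood : ∀ θ : ↥Nᶜ, ((θ : TestIndex d → unitInterval) none : ℝ) = 1 ∧
      Integrable (randomDensity hF M θ) ∧
      ∀ b : TestIndex d, ∫ z in testSet b, randomDensity hF M θ z = (θ : TestIndex d → unitInterval) b := by
    intro θ
    by_contra h
    exact θ.2 (hN h)
  have hemb : MeasurableEmbedding ((↑) : ↥Nᶜ → TestIndex d → unitInterval) :=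
    MeasurableEmbedding.subtype_coe hNm.compl
  let π : Measure ↥Nᶜ := (mixingMeasure F).comap (↑)
  have hπ : π.map (↑) = mixingMeasure F := by
    rw [map_comap_subtype_coe hNm.compl, Measure.restrict_eq_self_of_ae_mem]
    exact compl_mem_ae_iff.2 hN0
  have hint : ∀ f : (TestIndex d → unitInterval) → ℝ,
      ∫ θ, f (θ : ↥Nᶜ) ∂π = ∫ θ, f θ ∂(mixingMeasure F) := by
    intro f
    rw [← hπ, hemb.integral_map]
  have hprob := hF.isProbabilityMeasure_mixingMeasure
  refine ⟨↥Nᶜ, inferInstance, π, fun θ => randomDensity hF M θ, ⟨?_⟩, ⟨?_, ?_, ?_, ?_, ?_, ?_⟩,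
    ?_, ?_⟩
  · have h := hprob.measure_univ
    rw [← hπ, hemb.map_apply] at h
    simpa using h
  · exact (hF.measurable_randomDensity hM.continuous).comp
      ((measurable_subtype_coe.comp measurable_fst).prodMk measurable_snd)
  · exact fun θ z => hF.randomDensity_nonneg hM.nonneg θ z
  · exact fun θ z => hF.randomDensity_le θ z
  · exact fun θ => (hgood θ).2.1
  · intro θ
    obtain ⟨h1, -, h2⟩ := hgood θ
    rw [← setIntegral_univ, ← h1]
    exact h2 none
  · intro s ψ hψ
    have hψ' : Integrable (Function.extend (↑) ψ 0) (mixingMeasure F) := by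
      rw [← hπ, hemb.integrable_map_iff]
      exact hψ.congr (Eventually.of_forall fun θ => (hemb.injective.extend_apply ψ 0 θ).symm)
    refine (hF.continuousOn_integral_mul_prod hM (hF.integral_momentMeasure_eq hM s) hψ').congr
      fun Z _ => ?_
    simp only
    rw [← hint]
    refine integral_congr_ae (Eventually.of_forall fun θ => ?_)
    simp only [hemb.injective.extend_apply]
  · intro θ θ' h
    refine Subtype.ext (funext fun b => Subtype.ext ?_)
    rw [← (hgood θ).2.2 b, ← (hgood θ').2.2 b]
    simp only at h
    rw [h]
  · intro s Z hZ
    rw [hint fun θ => ∏ i, randomDensity hF M θ (Z i), ← hF.momentMeasure_real_univ hZ]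
    have := hF.integral_momentMeasure_eq hM s Z hZ 1
    simpa using this

end IsExtendedFamily

end

noncomputable section

/-! ### Weighted norms -/

/-- The weight `z ↦ e^{-μ} e^{-β |v|² / 2}`. -/
def maxwellWeight {d : ℕ} (β μ : ℝ) (z : Phase d) : ℝ :=
  Real.exp (-μ) * Real.exp (-(β * (‖z.2‖ ^ 2 / 2)))

section Weight

variable {d : ℕ} {β μ : ℝ}

lemma continuous_maxwellWeight : Continuous (maxwellWeight β μ : Phase d → ℝ) := by
  unfold maxwellWeight; fun_prop

lemma maxwellWeight_pos (z : Phase d) : 0 < maxwellWeight β μ z := by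
  unfold maxwellWeight; positivity

lemma maxwellWeight_le (hβ : 0 ≤ β) (z : Phase d) : maxwellWeight β μ z ≤ Real.exp (-μ) := by
  refine mul_le_of_le_one_right (Real.exp_pos _).le (Real.exp_le_one_iff.2 ?_)
  rw [neg_nonpos]
  positivity

lemma prod_maxwellWeight_mul {s : ℕ} (Z : Config d s) :
    (∏ i, maxwellWeight β μ (Z i)) * Real.exp (β * freeEnergy Z) * Real.exp (μ * s) = 1 := by
  simp only [maxwellWeight, freeEnergy, ← Real.exp_sum, ← Real.exp_add]
  rw [Real.exp_eq_one_iff, Finset.mul_sum, Finset.sum_add_distrib, Finset.sum_neg_distrib]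
  simp
  ring

/-- The weight e^{βE₀} e^{μs} is the reciprocal of the tensor power of the Maxwellian, so norm
bounds and tensor domination are the same thing. -/
lemma weighted_le_iff {s : ℕ} (Z : Config d s) (a K : ℝ) :
    a * Real.exp (β * freeEnergy Z) * Real.exp (μ * s) ≤ K ↔
      a ≤ K * ∏ i, maxwellWeight β μ (Z i) := by
  have h := prod_maxwellWeight_mul (β := β) (μ := μ) Z
  have h1 : 0 < Real.exp (β * freeEnergy Z) * Real.exp (μ * s) := by positivity
  have h2 : ∏ i, maxwellWeight β μ (Z i) =
      (Real.exp (β * freeEnergy Z) * Real.exp (μ * s))⁻¹ := by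
    exact eq_inv_of_mul_eq_one_left (by rw [← mul_assoc, h])
  rw [h2, ← div_eq_mul_inv, le_div_iff₀ h1, mul_assoc]

lemma le_of_familyNorm_le {D : ∀ s, Set (Config d s)} {G : ∀ s, Config d s → ℝ} {K : ℝ≥0∞}
    (hK : K ≠ ⊤) (h : familyNorm D β μ G ≤ K) {s : ℕ} (hs : 1 ≤ s) {Z : Config d s}
    (hZ : Z ∈ D s) : |G s Z| ≤ K.toReal * ∏ i, maxwellWeight β μ (Z i) := by
  rw [← weighted_le_iff, ← ENNReal.ofReal_le_iff_le_toReal hK]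
  refine le_trans ?_ h
  rw [ENNReal.ofReal_mul (by positivity)]
  refine le_trans ?_ (le_iSup₂ (f := fun (s : ℕ) (_ : 1 ≤ s) =>
    levelNorm (D s) β (G s) * ENNReal.ofReal (Real.exp (μ * s))) s hs)
  gcongr
  exact le_iSup₂ (f := fun Z (_ : Z ∈ D s) =>
    ENNReal.ofReal (|G s Z| * Real.exp (β * freeEnergy Z))) Z hZ

lemma familyNorm_le {D : ∀ s, Set (Config d s)} {G : ∀ s, Config d s → ℝ} {K : ℝ}
    (h : ∀ s, 1 ≤ s → ∀ Z ∈ D s, |G s Z| ≤ K * ∏ i, maxwellWeight β μ (Z i)) :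
    familyNorm D β μ G ≤ ENNReal.ofReal K := by
  refine iSup₂_le fun s hs => ?_
  rw [levelNorm, ENNReal.iSup_mul]
  refine iSup_le fun Z => ?_
  rw [ENNReal.iSup_mul]
  refine iSup_le fun hZ => ?_
  rw [← ENNReal.ofReal_mul (by positivity)]
  exact ENNReal.ofReal_le_ofReal ((weighted_le_iff Z _ _).2 (h s hs Z hZ))

end Weight

/-! ### The representation theorem -/

/-- Replacing the zeroth member of a family by the constant `1`. -/
def extendFamily {d : ℕ} (F : ∀ s, Config d s → ℝ) : ∀ s, Config d s → ℝ
  | 0 => fun _ => 1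
  | s + 1 => F (s + 1)

lemma extendFamily_of_pos {d : ℕ} (F : ∀ s, Config d s → ℝ) {s : ℕ} (hs : 1 ≤ s) :
    extendFamily F s = F s := by
  obtain ⟨s, rfl⟩ := Nat.exists_eq_add_of_le' hs
  rfl

section Representation

variable {d : ℕ} {F : ∀ s, Config d s → ℝ} {β μ : ℝ}

lemma IsMarginalFamily.isExtendedFamily (hF : IsMarginalFamily F) :
    IsExtendedFamily (extendFamily F) where
  nonneg
    | 0 => fun _ _ => zero_le_one
    | s + 1 => hF.nonneg (s + 1) (by omega)
  continuous
    | 0 => continuousOn_const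
    | s + 1 => hF.continuous (s + 1) (by omega)
  symm
    | 0 => fun _ _ _ => rfl
    | s + 1 => hF.symm (s + 1) (by omega)
  consistent
    -- Consistency between levels 0 and 1 is the normalization of F_1, as Ω_1 is the whole space.
    | 0 => fun Z _ => by
      have huniv : offDiag d 1 = Set.univ :=
        Set.eq_univ_of_forall fun W => mem_offDiag_of_le_one le_rfl W
      have hint := hF.integrable 1 le_rfl
      have hone := hF.normalized
      rw [huniv, integrableOn_univ] at hint
      rw [huniv, setIntegral_univ] at hone
      have hmp := (volume_preserving_funUnique (Fin 1) (Phase d)).symm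
      have heq : ∀ z : Phase d, Fin.snoc (α := fun _ => Phase d) Z z =
          (MeasurableEquiv.funUnique (Fin 1) (Phase d)).symm z := by
        intro z
        rw [show Z = Fin.elim0 from Subsingleton.elim _ _]
        funext i
        exact singleConfig_apply z i
      simp_rw [heq]
      exact ⟨(hmp.integrable_comp_emb (MeasurableEquiv.measurableEmbedding _)).2 hint,
        (hmp.integral_comp' (F 1)).trans hone⟩
    | s + 1 => hF.consistent (s + 1) (by omega)
  zero _ := rfl

/-- The additional 1 in the constant covers level zero, where the family is 1 and the product is
empty. -/
lemma isTensorDominated_extendFamily (hβ : 0 < β)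
    (hnorm : familyNorm (offDiag d) β μ F < ⊤) :
    IsTensorDominated (extendFamily F) (maxwellWeight β μ) (Real.exp (-μ))
      ((familyNorm (offDiag d) β μ F).toReal + 1) where
  continuous := continuous_maxwellWeight
  nonneg z := (maxwellWeight_pos z).le
  le := maxwellWeight_le hβ.le
  const_nonneg := by positivity
  bound
    | 0 => fun Z _ => by simp [extendFamily]
    | s + 1 => fun Z hZ => by
      refine (le_abs_self _).trans ((le_of_familyNorm_le hnorm.ne le_rfl (by omega) hZ).trans ?_)
      refine mul_le_mul_of_nonneg_right (by linarith) ?_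
      exact Finset.prod_nonneg fun i _ => (maxwellWeight_pos _).le

variable [Nonempty (Fin d)]

lemma exists_isRandomDensity_of_familyNorm_lt_top (hF : IsMarginalFamily F) (hβ : 0 < β)
    (hnorm : familyNorm (offDiag d) β μ F < ⊤) :
    ∃ (Θ : Type) (_ : MeasurableSpace Θ) (π : Measure Θ) (g : Θ → Phase d → ℝ),
      IsProbabilityMeasure π ∧ IsRandomDensity π (maxwellWeight β μ) g ∧ Function.Injective g ∧
      ∀ s, 1 ≤ s → ∀ Z ∈ offDiag d s, F s Z = ∫ θ, ∏ i, g θ (Z i) ∂π := by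
  obtain ⟨Θ, mΘ, π, g, hπ, hg, hinj, hFg⟩ :=
    hF.isExtendedFamily.exists_isRandomDensity (isTensorDominated_extendFamily hβ hnorm)
  refine ⟨Θ, mΘ, π, g, hπ, hg, hinj, fun s hs Z hZ => ?_⟩
  rw [← hFg s Z hZ, extendFamily_of_pos F hs]

/-- The members of a random density, as probability densities. -/
def IsRandomDensity.toProbDensity {Θ : Type*} [MeasurableSpace Θ] {π : Measure Θ}
    {M : Phase d → ℝ} {g : Θ → Phase d → ℝ} (hg : IsRandomDensity π M g) (θ : Θ) :
    ProbDensity d where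
  toFun := g θ
  measurable := hg.measurable.comp measurable_prodMk_left
  nonneg := hg.nonneg θ
  integrable := hg.integrable θ
  normalized := hg.normalized θ

omit [Nonempty (Fin d)] in
lemma IsRandomDensity.integrable_prod {Θ : Type*} [MeasurableSpace Θ] {π : Measure Θ}
    [IsFiniteMeasure π] {M : Phase d → ℝ} {g : Θ → Phase d → ℝ} (hg : IsRandomDensity π M g)
    {s : ℕ} (Z : Config d s) : Integrable (fun θ => ∏ i, g θ (Z i)) π := by
  refine Integrable.of_bound (C := ∏ i, M (Z i)) (Finset.measurable_prod _ fun i _ =>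
    hg.measurable.comp measurable_prodMk_right).aestronglyMeasurable
    (Eventually.of_forall fun θ => ?_)
  rw [Real.norm_eq_abs, Finset.abs_prod]
  refine Finset.prod_le_prod (fun _ _ => abs_nonneg _) fun i _ => ?_
  rw [abs_of_nonneg (hg.nonneg θ _)]
  exact hg.le θ _

theorem isTensorMixture_of_familyNorm_lt_top (hF : IsMarginalFamily F) (hβ : 0 < β)
    (hnorm : familyNorm (offDiag d) β μ F < ⊤) : IsTensorMixture β μ F := by
  obtain ⟨Θ, mΘ, π, g, hπ, hg, hinj, hFg⟩ :=
    exists_isRandomDensity_of_familyNorm_lt_top hF hβ hnorm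
  have hGinj : Function.Injective hg.toProbDensity := fun θ θ' h =>
    hinj (congrArg ProbDensity.toFun h)
  -- Distinct parameters have distinct densities, so the σ-algebra of the parameter space can be
  -- carried over to the set of densities, preserving joint measurability.
  let e : Θ ≃ Set.range hg.toProbDensity := Equiv.ofInjective _ hGinj
  let mS : MeasurableSpace (Set.range hg.toProbDensity) := MeasurableSpace.comap e.symm mΘ
  have hes : Measurable e.symm := comap_measurable _
  have he : Measurable e := by
    refine measurable_comap_iff.2 ?_
    rw [Equiv.symm_comp_self]
    exact measurable_id
  have htoFun : ∀ p : Set.range hg.toProbDensity, p.1.toFun = g (e.symm p) := fun p =>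
    congrArg (fun q : Set.range hg.toProbDensity => q.1.toFun) (e.apply_symm_apply p).symm
  have hmeas : Measurable fun p : Set.range hg.toProbDensity × Phase d => p.1.1.toFun p.2 := by
    simp_rw [htoFun]
    exact hg.measurable.comp ((hes.comp measurable_fst).prodMk measurable_snd)
  refine ⟨Set.range hg.toProbDensity, mS, π.map e, ⟨?_⟩, hmeas, ?_, fun s hs Z hZ => ?_⟩
  · rw [Measure.map_apply he MeasurableSet.univ, Set.preimage_univ, measure_univ]
  · rintro _ ⟨θ, rfl⟩
    refine iSup₂_le fun Z _ => ENNReal.ofReal_le_ofReal ?_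
    have hle : |(hg.toProbDensity θ).tensorPower 1 Z| ≤ 1 * ∏ i, maxwellWeight β μ (Z i) := by
      simp only [ProbDensity.tensorPower, Fin.prod_univ_one, one_mul]
      rw [abs_of_nonneg ((hg.toProbDensity θ).nonneg _)]
      exact hg.le θ _
    rw [← weighted_le_iff, Nat.cast_one, mul_one] at hle
    rwa [Real.exp_neg, ← one_div, le_div_iff₀ (Real.exp_pos _)]
  · have hm : Measurable fun p : Set.range hg.toProbDensity => p.1.tensorPower s Z :=
      Finset.measurable_prod _ fun i _ => hmeas.comp measurable_prodMk_right
    rw [integrable_map_measure hm.aestronglyMeasurable he.aemeasurable,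
      integral_map he.aemeasurable hm.aestronglyMeasurable]
    exact ⟨hg.integrable_prod Z, hFg s hs Z hZ⟩

end Representation

end

noncomputable section

/-! ### Hard-sphere configurations -/

section HardSphere

variable {d : ℕ} {ε : ℝ}

lemma hardSphere_subset_offDiag (hε : 0 ≤ ε) (s : ℕ) : hardSphere d ε s ⊆ offDiag d s := by
  intro Z hZ i j hij h
  have := hZ i j hij
  rw [h, sub_self, norm_zero] at this
  linarith

lemma isOpen_hardSphere (s : ℕ) : IsOpen (hardSphere d ε s) := by
  have : hardSphere d ε s = ⋂ i, ⋂ j, ⋂ (_ : i ≠ j), {Z | ε < ‖(Z i).1 - (Z j).1‖} := by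
    ext Z; simp [hardSphere]
  rw [this]
  refine isOpen_iInter_of_finite fun i => isOpen_iInter_of_finite fun j =>
    isOpen_iInter_of_finite fun _ => ?_
  exact isOpen_lt continuous_const (by fun_prop)

lemma comp_injective_mem_hardSphere {s t : ℕ} {Z : Config d s} (hZ : Z ∈ hardSphere d ε s)
    {e : Fin t → Fin s} (he : Function.Injective e) : Z ∘ e ∈ hardSphere d ε t :=
  fun _ _ hij => hZ _ _ (he.ne hij)

/-- The configurations of `k` hard spheres that do not overlap the spheres of `Z`. -/
def compatible (ε : ℝ) {s : ℕ} (Z : Config d s) (k : ℕ) : Set (Config d k) :=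
  {W | W ∈ hardSphere d ε k ∧ ∀ i j, ε < ‖(Z i).1 - (W j).1‖}

lemma measurableSet_compatible {s : ℕ} (Z : Config d s) (k : ℕ) :
    MeasurableSet (compatible ε Z k) := by
  have : compatible ε Z k = hardSphere d ε k ∩ ⋂ i, ⋂ j, {W | ε < ‖(Z i).1 - (W j).1‖} := by
    ext W; simp [compatible]
  rw [this]
  refine (isOpen_hardSphere k).measurableSet.inter ?_
  exact MeasurableSet.iInter fun i => MeasurableSet.iInter fun j =>
    measurableSet_lt measurable_const (by fun_prop)

lemma append_mem_hardSphere {s k : ℕ} {Z : Config d s} {W : Config d k} :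
    Fin.append Z W ∈ hardSphere d ε (s + k) ↔ Z ∈ hardSphere d ε s ∧ W ∈ compatible ε Z k := by
  constructor
  · intro h
    refine ⟨fun i j hij => ?_, fun i j hij => ?_, fun i j => ?_⟩
    · simpa using h (Fin.castAdd k i) (Fin.castAdd k j) (by simpa using hij)
    · simpa using h (Fin.natAdd s i) (Fin.natAdd s j) (by simpa using hij)
    · simpa using h (Fin.castAdd k i) (Fin.natAdd s j) (by simp [Fin.ext_iff]; omega)
  · rintro ⟨h1, h2, h3⟩ i j
    induction i using Fin.addCases with
    | left i =>
      induction j using Fin.addCases with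
      | left j => intro hij; simpa using h1 i j (by simpa using hij)
      | right j => intro _; simpa using h3 i j
    | right i =>
      induction j using Fin.addCases with
      | left j => intro _; simpa [norm_sub_rev] using h3 j i
      | right j => intro hij; simpa using h2 i j (by simpa using hij)

lemma glue_eq_append {s N : ℕ} (h : s ≤ N) (Z : Config d s) (W : Config d (N - s)) :
    glue Z W = Fin.append Z W ∘ finCongr (Nat.add_sub_cancel' h).symm := by
  funext i
  by_cases hi : i.1 < s
  · have : finCongr (Nat.add_sub_cancel' h).symm i = Fin.castAdd (N - s) ⟨i.1, hi⟩ := rfl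
    rw [Function.comp_apply, this, Fin.append_left, glue, dif_pos hi]
  · have : finCongr (Nat.add_sub_cancel' h).symm i = Fin.natAdd s ⟨i.1 - s, by omega⟩ :=
      Fin.ext (by simp; omega)
    rw [Function.comp_apply, this, Fin.append_right, glue, dif_neg hi]

lemma glue_mem_hardSphere {s N : ℕ} (h : s ≤ N) {Z : Config d s} {W : Config d (N - s)} :
    glue Z W ∈ hardSphere d ε N ↔ Z ∈ hardSphere d ε s ∧ W ∈ compatible ε Z (N - s) := by
  rw [← append_mem_hardSphere, glue_eq_append h]
  refine ⟨fun hm => ?_, fun hm => comp_injective_mem_hardSphere hm (Equiv.injective _)⟩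
  have := comp_injective_mem_hardSphere hm (finCongr (Nat.add_sub_cancel' h)).injective
  exact this

lemma prod_glue {s N : ℕ} (h : s ≤ N) (Z : Config d s) (W : Config d (N - s)) (f : Phase d → ℝ) :
    ∏ i, f (glue Z W i) = (∏ i, f (Z i)) * ∏ i, f (W i) := by
  rw [glue_eq_append h]
  have := Equiv.prod_comp (finCongr (Nat.add_sub_cancel' h).symm)
    fun i => f (Fin.append Z W i)
  simp only [Function.comp_apply]
  rw [this, Fin.prod_univ_add]
  simp

end HardSphere

/-! ### Hard-sphere probabilities of independent particles -/

section Probability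

variable {d : ℕ}

/-- The probability that `k` independent particles with law `P` form a hard-sphere configuration. -/
def spacingProb (ε : ℝ) (P : Measure (Phase d)) (k : ℕ) : ℝ :=
  (Measure.pi fun _ : Fin k => P).real (hardSphere d ε k)

/-- The probability that `k` independent particles with law `P` form a hard-sphere configuration
compatible with `Z`. -/
def compatProb (ε : ℝ) (P : Measure (Phase d)) {s : ℕ} (Z : Config d s) (k : ℕ) : ℝ :=
  (Measure.pi fun _ : Fin k => P).real (compatible ε Z k)

variable {ε κ : ℝ} {P : Measure (Phase d)}

lemma spacingProb_nonneg (k : ℕ) : 0 ≤ spacingProb ε P k := measureReal_nonneg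

lemma compatProb_nonneg {s : ℕ} (Z : Config d s) (k : ℕ) : 0 ≤ compatProb ε P Z k :=
  measureReal_nonneg

variable [IsProbabilityMeasure P]

lemma compatProb_le_one {s : ℕ} (Z : Config d s) (k : ℕ) : compatProb ε P Z k ≤ 1 :=
  measureReal_le_one

lemma compatProb_le_spacingProb {s : ℕ} (Z : Config d s) (k : ℕ) :
    compatProb ε P Z k ≤ spacingProb ε P k :=
  measureReal_mono fun _ h => h.1

lemma spacingProb_zero : spacingProb ε P 0 = 1 := by
  have : hardSphere d ε 0 = Set.univ := Set.eq_univ_of_forall fun Z i => i.elim0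
  rw [spacingProb, this, probReal_univ]

lemma pi_real_removeNth {k : ℕ} (j : Fin (k + 1)) {B : Set (Config d k)} (hB : MeasurableSet B) :
    (Measure.pi fun _ : Fin (k + 1) => P).real {W | W ∘ j.succAbove ∈ B} =
      (Measure.pi fun _ : Fin k => P).real B := by
  have hm : MeasurableSet {W : Config d (k + 1) | W ∘ j.succAbove ∈ B} :=
    (by fun_prop : Measurable fun W : Config d (k + 1) => W ∘ j.succAbove) hB
  have h := measurePreserving_insertNth P j
  rw [measureReal_def, ← h.measure_preimage hm.nullMeasurableSet, measureReal_def]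
  have : (fun p : Phase d × (Fin k → Phase d) => j.insertNth (α := fun _ => Phase d) p.1 p.2) ⁻¹'
      {W | W ∘ j.succAbove ∈ B} = Set.univ ×ˢ B := by
    ext ⟨z, W⟩
    simp
  rw [this, Measure.prod_prod, measure_univ, one_mul]

/-- Overlaps of the `j`-th particle with a point depending on the other particles are rare. -/
lemma pi_real_overlap_le (hκ0 : 0 ≤ κ) (hκ : ∀ x, P.real {z | ‖x - z.1‖ ≤ ε} ≤ κ) {k : ℕ}
    (j : Fin (k + 1)) {B : Set (Config d k)} (hB : MeasurableSet B)
    {x : Config d k → EuclideanSpace ℝ (Fin d)} (hx : Measurable x) :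
    (Measure.pi fun _ : Fin (k + 1) => P).real
        {W | W ∘ j.succAbove ∈ B ∧ ‖x (W ∘ j.succAbove) - (W j).1‖ ≤ ε} ≤
      κ * (Measure.pi fun _ : Fin k => P).real B := by
  have hm : MeasurableSet
      {W : Config d (k + 1) | W ∘ j.succAbove ∈ B ∧ ‖x (W ∘ j.succAbove) - (W j).1‖ ≤ ε} := by
    have hs : Measurable fun W : Config d (k + 1) => W ∘ j.succAbove := by fun_prop
    exact (hs hB).inter (measurableSet_le (((hx.comp hs).sub
      (measurable_fst.comp (measurable_pi_apply j))).norm) measurable_const)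
  have h := measurePreserving_insertNth P j
  rw [measureReal_def, ← h.measure_preimage hm.nullMeasurableSet,
    Measure.prod_apply_symm (h.measurable hm)]
  refine ENNReal.toReal_le_of_le_ofReal (by positivity) ?_
  rw [ENNReal.ofReal_mul hκ0, ofReal_measureReal, ← lintegral_indicator_const hB]
  refine lintegral_mono fun W => ?_
  by_cases hW : W ∈ B
  · rw [Set.indicator_of_mem hW]
    have hs : (fun z => (z, W)) ⁻¹' ((fun p : Phase d × (Fin k → Phase d) =>
        j.insertNth (α := fun _ => Phase d) p.1 p.2) ⁻¹'
          {W | W ∘ j.succAbove ∈ B ∧ ‖x (W ∘ j.succAbove) - (W j).1‖ ≤ ε}) =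
        {z | ‖x W - z.1‖ ≤ ε} := by
      ext z
      simp [hW]
    rw [hs, ← ofReal_measureReal]
    exact ENNReal.ofReal_le_ofReal (hκ _)
  · have hs : (fun z => (z, W)) ⁻¹' ((fun p : Phase d × (Fin k → Phase d) =>
        j.insertNth (α := fun _ => Phase d) p.1 p.2) ⁻¹'
          {W | W ∘ j.succAbove ∈ B ∧ ‖x (W ∘ j.succAbove) - (W j).1‖ ≤ ε}) = ∅ := by
      ext z
      simp [hW]
    rw [hs, measure_empty]
    exact zero_le

lemma spacingProb_succ_le (k : ℕ) : spacingProb ε P (k + 1) ≤ spacingProb ε P k := by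
  rw [spacingProb, spacingProb, ← pi_real_removeNth (Fin.last k) (isOpen_hardSphere k).measurableSet]
  exact measureReal_mono fun W hW => comp_injective_mem_hardSphere hW
    (Fin.succAbove_right_injective)

lemma spacingProb_antitone : Antitone (spacingProb ε P) :=
  antitone_nat_of_succ_le spacingProb_succ_le

/-- Union bound over the k particles that the last one may overlap, each overlap costing a factor κ
by independence. -/
lemma one_sub_mul_spacingProb_le (hκ0 : 0 ≤ κ) (hκ : ∀ x, P.real {z | ‖x - z.1‖ ≤ ε} ≤ κ)
    (k : ℕ) : (1 - k * κ) * spacingProb ε P k ≤ spacingProb ε P (k + 1) := by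
  have hB := (isOpen_hardSphere (d := d) (ε := ε) k).measurableSet
  have hcover : {W : Config d (k + 1) | W ∘ (Fin.last k).succAbove ∈ hardSphere d ε k} ⊆
      hardSphere d ε (k + 1) ∪ ⋃ i : Fin k, {W | W ∘ (Fin.last k).succAbove ∈ hardSphere d ε k ∧
        ‖((W ∘ (Fin.last k).succAbove) i).1 - (W (Fin.last k)).1‖ ≤ ε} := by
    intro W hW
    by_cases h : ∃ i : Fin k, ‖((W ∘ (Fin.last k).succAbove) i).1 - (W (Fin.last k)).1‖ ≤ ε
    · obtain ⟨i, hi⟩ := h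
      exact Or.inr (Set.mem_iUnion.2 ⟨i, hW, hi⟩)
    · push Not at h
      simp only [Fin.succAbove_last, Function.comp_apply] at h
      left
      intro i j hij
      induction i using Fin.lastCases with
      | last =>
        induction j using Fin.lastCases with
        | last => exact absurd rfl hij
        | cast j => rw [norm_sub_rev]; exact h j
      | cast i =>
        induction j using Fin.lastCases with
        | last => exact h i
        | cast j =>
          have := hW i j (by simpa using hij)
          simpa using this
  have h1 := (measureReal_mono (μ := Measure.pi fun _ : Fin (k + 1) => P) hcover).trans
    ((measureReal_union_le _ _).trans (add_le_add le_rfl (measureReal_iUnion_fintype_le _)))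
  rw [pi_real_removeNth (Fin.last k) hB] at h1
  have h2 : ∀ i : Fin k, (Measure.pi fun _ : Fin (k + 1) => P).real
      {W | W ∘ (Fin.last k).succAbove ∈ hardSphere d ε k ∧
        ‖((W ∘ (Fin.last k).succAbove) i).1 - (W (Fin.last k)).1‖ ≤ ε} ≤
      κ * spacingProb ε P k := fun i =>
    pi_real_overlap_le hκ0 hκ (Fin.last k) hB (x := fun W => (W i).1) (by fun_prop)
  have h3 := Finset.sum_le_sum fun i (_ : i ∈ Finset.univ) => h2 i
  simp only [Finset.sum_const, Finset.card_univ, Fintype.card_fin, nsmul_eq_mul] at h3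
  simp only [spacingProb] at h3 ⊢
  linarith

/-- Union bound over the s(k + 1) pairs. The overlapping particle is removed while the other k are
kept non-overlapping, so the error is proportional to `spacingProb ε P k`; an absolute error would
be useless after division by a possibly tiny spacing probability. -/
lemma spacingProb_sub_compatProb_le (hκ0 : 0 ≤ κ) (hκ : ∀ x, P.real {z | ‖x - z.1‖ ≤ ε} ≤ κ)
    {s : ℕ} (Z : Config d s) (k : ℕ) :
    spacingProb ε P (k + 1) - compatProb ε P Z (k + 1) ≤ s * (k + 1) * κ * spacingProb ε P k := by
  have hB := (isOpen_hardSphere (d := d) (ε := ε) k).measurableSet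
  have hcover : hardSphere d ε (k + 1) ⊆ compatible ε Z (k + 1) ∪
      ⋃ p : Fin s × Fin (k + 1), {W | W ∘ p.2.succAbove ∈ hardSphere d ε k ∧
        ‖(Z p.1).1 - (W p.2).1‖ ≤ ε} := by
    intro W hW
    by_cases h : ∃ i j, ‖(Z i).1 - (W j).1‖ ≤ ε
    · obtain ⟨i, j, hij⟩ := h
      exact Or.inr (Set.mem_iUnion.2 ⟨(i, j),
        comp_injective_mem_hardSphere hW Fin.succAbove_right_injective, hij⟩)
    · push Not at h
      exact Or.inl ⟨hW, h⟩
  have h1 := (measureReal_mono (μ := Measure.pi fun _ : Fin (k + 1) => P) hcover).trans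
    ((measureReal_union_le _ _).trans (add_le_add le_rfl (measureReal_iUnion_fintype_le _)))
  have h2 : ∀ p : Fin s × Fin (k + 1), (Measure.pi fun _ : Fin (k + 1) => P).real
      {W | W ∘ p.2.succAbove ∈ hardSphere d ε k ∧ ‖(Z p.1).1 - (W p.2).1‖ ≤ ε} ≤
      κ * spacingProb ε P k := fun p =>
    pi_real_overlap_le hκ0 hκ p.2 hB (x := fun _ => (Z p.1).1) measurable_const
  have h3 := Finset.sum_le_sum fun p (_ : p ∈ Finset.univ) => h2 p
  simp only [Finset.sum_const, Finset.card_univ, Fintype.card_prod, Fintype.card_fin,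
    nsmul_eq_mul] at h3
  push_cast at h3
  simp only [spacingProb, compatProb] at h3 ⊢
  linarith

lemma pow_mul_spacingProb_le (hκ0 : 0 ≤ κ) (hκ : ∀ x, P.real {z | ‖x - z.1‖ ≤ ε} ≤ κ)
    {N : ℕ} (hN : N * κ ≤ 1) (k m : ℕ) (hkm : k + m ≤ N) :
    (1 - N * κ) ^ m * spacingProb ε P k ≤ spacingProb ε P (k + m) := by
  induction m with
  | zero => simp
  | succ m ih =>
    have h1 := one_sub_mul_spacingProb_le hκ0 hκ (k + m)
    have h2 : (1 - N * κ) * spacingProb ε P (k + m) ≤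
        (1 - (k + m : ℕ) * κ) * spacingProb ε P (k + m) := by
      refine mul_le_mul_of_nonneg_right ?_ (spacingProb_nonneg _)
      have : ((k + m : ℕ) : ℝ) ≤ N := by exact_mod_cast (by omega : k + m ≤ N)
      nlinarith
    calc (1 - N * κ) ^ (m + 1) * spacingProb ε P k
        = (1 - N * κ) * ((1 - N * κ) ^ m * spacingProb ε P k) := by ring
      _ ≤ (1 - N * κ) * spacingProb ε P (k + m) :=
          mul_le_mul_of_nonneg_left (ih (by omega)) (by linarith)
      _ ≤ spacingProb ε P (k + (m + 1)) := h2.trans h1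

lemma pow_le_spacingProb (hκ0 : 0 ≤ κ) (hκ : ∀ x, P.real {z | ‖x - z.1‖ ≤ ε} ≤ κ)
    {N : ℕ} (hN : N * κ ≤ 1) : (1 - N * κ) ^ N ≤ spacingProb ε P N := by
  have := pow_mul_spacingProb_le hκ0 hκ hN 0 N (by omega)
  rwa [spacingProb_zero, mul_one, zero_add] at this

lemma inv_mul_compatProb_le (hκ0 : 0 ≤ κ) (hκ : ∀ x, P.real {z | ‖x - z.1‖ ≤ ε} ≤ κ)
    {N : ℕ} (hN : N * κ < 1) {s : ℕ} (hs : s ≤ N) (Z : Config d s) :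
    (spacingProb ε P N)⁻¹ * compatProb ε P Z (N - s) ≤ ((1 - N * κ) ^ s)⁻¹ := by
  have hq : 0 < 1 - N * κ := by linarith
  have hpos : 0 < spacingProb ε P N := (pow_pos hq N).trans_le (pow_le_spacingProb hκ0 hκ hN.le)
  have h := pow_mul_spacingProb_le hκ0 hκ hN.le (N - s) s (by omega)
  rw [Nat.sub_add_cancel hs] at h
  have h2 := compatProb_le_spacingProb (ε := ε) (P := P) Z (N - s)
  rw [inv_mul_le_iff₀ hpos, ← div_eq_mul_inv, le_div_iff₀ (pow_pos hq s)]
  nlinarith [pow_pos hq s]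

lemma le_inv_mul_compatProb (hκ0 : 0 ≤ κ) (hκ : ∀ x, P.real {z | ‖x - z.1‖ ≤ ε} ≤ κ)
    {N : ℕ} (hN : N * κ < 1) {s : ℕ} (hs : s < N) (Z : Config d s) :
    1 - s * (N * κ) * ((1 - N * κ) ^ (s + 1))⁻¹ ≤
      (spacingProb ε P N)⁻¹ * compatProb ε P Z (N - s) := by
  have hq : 0 < 1 - N * κ := by linarith
  have hpos : 0 < spacingProb ε P N := (pow_pos hq N).trans_le (pow_le_spacingProb hκ0 hκ hN.le)
  -- The overlap estimate removes one particle beyond the s fixed ones, which explains s < N and the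
  -- exponent s + 1.
  obtain ⟨k, rfl⟩ : ∃ k, N = k + (s + 1) := ⟨N - (s + 1), by omega⟩
  rw [show k + (s + 1) - s = k + 1 by omega]
  have h1 := spacingProb_sub_compatProb_le hκ0 hκ Z k
  have h2 := pow_mul_spacingProb_le hκ0 hκ hN.le k (s + 1) le_rfl
  have h3 : spacingProb ε P (k + (s + 1)) ≤ spacingProb ε P (k + 1) :=
    spacingProb_antitone (by omega)
  set n : ℝ := ((k + (s + 1) : ℕ) : ℝ) with hn
  set q := (1 - n * κ) ^ (s + 1)
  have hq' : 0 < q := pow_pos hq _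
  have h4 : spacingProb ε P k ≤ q⁻¹ * spacingProb ε P (k + (s + 1)) := by
    rw [le_inv_mul_iff₀ hq']
    exact h2
  have h5 : (k : ℝ) + 1 ≤ n := by rw [hn]; push_cast; linarith [Nat.cast_nonneg (α := ℝ) s]
  have h6 : s * ((k : ℝ) + 1) * κ * spacingProb ε P k ≤
      s * (n * κ) * (q⁻¹ * spacingProb ε P (k + (s + 1))) := by
    refine mul_le_mul ?_ h4 (spacingProb_nonneg _) (by positivity)
    rw [mul_assoc]
    gcongr
  rw [le_inv_mul_iff₀ hpos]
  nlinarith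

end Probability

end

noncomputable section

/-! ### Hard-sphere data built from a random density -/

instance instSigmaFinitePhase {d : ℕ} : SigmaFinite (volume : Measure (Phase d)) := inferInstance

instance instSigmaFiniteConfig {d k : ℕ} : SigmaFinite (volume : Measure (Config d k)) :=
  inferInstance

/-- The law with a given density. -/
def densityLaw {d : ℕ} (g : Phase d → ℝ) : Measure (Phase d) :=
  volume.withDensity fun z => ENNReal.ofReal (g z)

lemma pi_densityLaw {d : ℕ} {g : Phase d → ℝ} (h0 : ∀ z, 0 ≤ g z) (hint : Integrable g) (k : ℕ) :
    Measure.pi (fun _ : Fin k => densityLaw g) =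
      volume.withDensity fun W : Config d k => ENNReal.ofReal (∏ i, g (W i)) := by
  have : IsFiniteMeasure (densityLaw g) := isFiniteMeasure_withDensity_ofReal hint.2
  refine Measure.pi_eq fun B hB => ?_
  rw [withDensity_apply _ (MeasurableSet.univ_pi hB), volume_pi, Measure.restrict_pi_pi,
    ← ofReal_integral_eq_lintegral_ofReal, integral_fintype_prod_eq_prod,
    ENNReal.ofReal_prod_of_nonneg fun i _ => integral_nonneg h0]
  · refine Finset.prod_congr rfl fun i _ => ?_
    rw [densityLaw, withDensity_apply _ (hB i),
      ofReal_integral_eq_lintegral_ofReal hint.integrableOn (Eventually.of_forall h0)]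
  · exact Integrable.fintype_prod fun i => hint.integrableOn
  · exact Eventually.of_forall fun W => Finset.prod_nonneg fun i _ => h0 _

namespace IsRandomDensity

variable {d : ℕ} {Θ : Type*} [MeasurableSpace Θ] {π : Measure Θ} [IsProbabilityMeasure π]
  {M : Phase d → ℝ} {g : Θ → Phase d → ℝ} (hg : IsRandomDensity π M g)

include hg

omit [IsProbabilityMeasure π] in
lemma isProbabilityMeasure_densityLaw (θ : Θ) : IsProbabilityMeasure (densityLaw (g θ)) := by
  refine ⟨?_⟩
  rw [densityLaw, withDensity_apply _ MeasurableSet.univ, Measure.restrict_univ,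
    ← ofReal_integral_eq_lintegral_ofReal (hg.integrable θ) (Eventually.of_forall (hg.nonneg θ)),
    hg.normalized, ENNReal.ofReal_one]

omit [IsProbabilityMeasure π] in
lemma measurable_prod_apply (k : ℕ) :
    Measurable fun p : Θ × Config d k => ∏ i, g p.1 (p.2 i) :=
  Finset.measurable_prod _ fun i _ => hg.measurable.comp
    (measurable_fst.prodMk ((measurable_pi_apply i).comp measurable_snd))

omit [IsProbabilityMeasure π] in
lemma prod_nonneg {k : ℕ} (θ : Θ) (W : Config d k) : 0 ≤ ∏ i, g θ (W i) :=
  Finset.prod_nonneg fun _ _ => hg.nonneg θ _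

omit [IsProbabilityMeasure π] in
lemma prod_le {k : ℕ} (θ : Θ) (W : Config d k) : ∏ i, g θ (W i) ≤ ∏ i, M (W i) :=
  Finset.prod_le_prod (fun _ _ => hg.nonneg θ _) fun _ _ => hg.le θ _

omit [IsProbabilityMeasure π] in
lemma pi_densityLaw_real (θ : Θ) {k : ℕ} {B : Set (Config d k)} (hB : MeasurableSet B) :
    (Measure.pi fun _ : Fin k => densityLaw (g θ)).real B = ∫ W in B, ∏ i, g θ (W i) := by
  rw [measureReal_def, pi_densityLaw (hg.nonneg θ) (hg.integrable θ), withDensity_apply _ hB,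
    integral_eq_lintegral_of_nonneg_ae (Eventually.of_forall fun W => hg.prod_nonneg θ W)
      ((hg.measurable_prod_apply k).comp measurable_prodMk_left).aestronglyMeasurable]

omit [IsProbabilityMeasure π] in
lemma measurable_pi_densityLaw_real {k : ℕ} {B : Set (Config d k)} (hB : MeasurableSet B) :
    Measurable fun θ => (Measure.pi fun _ : Fin k => densityLaw (g θ)).real B := by
  simp_rw [hg.pi_densityLaw_real _ hB]
  exact ((hg.measurable_prod_apply k).stronglyMeasurable.integral_prod_right'
    (ν := volume.restrict B)).measurable

lemma integrable_mul_prod (k : ℕ) {φ : Θ → ℝ} {K : ℝ} (hφ : Measurable φ) (hK : ∀ θ, |φ θ| ≤ K) :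
    Integrable (fun p : Θ × Config d k => φ p.1 * ∏ i, g p.1 (p.2 i)) (π.prod volume) := by
  have h1 : Integrable (fun p : Θ × Config d k => ∏ i, g p.1 (p.2 i)) (π.prod volume) := by
    rw [integrable_prod_iff (hg.measurable_prod_apply k).aestronglyMeasurable]
    refine ⟨Eventually.of_forall fun θ => Integrable.fintype_prod fun _ => hg.integrable θ, ?_⟩
    refine (integrable_const (1 : ℝ)).congr (Eventually.of_forall fun θ => ?_)
    simp only
    simp_rw [Real.norm_eq_abs, abs_of_nonneg (hg.prod_nonneg θ _)]
    rw [integral_fintype_prod_volume_eq_pow (g θ), hg.normalized, one_pow]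
  exact h1.bdd_mul (c := K) (hφ.comp measurable_fst).aestronglyMeasurable
    (Eventually.of_forall fun p => hK p.1)

lemma integrable_mixture (k : ℕ) {φ : Θ → ℝ} {K : ℝ} (hφ : Measurable φ)
    (hK : ∀ θ, |φ θ| ≤ K) :
    Integrable fun W : Config d k => ∫ θ, φ θ * ∏ i, g θ (W i) ∂π :=
  (hg.integrable_mul_prod k hφ hK).integral_prod_right

lemma setIntegral_mixture {k : ℕ} {φ : Θ → ℝ} {K : ℝ} (hφ : Measurable φ)
    (hK : ∀ θ, |φ θ| ≤ K) {B : Set (Config d k)} (hB : MeasurableSet B) :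
    ∫ W in B, ∫ θ, φ θ * ∏ i, g θ (W i) ∂π =
      ∫ θ, φ θ * (Measure.pi fun _ : Fin k => densityLaw (g θ)).real B ∂π := by
  rw [← integral_integral_swap]
  · refine integral_congr_ae (Eventually.of_forall fun θ => ?_)
    simp only
    rw [integral_const_mul, hg.pi_densityLaw_real θ hB]
  · exact (hg.integrable_mul_prod k hφ hK).mono_measure
      (Measure.prod_mono le_rfl Measure.restrict_le_self)

end IsRandomDensity

/-- The mixture of the laws of `N` independent particles conditioned not to overlap. -/
def hardSphereMixture {d : ℕ} {Θ : Type*} [MeasurableSpace Θ] (ε : ℝ) (π : Measure Θ)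
    (g : Θ → Phase d → ℝ) (N : ℕ) (Z : Config d N) : ℝ :=
  ∫ θ, (spacingProb ε (densityLaw (g θ)) N)⁻¹ * ∏ i, g θ (Z i) ∂π

lemma cutoff_glue_hardSphereMixture {d : ℕ} {Θ : Type*} [MeasurableSpace Θ] (π : Measure Θ)
    (g : Θ → Phase d → ℝ) {ε : ℝ} {s N : ℕ} (hs : s ≤ N) {Z : Config d s}
    (hZ : Z ∈ hardSphere d ε s) (W : Config d (N - s)) :
    cutoff ε (hardSphereMixture ε π g N) (glue Z W) =
      (compatible ε Z (N - s)).indicator (fun W => ∫ θ,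
        ((spacingProb ε (densityLaw (g θ)) N)⁻¹ * ∏ i, g θ (Z i)) * ∏ i, g θ (W i) ∂π) W := by
  have hmem := glue_mem_hardSphere (d := d) (ε := ε) hs (Z := Z) (W := W)
  by_cases hW : W ∈ compatible ε Z (N - s)
  · rw [cutoff, Set.indicator_of_mem (hmem.2 ⟨hZ, hW⟩), Set.indicator_of_mem hW, hardSphereMixture]
    refine integral_congr_ae (Eventually.of_forall fun θ => ?_)
    simp only
    rw [prod_glue hs, mul_assoc]
  · rw [cutoff, Set.indicator_of_notMem (fun h => hW (hmem.1 h).2), Set.indicator_of_notMem hW]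

/-! ### Continuity of compatibility probabilities in the fixed particles -/

section Compatible

variable {d : ℕ} {ε : ℝ}

/-- Spheres are null sets, so almost no W is exactly in contact with Z. Off contact, compatibility
is locally constant in Z, which makes `compatProb` continuous by dominated convergence. -/
lemma ae_norm_sub_ne (hε : 0 < ε) {s : ℕ} (Z : Config d s) (k : ℕ) :
    ∀ᵐ W : Config d k, ∀ i j, ‖(Z i).1 - (W j).1‖ ≠ ε := by
  refine ae_all_iff.2 fun i => ae_all_iff.2 fun j => ?_
  have h1 : ∀ᵐ y : EuclideanSpace ℝ (Fin d), ‖(Z i).1 - y‖ ≠ ε := by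
    filter_upwards [compl_mem_ae_iff.2 (Measure.addHaar_sphere_of_ne_zero volume (Z i).1 hε.ne')]
      with y hy h
    refine hy ?_
    rwa [mem_sphere_iff_norm, norm_sub_rev]
  have h2 : ∀ᵐ z : Phase d, ‖(Z i).1 - z.1‖ ≠ ε := Measure.quasiMeasurePreserving_fst.ae h1
  exact (Measure.quasiMeasurePreserving_eval (fun _ : Fin k => (volume : Measure (Phase d))) j).ae
    h2

lemma eventually_mem_compatible_iff {s k : ℕ} {Z : Config d s} {W : Config d k}
    (hW : ∀ i j, ‖(Z i).1 - (W j).1‖ ≠ ε) :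
    ∀ᶠ Z' in 𝓝 Z, (W ∈ compatible ε Z' k ↔ W ∈ compatible ε Z k) := by
  have h : ∀ i j, ∀ᶠ Z' : Config d s in 𝓝 Z,
      (ε < ‖(Z' i).1 - (W j).1‖ ↔ ε < ‖(Z i).1 - (W j).1‖) := by
    intro i j
    have hc : Continuous fun Z' : Config d s => ‖(Z' i).1 - (W j).1‖ := by fun_prop
    rcases (hW i j).lt_or_gt with h | h
    · filter_upwards [hc.continuousAt.tendsto.eventually_lt_const h] with Z' hZ'
      exact ⟨fun h' => absurd h' hZ'.not_gt, fun h' => absurd h' h.not_gt⟩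
    · filter_upwards [hc.continuousAt.tendsto.eventually_const_lt h] with Z' hZ'
      exact ⟨fun _ => h, fun _ => hZ'⟩
  filter_upwards [eventually_all.2 fun i => eventually_all.2 fun j => h i j] with Z' hZ'
  exact and_congr Iff.rfl (forall_congr' fun i => forall_congr' fun j => hZ' i j)

lemma compatProb_continuous (hε : 0 < ε) {g : Phase d → ℝ} (h0 : ∀ z, 0 ≤ g z)
    (hint : Integrable g) {s : ℕ} (k : ℕ) :
    Continuous fun Z : Config d s => compatProb ε (densityLaw g) Z k := by
  have : IsFiniteMeasure (densityLaw g) := isFiniteMeasure_withDensity_ofReal hint.2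
  refine continuous_iff_continuousAt.2 fun Z => ?_
  have heq : ∀ Z' : Config d s, compatProb ε (densityLaw g) Z' k =
      ∫ W, (compatible ε Z' k).indicator (fun _ => (1 : ℝ)) W
        ∂(Measure.pi fun _ : Fin k => densityLaw g) := by
    intro Z'
    rw [integral_indicator (measurableSet_compatible Z' k)]
    simp [compatProb]
  simp_rw [ContinuousAt, heq]
  refine tendsto_integral_filter_of_dominated_convergence (fun _ => 1) ?_ ?_
    (integrable_const _) ?_
  · exact Eventually.of_forall fun Z' =>
      (measurable_const.indicator (measurableSet_compatible Z' k)).aestronglyMeasurable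
  · refine Eventually.of_forall fun Z' => Eventually.of_forall fun W => ?_
    rw [Real.norm_eq_abs, abs_of_nonneg (Set.indicator_nonneg (fun _ _ => zero_le_one) _)]
    exact Set.indicator_le_self' (fun _ _ => zero_le_one) _
  · rw [pi_densityLaw h0 hint]
    filter_upwards [(withDensity_absolutelyContinuous _ _).ae_le (ae_norm_sub_ne hε Z k)] with W hW
    refine tendsto_const_nhds.congr' ?_
    filter_upwards [eventually_mem_compatible_iff hW] with Z' hZ'
    by_cases h : W ∈ compatible ε Z k
    · rw [Set.indicator_of_mem h, Set.indicator_of_mem (hZ'.2 h)]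
    · rw [Set.indicator_of_notMem h, Set.indicator_of_notMem (fun h' => h (hZ'.1 h'))]

end Compatible

/-! ### Marginals of the conditioned mixture -/

namespace IsRandomDensity

variable {d : ℕ} {Θ : Type*} [MeasurableSpace Θ] {π : Measure Θ} [IsProbabilityMeasure π]
  {M : Phase d → ℝ} {g : Θ → Phase d → ℝ} (hg : IsRandomDensity π M g)
  {A ε c : ℝ} {N : ℕ}

section

include hg

omit [IsProbabilityMeasure π] in
lemma measurable_inv_spacingProb :
    Measurable fun θ => (spacingProb ε (densityLaw (g θ)) N)⁻¹ :=
  (hg.measurable_pi_densityLaw_real (isOpen_hardSphere N).measurableSet).inv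

omit [IsProbabilityMeasure π] in
lemma measurable_compatProb {s : ℕ} (Z : Config d s) (k : ℕ) :
    Measurable fun θ => compatProb ε (densityLaw (g θ)) Z k :=
  hg.measurable_pi_densityLaw_real (measurableSet_compatible Z k)

end

omit [MeasurableSpace Θ] in
lemma abs_inv_spacingProb_le (hc : 0 < c)
    (hcN : ∀ θ, c ≤ spacingProb ε (densityLaw (g θ)) N) (θ : Θ) :
    |(spacingProb ε (densityLaw (g θ)) N)⁻¹| ≤ c⁻¹ := by
  rw [abs_of_nonneg (inv_nonneg.2 (hc.le.trans (hcN θ)))]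
  exact inv_anti₀ hc (hcN θ)

include hg

omit [IsProbabilityMeasure π] in
lemma measurable_weight {s : ℕ} (Z : Config d s) :
    Measurable fun θ => (spacingProb ε (densityLaw (g θ)) N)⁻¹ * ∏ i, g θ (Z i) :=
  hg.measurable_inv_spacingProb.mul ((hg.measurable_prod_apply s).comp measurable_prodMk_right)

omit [IsProbabilityMeasure π] in
lemma abs_weight_le (hc : 0 < c) (hcN : ∀ θ, c ≤ spacingProb ε (densityLaw (g θ)) N) {s : ℕ}
    (Z : Config d s) (θ : Θ) :
    |(spacingProb ε (densityLaw (g θ)) N)⁻¹ * ∏ i, g θ (Z i)| ≤ c⁻¹ * ∏ i, M (Z i) := by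
  rw [abs_mul, abs_of_nonneg (hg.prod_nonneg θ Z)]
  exact mul_le_mul (abs_inv_spacingProb_le hc hcN θ) (hg.prod_le θ Z) (hg.prod_nonneg θ Z)
    (inv_nonneg.2 hc.le)

lemma marginal_hardSphereMixture (hc : 0 < c)
    (hcN : ∀ θ, c ≤ spacingProb ε (densityLaw (g θ)) N) {s : ℕ} (hs : s ≤ N) {Z : Config d s}
    (hZ : Z ∈ hardSphere d ε s) :
    marginal ε (hardSphereMixture ε π g N) s Z =
      ∫ θ, (spacingProb ε (densityLaw (g θ)) N)⁻¹ * compatProb ε (densityLaw (g θ)) Z (N - s) *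
        ∏ i, g θ (Z i) ∂π := by
  rw [marginal, if_pos hs]
  simp_rw [cutoff_glue_hardSphereMixture π g hs hZ]
  rw [integral_indicator (measurableSet_compatible Z _),
    hg.setIntegral_mixture (hg.measurable_weight Z) (hg.abs_weight_le hc hcN Z)
      (measurableSet_compatible Z _)]
  refine integral_congr_ae (Eventually.of_forall fun θ => ?_)
  simp only [compatProb]
  ring

lemma slice_integrable (hc : 0 < c)
    (hcN : ∀ θ, c ≤ spacingProb ε (densityLaw (g θ)) N) {s : ℕ} (hs : s ≤ N) {Z : Config d s}
    (hZ : Z ∈ hardSphere d ε s) :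
    Integrable fun W : Config d (N - s) =>
      cutoff ε (hardSphereMixture ε π g N) (glue Z W) := by
  simp_rw [cutoff_glue_hardSphereMixture π g hs hZ]
  exact (hg.integrable_mixture _ (hg.measurable_weight Z)
    (hg.abs_weight_le hc hcN Z)).indicator (measurableSet_compatible Z _)

/-- The individual densities need not be continuous, so the limit cannot be taken under the integral
directly. With the compatibility factor frozen at Z₀, continuity is the mixed-moment property of the
random density; the remaining difference tends to 0 by dominated convergence, as the products are at
most A^s. -/
lemma continuousOn_mixture (hε : 0 < ε) (hMA : ∀ z, M z ≤ A) (hc : 0 < c)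
    (hcN : ∀ θ, c ≤ spacingProb ε (densityLaw (g θ)) N) (s k : ℕ) :
    ContinuousOn (fun Z : Config d s => ∫ θ, (spacingProb ε (densityLaw (g θ)) N)⁻¹ *
      compatProb ε (densityLaw (g θ)) Z k * ∏ i, g θ (Z i) ∂π) (hardSphere d ε s) := by
  intro Z₀ hZ₀
  have hprob := hg.isProbabilityMeasure_densityLaw
  have hwm := hg.measurable_inv_spacingProb (ε := ε) (N := N)
  have hwb := abs_inv_spacingProb_le hc hcN
  have hcb : ∀ θ (Z : Config d s), |compatProb ε (densityLaw (g θ)) Z k| ≤ 1 := fun θ Z => by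
    rw [abs_of_nonneg (compatProb_nonneg Z k)]
    exact compatProb_le_one Z k
  have hint : ∀ Z : Config d s, Integrable (fun θ => (spacingProb ε (densityLaw (g θ)) N)⁻¹ *
      compatProb ε (densityLaw (g θ)) Z k) π := by
    intro Z
    refine Integrable.of_bound (C := c⁻¹) (hwm.mul (hg.measurable_compatProb Z k)).aestronglyMeasurable
      (Eventually.of_forall fun θ => ?_)
    rw [norm_mul]
    exact (mul_le_mul (hwb θ) (hcb θ Z) (abs_nonneg _) (inv_nonneg.2 hc.le)).trans_eq (mul_one _)
  have hprodm : ∀ Z : Config d s, Measurable fun θ => ∏ i, g θ (Z i) := fun Z =>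
    (hg.measurable_prod_apply s).comp measurable_prodMk_right
  have hprodb : ∀ θ (Z : Config d s), |∏ i, g θ (Z i)| ≤ A ^ s := by
    intro θ Z
    rw [abs_of_nonneg (hg.prod_nonneg θ Z)]
    calc ∏ i, g θ (Z i) ≤ ∏ _i : Fin s, A :=
          Finset.prod_le_prod (fun _ _ => hg.nonneg θ _) fun i _ => (hg.le θ _).trans (hMA _)
      _ = A ^ s := by simp
  have hint' : ∀ Z Z' : Config d s, Integrable (fun θ => (spacingProb ε (densityLaw (g θ)) N)⁻¹ *
      compatProb ε (densityLaw (g θ)) Z k * ∏ i, g θ (Z' i)) π := fun Z Z' =>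
    (hint Z).mul_bdd (hprodm Z').aestronglyMeasurable
      (Eventually.of_forall fun θ => hprodb θ Z')
  have h2 : Tendsto (fun Z : Config d s => ∫ θ, (spacingProb ε (densityLaw (g θ)) N)⁻¹ *
      compatProb ε (densityLaw (g θ)) Z₀ k * ∏ i, g θ (Z i) ∂π) (𝓝[hardSphere d ε s] Z₀)
      (𝓝 (∫ θ, (spacingProb ε (densityLaw (g θ)) N)⁻¹ *
        compatProb ε (densityLaw (g θ)) Z₀ k * ∏ i, g θ (Z₀ i) ∂π)) :=
    ((hg.continuousOn s _ (hint Z₀)).mono (hardSphere_subset_offDiag hε.le s)) Z₀ hZ₀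
  have h1 : Tendsto (fun Z : Config d s => ∫ θ, ((spacingProb ε (densityLaw (g θ)) N)⁻¹ *
      compatProb ε (densityLaw (g θ)) Z k * ∏ i, g θ (Z i) -
      (spacingProb ε (densityLaw (g θ)) N)⁻¹ *
      compatProb ε (densityLaw (g θ)) Z₀ k * ∏ i, g θ (Z i)) ∂π) (𝓝[hardSphere d ε s] Z₀)
      (𝓝 (∫ _, (0 : ℝ) ∂π)) := by
    refine tendsto_integral_filter_of_dominated_convergence (fun _ => 2 * c⁻¹ * A ^ s) ?_ ?_
      (integrable_const _) ?_
    · exact Eventually.of_forall fun Z => ((hint' Z Z).sub (hint' Z₀ Z)).aestronglyMeasurable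
    · refine Eventually.of_forall fun Z => Eventually.of_forall fun θ => ?_
      rw [← sub_mul, ← mul_sub, norm_mul, norm_mul]
      have h3 : ‖compatProb ε (densityLaw (g θ)) Z k - compatProb ε (densityLaw (g θ)) Z₀ k‖ ≤ 2 :=
        (norm_sub_le _ _).trans (by
          have := hcb θ Z
          have := hcb θ Z₀
          simp only [Real.norm_eq_abs]
          linarith)
      have h4 := hwb θ
      have h5 := hprodb θ Z
      refine mul_le_mul ?_ h5 (norm_nonneg _) (by positivity)
      rw [mul_comm 2]
      exact mul_le_mul h4 h3 (norm_nonneg _) (inv_nonneg.2 hc.le)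
    · refine Eventually.of_forall fun θ => ?_
      have hcont := ((compatProb_continuous hε (hg.nonneg θ) (hg.integrable θ) k).tendsto Z₀).mono_left
        (inf_le_left : 𝓝[hardSphere d ε s] Z₀ ≤ 𝓝 Z₀)
      rw [tendsto_iff_norm_sub_tendsto_zero] at hcont
      have hlim := (hcont.const_mul c⁻¹).mul_const (A ^ s)
      simp only [mul_zero, zero_mul] at hlim
      refine squeeze_zero_norm (fun Z => ?_) hlim
      rw [← sub_mul, ← mul_sub, norm_mul, norm_mul]
      refine mul_le_mul ?_ (hprodb θ Z) (norm_nonneg _) (by positivity)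
      exact mul_le_mul_of_nonneg_right (hwb θ) (norm_nonneg _)
  have h3 := h1.add h2
  rw [integral_zero, zero_add] at h3
  refine h3.congr fun Z => ?_
  rw [integral_sub (hint' Z Z) (hint' Z₀ Z), sub_add_cancel]

theorem isBBGKYDatum (hε : 0 < ε) (hMA : ∀ z, M z ≤ A) (hc : 0 < c)
    (hcN : ∀ θ, c ≤ spacingProb ε (densityLaw (g θ)) N) :
    IsBBGKYDatum ε (hardSphereMixture ε π g N) where
  nonneg Z _ := integral_nonneg fun θ =>
    mul_nonneg (inv_nonneg.2 (spacingProb_nonneg N)) (hg.prod_nonneg θ Z)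
  symm σ Z _ := by
    refine integral_congr_ae (Eventually.of_forall fun θ => ?_)
    simp only [Function.comp_apply]
    rw [Equiv.prod_comp σ fun i => g θ (Z i)]
  integrable := (hg.integrable_mixture N hg.measurable_inv_spacingProb
    (abs_inv_spacingProb_le hc hcN)).integrableOn
  normalized := by
    refine (hg.setIntegral_mixture hg.measurable_inv_spacingProb
      (abs_inv_spacingProb_le hc hcN) (isOpen_hardSphere N).measurableSet).trans ?_
    rw [integral_congr_ae (g := fun _ => (1 : ℝ))]
    · simp
    · exact Eventually.of_forall fun θ => inv_mul_cancel₀ (hc.trans_le (hcN θ)).ne'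
  slice_integrable s _ hs Z hZ := hg.slice_integrable hc hcN hs hZ
  continuous s _ hs := (hg.continuousOn_mixture hε hMA hc hcN s (N - s)).congr
    fun Z hZ => hg.marginal_hardSphereMixture hc hcN hs hZ

lemma abs_marginal_le (hc : 0 < c) (hcN : ∀ θ, c ≤ spacingProb ε (densityLaw (g θ)) N) {s : ℕ}
    (hs : s ≤ N) {Z : Config d s} (hZ : Z ∈ hardSphere d ε s) {b : ℝ}
    (hb : ∀ θ, (spacingProb ε (densityLaw (g θ)) N)⁻¹ *
      compatProb ε (densityLaw (g θ)) Z (N - s) ≤ b) :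
    |marginal ε (hardSphereMixture ε π g N) s Z| ≤ b * ∏ i, M (Z i) := by
  rw [hg.marginal_hardSphereMixture hc hcN hs hZ]
  have : b * ∏ i, M (Z i) = b * (∏ i, M (Z i)) * π.real Set.univ := by simp
  rw [this]
  rw [← Real.norm_eq_abs]
  refine norm_integral_le_of_norm_le_const (μ := π) (Eventually.of_forall fun θ => ?_)
  have h0 : 0 ≤ (spacingProb ε (densityLaw (g θ)) N)⁻¹ *
      compatProb ε (densityLaw (g θ)) Z (N - s) :=
    mul_nonneg (inv_nonneg.2 (spacingProb_nonneg N)) (compatProb_nonneg Z _)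
  rw [Real.norm_eq_abs, abs_of_nonneg (mul_nonneg h0 (hg.prod_nonneg θ Z))]
  exact mul_le_mul (hb θ) (hg.prod_le θ Z) (hg.prod_nonneg θ Z) (h0.trans (hb θ))

lemma abs_marginal_sub_le (hMA : ∀ z, M z ≤ A) (hc : 0 < c)
    (hcN : ∀ θ, c ≤ spacingProb ε (densityLaw (g θ)) N) {s : ℕ}
    (hs : s ≤ N) {Z : Config d s} (hZ : Z ∈ hardSphere d ε s) {η : ℝ}
    (hη : ∀ θ, |(spacingProb ε (densityLaw (g θ)) N)⁻¹ *
      compatProb ε (densityLaw (g θ)) Z (N - s) - 1| ≤ η) :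
    |marginal ε (hardSphereMixture ε π g N) s Z - ∫ θ, ∏ i, g θ (Z i) ∂π| ≤ η * A ^ s := by
  have hprodm : Measurable fun θ => ∏ i, g θ (Z i) :=
    (hg.measurable_prod_apply s).comp measurable_prodMk_right
  have hA : ∀ θ, ∏ i, g θ (Z i) ≤ A ^ s := fun θ => by
    calc ∏ i, g θ (Z i) ≤ ∏ _i : Fin s, A :=
          Finset.prod_le_prod (fun _ _ => hg.nonneg θ _) fun i _ => (hg.le θ _).trans (hMA _)
      _ = A ^ s := by simp
  have hi2 := hg.integrable_prod Z
  have hi1 : Integrable (fun θ => (spacingProb ε (densityLaw (g θ)) N)⁻¹ *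
      compatProb ε (densityLaw (g θ)) Z (N - s) * ∏ i, g θ (Z i)) π := by
    refine hi2.bdd_mul (c := η + 1)
      (hg.measurable_inv_spacingProb.mul (hg.measurable_compatProb Z _)).aestronglyMeasurable
      (Eventually.of_forall fun θ => ?_)
    rw [Real.norm_eq_abs]
    have := abs_le.1 (hη θ)
    rw [abs_le]
    constructor <;> linarith
  rw [hg.marginal_hardSphereMixture hc hcN hs hZ, ← integral_sub hi1 hi2]
  have : η * A ^ s = η * A ^ s * π.real Set.univ := by simp
  rw [this]
  rw [← Real.norm_eq_abs]
  refine norm_integral_le_of_norm_le_const (μ := π) (Eventually.of_forall fun θ => ?_)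
  rw [← sub_one_mul, Real.norm_eq_abs, abs_mul, abs_of_nonneg (hg.prod_nonneg θ Z)]
  exact mul_le_mul (hη θ) (hA θ) (hg.prod_nonneg θ Z) ((abs_nonneg _).trans (hη θ))

end IsRandomDensity

end

noncomputable section

/-! ### The Boltzmann–Grad scaling -/

section Scaling

variable {d : ℕ}

lemma bgDiameter_pos {N : ℕ} (hN : 1 ≤ N) : 0 < bgDiameter d N :=
  Real.rpow_pos_of_pos (by exact_mod_cast hN) _

/-- In the Boltzmann–Grad scaling N ε^{d-1} = 1, the excluded volume N ε^d equals ε and so tends to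
0. -/
lemma natCast_mul_bgDiameter_pow (hd : 2 ≤ d) {N : ℕ} (hN : 1 ≤ N) :
    N * bgDiameter d N ^ d = bgDiameter d N := by
  have hN' : (0 : ℝ) < N := by exact_mod_cast hN
  have hd' : (0 : ℝ) < d - 1 := by
    have : (2 : ℝ) ≤ d := by exact_mod_cast hd
    linarith
  rw [bgDiameter, ← Real.rpow_natCast, ← Real.rpow_mul hN'.le]
  nth_rewrite 1 [← Real.rpow_one (N : ℝ)]
  rw [← Real.rpow_add hN']
  congr 1
  field_simp
  ring

lemma tendsto_bgDiameter (hd : 2 ≤ d) : Tendsto (bgDiameter d) atTop (𝓝 0) := by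
  have hd' : (0 : ℝ) < d - 1 := by
    have : (2 : ℝ) ≤ d := by exact_mod_cast hd
    linarith
  exact (tendsto_rpow_neg_atTop (one_div_pos.2 hd')).comp tendsto_natCast_atTop_atTop

lemma hardSphere_anti {ε ε' : ℝ} (h : ε ≤ ε') (s : ℕ) : hardSphere d ε' s ⊆ hardSphere d ε s :=
  fun _ hZ i j hij => h.trans_lt (hZ i j hij)

lemma exists_mem_hardSphere {s : ℕ} {Z : Config d s} (hZ : Z ∈ offDiag d s) :
    ∃ r, 0 < r ∧ Z ∈ hardSphere d r s := by
  have h : ∀ᶠ r : ℝ in 𝓝[>] 0, ∀ i j, i ≠ j → r < ‖(Z i).1 - (Z j).1‖ := by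
    refine eventually_all.2 fun i => eventually_all.2 fun j => ?_
    by_cases hij : i = j
    · exact Eventually.of_forall fun _ h => absurd hij h
    · filter_upwards [mem_nhdsWithin_of_mem_nhds
        (Iio_mem_nhds (norm_pos_iff.2 (sub_ne_zero.2 (hZ i j hij))))] with r hr _ using hr
  obtain ⟨r, hr, hr0⟩ := (h.and self_mem_nhdsWithin).exists
  exact ⟨r, hr0, hr⟩

lemma nonempty_hardSphere [Nonempty (Fin d)] {ε : ℝ} (hε : 0 ≤ ε) (s : ℕ) :
    (hardSphere d ε s).Nonempty := by
  obtain ⟨j⟩ := ‹Nonempty (Fin d)›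
  -- Particles at rest on a coordinate axis, with spacing ε + 1.
  refine ⟨fun i => ((i * (ε + 1) : ℝ) • EuclideanSpace.single j (1 : ℝ), 0), fun a b hab => ?_⟩
  simp only
  rw [← sub_smul, norm_smul, PiLp.norm_single, norm_one, mul_one, ← sub_mul, norm_mul,
    Real.norm_of_nonneg (by linarith : 0 ≤ ε + 1)]
  have h1 : (1 : ℝ) ≤ ‖((a : ℕ) : ℝ) - ((b : ℕ) : ℝ)‖ := by
    have h2 : (1 : ℤ) ≤ |((a : ℕ) : ℤ) - ((b : ℕ) : ℤ)| :=
      Int.one_le_abs (sub_ne_zero.2 (by exact_mod_cast Fin.val_ne_of_ne hab))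
    rw [Real.norm_eq_abs]
    exact_mod_cast h2
  nlinarith

end Scaling

/-! ### Maxwellian bounds -/

section Maxwellian

variable {d : ℕ} {β : ℝ}

lemma integrable_gaussian (hβ : 0 < β) :
    Integrable fun v : EuclideanSpace ℝ (Fin d) => Real.exp (-(β * (‖v‖ ^ 2 / 2))) := by
  have h := (GaussianFourier.integrable_cexp_neg_mul_sq_norm_add
    (V := EuclideanSpace ℝ (Fin d)) (b := ((β / 2 : ℝ) : ℂ)) (by simpa using hβ) 0 0).norm
  refine h.congr (Eventually.of_forall fun v => ?_)
  simp only [Complex.norm_exp]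
  congr 1
  simp [← Complex.ofReal_pow]
  ring

/-- Laws dominated by a Maxwellian give small probability to small balls of positions. -/
lemma exists_densityLaw_real_le (d : ℕ) (hβ : 0 < β) (μ : ℝ) :
    ∃ K, 0 ≤ K ∧ ∀ g : Phase d → ℝ, (∀ z, g z ≤ maxwellWeight β μ z) → ∀ ε, 0 ≤ ε → ∀ x,
      (densityLaw g).real {z | ‖x - z.1‖ ≤ ε} ≤ K * ε ^ d := by
  set G : EuclideanSpace ℝ (Fin d) → ℝ := fun v => Real.exp (-(β * (‖v‖ ^ 2 / 2))) with hG
  have hGfin : ∫⁻ v, ENNReal.ofReal (G v) ≠ ⊤ := (integrable_gaussian hβ).lintegral_lt_top.ne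
  set b := volume (Metric.ball (0 : EuclideanSpace ℝ (Fin d)) 1)
  have hb : b ≠ ⊤ := measure_ball_lt_top.ne
  refine ⟨Real.exp (-μ) * b.toReal * (∫⁻ v, ENNReal.ofReal (G v)).toReal, by positivity,
    fun g hg ε hε x => ?_⟩
  have hset : {z : Phase d | ‖x - z.1‖ ≤ ε} = Metric.closedBall x ε ×ˢ Set.univ := by
    ext z
    simp [Metric.mem_closedBall, dist_eq_norm, norm_sub_rev]
  have hmeas : Measurable G := by rw [hG]; fun_prop
  refine ENNReal.toReal_le_of_le_ofReal (by positivity) ?_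
  rw [hset, densityLaw, withDensity_apply _ (measurableSet_closedBall.prod MeasurableSet.univ)]
  calc ∫⁻ z in Metric.closedBall x ε ×ˢ Set.univ, ENNReal.ofReal (g z)
      ≤ ∫⁻ z in Metric.closedBall x ε ×ˢ Set.univ,
          ENNReal.ofReal (Real.exp (-μ)) * ENNReal.ofReal (G z.2) := by
        refine lintegral_mono fun z => ?_
        rw [← ENNReal.ofReal_mul (Real.exp_pos _).le]
        exact ENNReal.ofReal_le_ofReal (hg z)
    _ = ENNReal.ofReal (Real.exp (-μ)) * (ENNReal.ofReal (ε ^ d) * b) *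
          ∫⁻ v, ENNReal.ofReal (G v) := by
        rw [Measure.volume_eq_prod, ← Measure.prod_restrict, Measure.restrict_univ,
          lintegral_prod_mul (f := fun _ => ENNReal.ofReal (Real.exp (-μ)))
            (g := fun v => ENNReal.ofReal (G v)) aemeasurable_const
            hmeas.ennreal_ofReal.aemeasurable,
          setLIntegral_const, Measure.addHaar_closedBall _ _ hε, finrank_euclideanSpace_fin]
    _ = ENNReal.ofReal (Real.exp (-μ) * b.toReal * (∫⁻ v, ENNReal.ofReal (G v)).toReal *
          ε ^ d) := by
        rw [ENNReal.ofReal_mul (by positivity), ENNReal.ofReal_mul (by positivity),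
          ENNReal.ofReal_mul (by positivity), ENNReal.ofReal_toReal hb,
          ENNReal.ofReal_toReal hGfin]
        ring

lemma maxwellWeight_sub_log_two (μ : ℝ) (z : Phase d) :
    maxwellWeight β (μ - Real.log 2) z = 2 * maxwellWeight β μ z := by
  rw [maxwellWeight, maxwellWeight, neg_sub, sub_eq_add_neg, Real.exp_add,
    Real.exp_log two_pos, mul_assoc]

lemma familyNorm_mono {D : ∀ s, Set (Config d s)} {G : ∀ s, Config d s → ℝ} {μ μ' : ℝ}
    (h : μ ≤ μ') : familyNorm D β μ G ≤ familyNorm D β μ' G := by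
  refine iSup₂_mono fun s _ => ?_
  gcongr

/-- A continuous positive probability density dominated by a Maxwellian. -/
lemma exists_density_le_maxwellWeight (d : ℕ) (hβ : 0 < β) :
    ∃ (h : Phase d → ℝ) (μ : ℝ), Continuous h ∧ (∀ z, 0 < h z) ∧ ∫ z, h z = 1 ∧
      ∀ z, h z ≤ maxwellWeight β μ z := by
  set G : EuclideanSpace ℝ (Fin d) → ℝ := fun v => Real.exp (-(β * (‖v‖ ^ 2 / 2))) with hG
  set I := ∫ v, G v with hI
  have hIpos : 0 < I := integral_exp_pos (integrable_gaussian hβ)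
  -- Gaussian in position and in velocity. The position factor is at most 1 before normalization,
  -- and μ = 2 log I makes e^{-μ} = I⁻².
  refine ⟨fun z => (I⁻¹ * G z.1) * (I⁻¹ * G z.2), 2 * Real.log I, ?_, fun z => by positivity,
    ?_, fun z => ?_⟩
  · simp only [hG]
    fun_prop
  · rw [Measure.volume_eq_prod, integral_prod_mul (fun x => I⁻¹ * G x) fun v => I⁻¹ * G v,
      integral_const_mul, ← hI, inv_mul_cancel₀ hIpos.ne', mul_one]
  · have h1 : Real.exp (-(2 * Real.log I)) = I⁻¹ * I⁻¹ := by
      rw [Real.exp_neg, two_mul, Real.exp_add, Real.exp_log hIpos, mul_inv]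
    have h2 : G z.1 ≤ 1 := Real.exp_le_one_iff.2 (by simp only [neg_nonpos]; positivity)
    have h3 : maxwellWeight β (2 * Real.log I) z = I⁻¹ * I⁻¹ * G z.2 := by
      rw [maxwellWeight, h1]
    rw [h3]
    have h4 : 0 ≤ I⁻¹ * I⁻¹ * G z.2 := by positivity
    calc I⁻¹ * G z.1 * (I⁻¹ * G z.2) = G z.1 * (I⁻¹ * I⁻¹ * G z.2) := by ring
      _ ≤ 1 * (I⁻¹ * I⁻¹ * G z.2) := mul_le_mul_of_nonneg_right h2 h4
      _ = _ := one_mul _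

end Maxwellian

/-! ### Uniform bounds and convergence of the hard-sphere marginals -/

lemma marginal_of_lt {d N s : ℕ} {ε : ℝ} (f : Config d N → ℝ) (h : N < s) (Z : Config d s) :
    marginal ε f s Z = 0 := by
  rw [marginal, if_neg h.not_ge, Pi.zero_apply]

/-- A single density is a random density under a point mass, so the conditioned-mixture results also
serve for independent particles. -/
lemma isRandomDensity_dirac {d : ℕ} {M h : Phase d → ℝ} (hc : Continuous h) (h0 : ∀ z, 0 ≤ h z)
    (h1 : ∫ z, h z = 1) (hM : ∀ z, h z ≤ M z) :
    IsRandomDensity (Measure.dirac ()) M fun _ => h where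
  measurable := hc.measurable.comp measurable_snd
  nonneg _ := h0
  le _ := hM
  integrable _ := integrable_of_integral_eq_one h1
  normalized _ := h1
  continuousOn s ψ _ := by
    simp only [integral_dirac]
    fun_prop

lemma spacingProb_pos {d : ℕ} [Nonempty (Fin d)] {h : Phase d → ℝ} (hc : Continuous h)
    (h0 : ∀ z, 0 < h z) (h1 : ∫ z, h z = 1) {ε : ℝ} (hε : 0 ≤ ε) (N : ℕ) :
    0 < spacingProb ε (densityLaw h) N := by
  have hg := isRandomDensity_dirac hc (fun z => (h0 z).le) h1 fun _ => le_rfl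
  have hpos : ∀ W : Config d N, 0 < ∏ i, h (W i) := fun W => Finset.prod_pos fun i _ => h0 _
  have hint : Integrable fun W : Config d N => ∏ i, h (W i) :=
    Integrable.fintype_prod fun _ => hg.integrable ()
  rw [spacingProb, hg.pi_densityLaw_real () (isOpen_hardSphere N).measurableSet,
    setIntegral_pos_iff_support_of_nonneg_ae (Eventually.of_forall fun W => (hpos W).le)
      hint.integrableOn]
  have : Function.support (fun W : Config d N => ∏ i, h (W i)) = Set.univ :=
    Set.eq_univ_of_forall fun W => (hpos W).ne'
  rw [this, Set.univ_inter]
  exact (isOpen_hardSphere N).measure_pos volume (nonempty_hardSphere hε N)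

/-- Hard-sphere data with Maxwellian bounds exist for every number of particles. -/
lemma exists_isBBGKYDatum (d : ℕ) [Nonempty (Fin d)] {β : ℝ} (hβ : 0 < β) :
    ∃ μ, ∀ (N : ℕ) (ε : ℝ), 0 < ε → ∃ f : Config d N → ℝ, IsBBGKYDatum ε f ∧
      familyNorm (hardSphere d ε) β μ (marginal ε f) < ⊤ := by
  obtain ⟨h, μ, hc, h0, h1, hM⟩ := exists_density_le_maxwellWeight d hβ
  have hg := isRandomDensity_dirac hc (fun z => (h0 z).le) h1 hM
  refine ⟨μ, fun N ε hε => ?_⟩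
  have hpos := spacingProb_pos hc h0 h1 hε.le N
  have hprob := hg.isProbabilityMeasure_densityLaw ()
  refine ⟨_, hg.isBBGKYDatum hε (maxwellWeight_le hβ.le) hpos fun _ => le_rfl,
    (familyNorm_le (K := (spacingProb ε (densityLaw h) N)⁻¹) fun s _ Z hZ => ?_).trans_lt
      ENNReal.ofReal_lt_top⟩
  rcases le_or_gt s N with hs | hs
  · refine hg.abs_marginal_le hpos (fun _ => le_rfl) hs hZ fun _ => ?_
    exact mul_le_of_le_one_right (inv_nonneg.2 hpos.le) (compatProb_le_one Z _)
  · rw [marginal_of_lt _ hs, abs_zero]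
    exact mul_nonneg (inv_nonneg.2 hpos.le)
      (Finset.prod_nonneg fun _ _ => (maxwellWeight_pos _).le)

namespace IsRandomDensity

variable {d : ℕ} {Θ : Type*} [MeasurableSpace Θ] {π : Measure Θ} [IsProbabilityMeasure π]
  {β μ : ℝ} {g : Θ → Phase d → ℝ} (hg : IsRandomDensity π (maxwellWeight β μ) g)
  {ε κ : ℝ} {N : ℕ}

include hg

omit [IsProbabilityMeasure π] in
lemma half_pow_le_spacingProb (hκ0 : 0 ≤ κ)
    (hκ : ∀ θ x, (densityLaw (g θ)).real {z | ‖x - z.1‖ ≤ ε} ≤ κ) (hN : N * κ ≤ 1 / 2) (θ : Θ) :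
    (1 / 2 : ℝ) ^ N ≤ spacingProb ε (densityLaw (g θ)) N := by
  have := hg.isProbabilityMeasure_densityLaw θ
  refine le_trans ?_ (pow_le_spacingProb hκ0 (hκ θ) (by linarith))
  gcongr
  linarith

/-- For Nκ ≤ 1/2 the ratio of compatibility to spacing probability is at most 2^s. A factor 2 per
particle is absorbed by lowering μ by log 2. -/
lemma familyNorm_marginal_le (hκ0 : 0 ≤ κ)
    (hκ : ∀ θ x, (densityLaw (g θ)).real {z | ‖x - z.1‖ ≤ ε} ≤ κ) (hN : N * κ ≤ 1 / 2) :
    familyNorm (hardSphere d ε) β (μ - Real.log 2)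
      (marginal ε (hardSphereMixture ε π g N)) ≤ 1 := by
  rw [← ENNReal.ofReal_one]
  refine familyNorm_le fun s _ Z hZ => ?_
  simp only [maxwellWeight_sub_log_two, Finset.prod_mul_distrib, Finset.prod_const,
    Finset.card_univ, Fintype.card_fin, one_mul]
  rcases le_or_gt s N with hs | hs
  · refine hg.abs_marginal_le (by positivity) (hg.half_pow_le_spacingProb hκ0 hκ hN) hs hZ
      fun θ => ?_
    have := hg.isProbabilityMeasure_densityLaw θ
    refine (inv_mul_compatProb_le hκ0 (hκ θ) (by linarith) hs Z).trans ?_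
    rw [← inv_pow]
    refine pow_le_pow_left₀ (inv_nonneg.2 (by linarith)) ?_ s
    rw [inv_le_comm₀ (by linarith) two_pos]
    linarith
  · rw [marginal_of_lt _ hs, abs_zero]
    exact mul_nonneg (by positivity) (Finset.prod_nonneg fun _ _ => (maxwellWeight_pos _).le)

lemma abs_marginal_sub_integral_le (hβ : 0 ≤ β) (hκ0 : 0 ≤ κ)
    (hκ : ∀ θ x, (densityLaw (g θ)).real {z | ‖x - z.1‖ ≤ ε} ≤ κ) (hN : N * κ ≤ 1 / 2) {s : ℕ}
    (hs : s < N) {Z : Config d s} (hZ : Z ∈ hardSphere d ε s) :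
    |marginal ε (hardSphereMixture ε π g N) s Z - ∫ θ, ∏ i, g θ (Z i) ∂π| ≤
      (((1 - N * κ) ^ s)⁻¹ - 1 + s * (N * κ) * ((1 - N * κ) ^ (s + 1))⁻¹) * Real.exp (-μ) ^ s := by
  refine hg.abs_marginal_sub_le (maxwellWeight_le hβ) (by positivity)
    (hg.half_pow_le_spacingProb hκ0 hκ hN) hs.le hZ fun θ => ?_
  have := hg.isProbabilityMeasure_densityLaw θ
  have h1 := inv_mul_compatProb_le hκ0 (hκ θ) (by linarith) hs.le Z
  have h2 := le_inv_mul_compatProb hκ0 (hκ θ) (by linarith) hs Z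
  have hNκ : 0 ≤ N * κ := by positivity
  have hq : 0 < 1 - N * κ := by linarith
  have h3 : 0 ≤ s * (N * κ) * ((1 - N * κ) ^ (s + 1))⁻¹ := by positivity
  have h4 : 1 ≤ ((1 - N * κ) ^ s)⁻¹ :=
    (one_le_inv₀ (pow_pos hq s)).2 (pow_le_one₀ hq.le (by linarith))
  rw [abs_le]
  constructor <;> linarith

end IsRandomDensity

/-! ### Admissible data -/

section Admissible

variable {d : ℕ} {F : ∀ s, Config d s → ℝ}

/-- A point of Ω_s has positive minimal distance, hence belongs to 𝒟_s once ε_N is smaller. The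
uniform bound there survives the pointwise limit, with the same β and μ. -/
lemma IsAdmissible.exists_familyNorm_lt_top (hd : 2 ≤ d) (h : IsAdmissible F) :
    ∃ β, 0 < β ∧ ∃ μ, familyNorm (offDiag d) β μ F < ⊤ := by
  obtain ⟨-, f, -, ⟨β, hβ, μ, hfin⟩, hlim⟩ := h
  set K := ⨆ (N : ℕ) (_ : 1 ≤ N),
    familyNorm (hardSphere d (bgDiameter d N)) β μ (marginal (bgDiameter d N) (f N)) with hK
  refine ⟨β, hβ, μ, (familyNorm_le (K := K.toReal) fun s hs Z hZ => ?_).trans_lt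
    ENNReal.ofReal_lt_top⟩
  obtain ⟨r, hr0, hr⟩ := exists_mem_hardSphere hZ
  refine le_of_tendsto ((hlim s hs).tendsto_at hZ).abs ?_
  filter_upwards [eventually_ge_atTop 1, (tendsto_bgDiameter hd).eventually_lt_const hr0]
    with N hN hNr
  exact le_of_familyNorm_le hfin.ne (le_iSup₂_of_le N hN le_rfl) hs (hardSphere_anti hNr.le s hr)

lemma isAdmissible_of_familyNorm_lt_top (hd : 2 ≤ d) (hF : IsMarginalFamily F) {β μ : ℝ}
    (hβ : 0 < β) (hnorm : familyNorm (offDiag d) β μ F < ⊤) : IsAdmissible F := by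
  have : Nonempty (Fin d) := ⟨⟨0, by omega⟩⟩
  obtain ⟨Θ, mΘ, π, g, hπ, hg, -, hrep⟩ := exists_isRandomDensity_of_familyNorm_lt_top hF hβ hnorm
  obtain ⟨K, hK0, hK⟩ := exists_densityLaw_real_le d hβ μ
  obtain ⟨μ', hμ'⟩ := exists_isBBGKYDatum d hβ
  choose f₀ hf₀ hf₀' using hμ'
  set ε := bgDiameter d with hε_def
  set κ : ℕ → ℝ := fun N => K * ε N ^ d with hκ_def
  have hε : ∀ N, 1 ≤ N → 0 < ε N := fun N hN => bgDiameter_pos hN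
  have hκ : ∀ N, 1 ≤ N → ∀ θ x, (densityLaw (g θ)).real {z | ‖x - z.1‖ ≤ ε N} ≤ κ N :=
    fun N hN θ x => hK _ (hg.le θ) _ (hε N hN).le x
  have hκ0 : ∀ N, 1 ≤ N → 0 ≤ κ N := fun N hN => mul_nonneg hK0 (pow_nonneg (hε N hN).le d)
  have hNκ : Tendsto (fun N : ℕ => N * κ N) atTop (𝓝 0) := by
    have h := (tendsto_bgDiameter hd).const_mul K
    rw [mul_zero] at h
    refine h.congr' ?_
    filter_upwards [eventually_ge_atTop 1] with N hN
    rw [← natCast_mul_bgDiameter_pow hd hN]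
    simp only [hκ_def, hε_def]
    rw [natCast_mul_bgDiameter_pow hd hN]
    nth_rewrite 1 [← natCast_mul_bgDiameter_pow hd hN]
    ring
  obtain ⟨N₀, hN₀⟩ := eventually_atTop.1 (hNκ.eventually_le_const (by norm_num : (0 : ℝ) < 1 / 2))
  classical
  -- The mixture is used once Nκ ≤ 1/2, and a fixed Gaussian construction before that. N = 0 is put
  -- in the first branch only because positivity of the diameter is available for N ≥ 1.
  set f : ∀ N, Config d N → ℝ := fun N =>
    if hN : N₀ ≤ N ∨ N = 0 then hardSphereMixture (ε N) π g N
    else f₀ N (ε N) (hε N (by omega)) with hf_def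
  have hf_large : ∀ N, N₀ ≤ N → f N = hardSphereMixture (ε N) π g N := fun N hN => by
    simp only [hf_def]
    rw [dif_pos (Or.inl hN)]
  have hf_small : ∀ N (hN : 1 ≤ N), N < N₀ → f N = f₀ N (ε N) (hε N hN) := fun N hN hN' => by
    simp only [hf_def]
    rw [dif_neg (by omega)]
  refine ⟨hF, f, fun N hN => ?_, ⟨β, hβ, min μ' (μ - Real.log 2), ?_⟩, fun s hs => ?_⟩
  · rcases le_or_gt N₀ N with h | h
    · rw [hf_large N h]
      exact hg.isBBGKYDatum (hε N hN) (maxwellWeight_le hβ.le) (by positivity)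
        (hg.half_pow_le_spacingProb (hκ0 N hN) (hκ N hN) (hN₀ N h))
    · rw [hf_small N hN h]
      exact hf₀ N _ _
  · set b : ℕ → ℝ≥0∞ := fun N => if hN : 1 ≤ N then
      familyNorm (hardSphere d (ε N)) β μ' (marginal (ε N) (f₀ N (ε N) (hε N hN))) else 0
      with hb_def
    have hb : ∀ N, b N < ⊤ := fun N => by
      simp only [hb_def]
      split_ifs with hN
      · exact hf₀' N _ _
      · exact ENNReal.zero_lt_top
    -- The bound 1 serves all N ≥ N₀; the sum covers the finitely many smaller N, each of finite
    -- norm. The minimum of the two values of μ suits both cases.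
    refine lt_of_le_of_lt (b := 1 + ∑ N ∈ Finset.range N₀, b N) (iSup₂_le fun N hN => ?_)
      (ENNReal.add_lt_top.2 ⟨ENNReal.one_lt_top, ENNReal.sum_lt_top.2 fun N _ => hb N⟩)
    rcases le_or_gt N₀ N with h | h
    · rw [hf_large N h]
      exact ((familyNorm_mono (min_le_right _ _)).trans
        (hg.familyNorm_marginal_le (hκ0 N hN) (hκ N hN) (hN₀ N h))).trans le_self_add
    · rw [hf_small N hN h]
      refine (familyNorm_mono (min_le_left _ _)).trans (le_trans ?_ le_add_self)
      refine le_trans (le_of_eq ?_)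
        (Finset.single_le_sum (fun _ _ => zero_le) (Finset.mem_range.2 h))
      simp only [hb_def]
      rw [dif_pos hN]
  · rw [Metric.tendstoLocallyUniformlyOn_iff]
    intro η hη Z hZ
    obtain ⟨r, hr0, hr⟩ := exists_mem_hardSphere hZ
    -- As soon as ε_N < r, this whole neighbourhood lies in 𝒟_s, and the error estimate there does
    -- not depend on the point.
    refine ⟨hardSphere d r s, mem_nhdsWithin_of_mem_nhds ((isOpen_hardSphere s).mem_nhds hr), ?_⟩
    have hlim : Tendsto (fun N : ℕ => (((1 - N * κ N) ^ s)⁻¹ - 1 +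
        s * (N * κ N) * ((1 - N * κ N) ^ (s + 1))⁻¹) * Real.exp (-μ) ^ s) atTop (𝓝 0) := by
      have h1 : Tendsto (fun N : ℕ => 1 - N * κ N) atTop (𝓝 1) := by
        simpa using hNκ.const_sub 1
      have h2 := (((h1.pow s).inv₀ (by simp)).sub_const 1).add
        ((hNκ.const_mul (s : ℝ)).mul ((h1.pow (s + 1)).inv₀ (by simp)))
      simpa using h2.mul_const (Real.exp (-μ) ^ s)
    filter_upwards [eventually_gt_atTop s, eventually_ge_atTop N₀,
      (tendsto_bgDiameter hd).eventually_lt_const hr0, hlim.eventually_lt_const hη]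
      with N hsN hN hNr hNη Z' hZ'
    rw [dist_comm, Real.dist_eq, hrep s hs Z' (hardSphere_subset_offDiag hr0.le s hZ'),
      hf_large N hN]
    have hN1 : 1 ≤ N := by omega
    exact (hg.abs_marginal_sub_integral_le hβ.le (hκ0 N hN1) (hκ N hN1) (hN₀ N hN) hsN
      (hardSphere_anti hNr.le s hZ')).trans_lt hNη

end Admissible

theorem mainTheorem7 (d : ℕ) (hd : 2 ≤ d) :
    (∀ F : ∀ s, Config d s → ℝ,
      IsAdmissible F ↔
        IsMarginalFamily F ∧ ∃ β₀ : ℝ, 0 < β₀ ∧ ∃ μ₀ : ℝ, familyNorm (offDiag d) β₀ μ₀ F < ⊤) ∧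
    (∀ F : ∀ s, Config d s → ℝ, IsMarginalFamily F →
      ∀ β₀ μ₀ : ℝ, 0 < β₀ → familyNorm (offDiag d) β₀ μ₀ F < ⊤ → IsTensorMixture β₀ μ₀ F) := by
  have : Nonempty (Fin d) := ⟨⟨0, by omega⟩⟩
  refine ⟨fun F => ⟨fun h => ⟨h.1, h.exists_familyNorm_lt_top hd⟩, ?_⟩, fun F hF β₀ μ₀ hβ hnorm =>
    isTensorMixture_of_familyNorm_lt_top hF hβ hnorm⟩
  rintro ⟨hF, β₀, hβ, μ₀, hnorm⟩
  exact isAdmissible_of_familyNorm_lt_top hd hF hβ hnorm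

end
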